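/- Let $E/F$ be a quadratic extension of non-archimedean local fields, with residue field cardinalities $q_E,q_F$, rings of integers $\mathcal O_E,\mathcal O_F$, normalized valuations $\nu_E,\nu_F$ and absolute values $|x|_E=q_E^{-\nu_E(x)}$, $|x|_F=q_F^{-\nu_F(x)}$. Assume $E=F(\alpha)$ with $\alpha^2\in F$, where either $E/F$ is unramified ($q_E=q_F^2$), $|\alpha^2|_F=1$ and $q_F$ is odd, or $E/F$ is ramified ($q_E=q_F$) and $|\alpha^2|_F=q_F^{-1}$. For uniformizers $\varpi_E,\varpi_F$, characters $\chi$ of $\mathcal O_E^\times$ and $\eta$ of $\mathcal O_F^\times$, and $s,t\in\mathbb C$ put $\chi_s(x)=\chi(\varpi_E^{-\nu_E(x)}x)|x|_E^s$ $(x\in E^\times)$ and $\eta_t(y)=\eta(\varpi_F^{-\nu_F(y)}y)|y|_F^t$ $(y\in F^\times)$; the uniformizers are assumed to be chosen such that $\chi_0(\varpi_F)=1$ (e.g. $\varpi_F=\varpi_E$ in the unramified and $\varpi_F=\varpi_E^2$ in the ramified case). Let $\pi_{\chi,s}$ be the representation of $\mathrm{PGL}(2,E)$ by left translation on the space of locally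 constant functions $f$ on $\mathrm{PGL}(2,E)$ with $f\big(g\begin{pmatrix}a&b\\0&d\end{pmatrix}\big)=\chi_{s+1/2}(a/d)^{-1}f(g)$, and let $\tau_{\eta,t}$ be the representation of $\mathrm{PGL}(2,F)$ defined in the same way from $\eta_{t+1/2}$. Write $\overline n_x=\begin{pmatrix}1&0\\x&1\end{pmatrix}$. For $x=x_1+x_2\alpha\in E\setminus F$ $(x_1,x_2\in F)$ put $$K_{s,t}^{\chi,\eta}(x)=\chi_{s-\frac12}(x^2)\,(\chi_{s-\frac12}\eta_{t+\frac12})\Big(\frac{x_2}{x_1^2-x_2^2\alpha^2}\Big),$$ and let $\widetilde K_{s,t}^{\chi,\eta}=c_+\,c_-\,K_{s,t}^{\chi,\eta}$, where $c_+=1-q_F^{-(2s+t+1/2)}$ if $\chi|_{\mathcal O_F^\times}\eta=1$ and $c_+=1$ otherwise, and $c_-=1-q_F^{-(2s-t+1/2)}$ if $\chi|_{\mathcal O_F^\times}\eta^{-1}=1$ and $c_-=1$ otherwise. For $\operatorname{Re}(2s\pm t+\frac12)>0$ the function $\widetilde K_{s,t}^{\chi,\eta}$ defines a distribution on $E$ (with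 respect to the Haar measure giving $\mathcal O_E$ measure $1$). Assume $\chi^2=1$. Then: (0) The family $\widetilde K_{s,t}^{\chi,\eta}$ extends uniquely to a family of distributions on $E$ that is holomorphic in $(s,t)\in\mathbb C^2$ (i.e. its pairing with every locally constant compactly supported function is holomorphic), and for all $s,t\in\mathbb C$ there is a unique $\mathrm{PGL}(2,F)$-intertwining operator $\widetilde A_{s,t}^{\chi,\eta}:\pi_{\chi,s}|_{\mathrm{PGL}(2,F)}\to\tau_{\eta,t}$ with distribution kernel $\widetilde K_{s,t}^{\chi,\eta}$, i.e. $\widetilde A_{s,t}^{\chi,\eta}f(\overline n_y)=\langle \widetilde K_{s,t}^{\chi,\eta},f(\overline n_{\,\cdot\,+y})\rangle$ for all $y\in F$ and all $f\in\pi_{\chi,s}$ for which $x\mapsto f(\overline n_{x+y})$ is compactly supported. Let $\varphi_{\chi,s}\in\pi_{\chi,s}$ be the vector given by $\varphi_{\chi,s}(kb)=\chi_{s+\frac12}(a/d)^{-1}\chi(\det k)^{-1}$ for $k\in \mathrm{GL}(2,\mathcal O_E)$ and $b=\begin{pmatrix}a&*\\0&d\end{pmatrix}$, and for $\eta^2=1$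 let $\psi_{\eta,t}\in\tau_{\eta,t}$ be the vector defined in the same way from $\eta$ and $t$. Then for all $s,t\in\mathbb C$: (1) If $\eta\neq\chi|_{\mathcal O_F^\times}$, then $\widetilde A_{s,t}^{\chi,\eta}\varphi_{\chi,s}=0$. (2) If $\eta=\chi|_{\mathcal O_F^\times}$, then $$\widetilde A_{s,t}^{\chi,\eta}\varphi_{\chi,s}=(1-q_F^{-1})\,\psi_{\eta,t}\times\begin{cases}1-q_E^{-(2s+1)}&\text{if }E/F\text{ is unramified},\\(1-q_E^{-(2s+1)})(1+q_F^{t-\frac12})&\text{if }E/F\text{ is ramified}.\end{cases}$$ -/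

import Mathlib

open ValuativeRel MeasureTheory Topology Filter
open scoped MatrixGroups

namespace PGLBranching

set_option linter.unusedSectionVars false

noncomputable section

/-! ### Non-archimedean local fields: valuation, absolute value, quasi-characters -/

section LocalField

variable (K : Type*) [Field K] [ValuativeRel K] [TopologicalSpace K]
  [IsNonarchimedeanLocalField K]

/-- The cardinality `q_K` of the residue field. -/
def resCard : ℕ := Nat.card 𝓀[K]

variable {K}

/-- The normalized (surjective onto `ℤ` away from `0`) additive valuation `ν_K`; the value at `0`
is the junk value `0`. -/
def ord (x : K) : ℤ :=
  -WithZero.log (IsNonarchimedeanLocalField.valueGroupWithZeroIsoInt K (valuation K x))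

/-- The normalized absolute value `|x| = q_K ^ (-ν_K(x))`, `|0| = 0`. -/
def absV (x : K) : ℝ :=
  open Classical in if x = 0 then 0 else (resCard K : ℝ) ^ (-ord x)

variable (K) in
/-- Uniformizers of `K`. -/
abbrev Uniformizer := {ϖ : K // ord ϖ = 1}

/-- An element of valuation one of `K`, as a unit of the ring of integers (`1` if the valuation
is not one). -/
def unitOf (y : K) : 𝒪[K]ˣ :=
  open Classical in
  if h : valuation K y = 1 then
    { val := ⟨y, (Valuation.mem_integer_iff _ _).2 h.le⟩
      inv := ⟨y⁻¹, (Valuation.mem_integer_iff _ _).2 (by rw [map_inv₀, h, inv_one])⟩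
      val_inv := Subtype.ext (mul_inv_cancel₀ (by rintro rfl; simp at h))
      inv_val := Subtype.ext (inv_mul_cancel₀ (by rintro rfl; simp at h)) }
  else 1

/-- The quasi-character `χ_s(x) = χ(ϖ ^ (-ν(x)) x) |x| ^ s` of `Kˣ`, extended by `0` to `K`. -/
def quasiChar (χ : PontryaginDual 𝒪[K]ˣ) (ϖ : Uniformizer K) (s : ℂ) (x : K) : ℂ :=
  open Classical in
  if x = 0 then 0
  else (χ (unitOf ((ϖ : K) ^ (-ord x) * x)) : ℂ) * ((absV x : ℝ) : ℂ) ^ s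

/-- The local `L`-factor `L(z, ξ_w)`, for a character `ξ` of `𝒪ˣ` and `z w : ℂ`. -/
def localL (ξ : 𝒪[K]ˣ →* Circle) (z w : ℂ) : ℂ :=
  open Classical in if ξ = 1 then (1 - (resCard K : ℂ) ^ (-z - w))⁻¹ else 1

variable (K) in
/-- The ring of integers, as a compact set with non-empty interior. -/
def integersCompacts : TopologicalSpace.PositiveCompacts K where
  carrier := 𝒪[K]
  isCompact' := IsNonarchimedeanLocalField.isCompact_closedBall K 1
  interior_nonempty' := by
    refine ⟨0, mem_interior_iff_mem_nhds.2 ?_⟩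
    refine (IsValuativeTopology.mem_nhds_zero_iff _).2 ⟨1, fun x hx => ?_⟩
    exact (Valuation.mem_integer_iff _ _).2 (le_of_lt hx)

variable (K) in
/-- The Haar measure on `K` for which the ring of integers has measure one. -/
def haar [MeasurableSpace K] [BorelSpace K] : Measure K :=
  Measure.addHaarMeasure (integersCompacts K)

variable (K) in
/-- The space of locally constant compactly supported functions `K → ℂ`. -/
def TestFunction : Submodule ℂ (K → ℂ) where
  carrier := {u | IsLocallyConstant u ∧ HasCompactSupport u}
  zero_mem' := ⟨IsLocallyConstant.const 0, HasCompactSupport.zero⟩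
  add_mem' := fun hu hv => ⟨hu.1.add hv.1, hu.2.add hv.2⟩
  smul_mem' := fun c _ hu => ⟨hu.1.comp (fun z => c • z), hu.2.smul_left (f := fun _ => c)⟩

variable (K) in
/-- Distributions on `K`: arbitrary linear functionals on the space of test functions. -/
abbrev Distribution := TestFunction K →ₗ[ℂ] ℂ

/-! Elementary facts on valuations, needed below to construct the `K`-type vectors. -/

lemma ord_mul {x y : K} (hx : x ≠ 0) (hy : y ≠ 0) : ord (x * y) = ord x + ord y := by
  simp only [ord, map_mul]
  rw [WithZero.log_mul (by simpa using hx) (by simpa using hy)]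
  ring

@[simp] lemma ord_one : ord (1 : K) = 0 := by simp [ord]

lemma ord_inv (x : K) : ord x⁻¹ = -ord x := by
  simp only [ord, map_inv₀, WithZero.log_inv]

lemma ord_zpow (x : K) (n : ℤ) : ord (x ^ n) = n * ord x := by
  simp only [ord, map_zpow₀, WithZero.log_zpow]
  simp

lemma ord_eq_zero_iff {x : K} (hx : x ≠ 0) : ord x = 0 ↔ valuation K x = 1 := by
  constructor
  · intro h
    have h0 : IsNonarchimedeanLocalField.valueGroupWithZeroIsoInt K (valuation K x) ≠ 0 := by
      simpa using hx
    have h1 : WithZero.log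
        (IsNonarchimedeanLocalField.valueGroupWithZeroIsoInt K (valuation K x)) = 0 := by
      simpa [ord] using h
    have h2 := WithZero.exp_log h0
    rw [h1, WithZero.exp_zero] at h2
    exact (map_eq_one_iff _
      (IsNonarchimedeanLocalField.valueGroupWithZeroIsoInt K).injective).1 h2.symm
  · intro h
    simp [ord, h]

lemma one_lt_resCard : 1 < resCard K := Finite.one_lt_card

lemma absV_zero : absV (0 : K) = 0 := by simp [absV]

lemma absV_of_ne {x : K} (hx : x ≠ 0) : absV x = (resCard K : ℝ) ^ (-ord x) := by
  simp [absV, hx]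

lemma absV_pos {x : K} (hx : x ≠ 0) : 0 < absV x := by
  rw [absV_of_ne hx]
  have := one_lt_resCard (K := K)
  positivity

lemma absV_nonneg (x : K) : 0 ≤ absV x := by
  by_cases hx : x = 0
  · simp [hx, absV_zero]
  · exact (absV_pos hx).le

lemma absV_mul (x y : K) : absV (x * y) = absV x * absV y := by
  by_cases hx : x = 0
  · simp [hx, absV_zero]
  by_cases hy : y = 0
  · simp [hy, absV_zero]
  have hq : (resCard K : ℝ) ≠ 0 := by have := one_lt_resCard (K := K); positivity
  rw [absV_of_ne hx, absV_of_ne hy, absV_of_ne (mul_ne_zero hx hy), ord_mul hx hy, neg_add,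
    zpow_add₀ hq]

lemma absV_le_absV {x y : K} (h : valuation K x ≤ valuation K y) : absV x ≤ absV y := by
  by_cases hx : x = 0
  · simp [hx, absV_zero, absV_nonneg]
  have hy : y ≠ 0 := by
    rintro rfl
    simp at h
    exact hx h
  rw [absV_of_ne hx, absV_of_ne hy]
  refine zpow_le_zpow_right₀ (by exact_mod_cast one_lt_resCard.le) ?_
  simp only [ord, neg_neg]
  refine (WithZero.log_le_log (by simpa using hx) (by simpa using hy)).2 ?_
  exact (map_le_map_iff (IsNonarchimedeanLocalField.valueGroupWithZeroIsoInt K)).2 h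

lemma absV_eq_absV {x y : K} (h : valuation K x = valuation K y) : absV x = absV y :=
  le_antisymm (absV_le_absV h.le) (absV_le_absV h.ge)

lemma unitOf_val {y : K} (h : valuation K y = 1) : ((unitOf y : 𝒪[K]) : K) = y := by
  simp [unitOf, h]

lemma unitOf_inv_val {y : K} (h : valuation K y = 1) :
    (((unitOf y)⁻¹ : 𝒪[K]ˣ) : 𝒪[K]) = (y⁻¹ : K) := by
  have : unitOf y = { val := ⟨y, (Valuation.mem_integer_iff _ _).2 h.le⟩
                      inv := ⟨y⁻¹, (Valuation.mem_integer_iff _ _).2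
                        (by rw [map_inv₀, h, inv_one])⟩
                      val_inv := Subtype.ext (mul_inv_cancel₀ (by rintro rfl; simp at h))
                      inv_val := Subtype.ext (inv_mul_cancel₀ (by rintro rfl; simp at h)) } := by
    simp [unitOf, h]
  rw [this]
  rfl

lemma unitOf_mul {x y : K} (hx : valuation K x = 1) (hy : valuation K y = 1) :
    unitOf (x * y) = unitOf x * unitOf y := by
  ext
  rw [unitOf_val (by simp [hx, hy])]
  simp [unitOf_val hx, unitOf_val hy]

lemma Uniformizer.ne_zero (ϖ : Uniformizer K) : (ϖ : K) ≠ 0 := by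
  intro h
  have := ϖ.2
  rw [h] at this
  simp [ord] at this

lemma valuation_unitPart (ϖ : Uniformizer K) {x : K} (hx : x ≠ 0) :
    valuation K ((ϖ : K) ^ (-ord x) * x) = 1 := by
  have h0 := zpow_ne_zero (-ord x) ϖ.ne_zero
  rw [← ord_eq_zero_iff (mul_ne_zero h0 hx), ord_mul h0 hx, ord_zpow, ϖ.2]
  ring

lemma quasiChar_of_ne (χ : PontryaginDual 𝒪[K]ˣ) (ϖ : Uniformizer K) (s : ℂ) {x : K}
    (hx : x ≠ 0) : quasiChar χ ϖ s x =
      (χ (unitOf ((ϖ : K) ^ (-ord x) * x)) : ℂ) * ((absV x : ℝ) : ℂ) ^ s := by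
  simp [quasiChar, hx]

lemma quasiChar_mul (χ : PontryaginDual 𝒪[K]ˣ) (ϖ : Uniformizer K) (s : ℂ) (x y : K) :
    quasiChar χ ϖ s (x * y) = quasiChar χ ϖ s x * quasiChar χ ϖ s y := by
  by_cases hx : x = 0
  · simp [hx, quasiChar]
  by_cases hy : y = 0
  · simp [hy, quasiChar]
  rw [quasiChar_of_ne _ _ _ hx, quasiChar_of_ne _ _ _ hy,
    quasiChar_of_ne _ _ _ (mul_ne_zero hx hy)]
  have h : (ϖ : K) ^ (-ord (x * y)) * (x * y)
      = ((ϖ : K) ^ (-ord x) * x) * ((ϖ : K) ^ (-ord y) * y) := by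
    rw [ord_mul hx hy, neg_add, zpow_add₀ ϖ.ne_zero]
    ring
  rw [h, unitOf_mul (valuation_unitPart ϖ hx) (valuation_unitPart ϖ hy), map_mul, absV_mul,
    Complex.ofReal_mul, Complex.mul_cpow_ofReal_nonneg (absV_nonneg x) (absV_nonneg y),
    Circle.coe_mul]
  ring

lemma quasiChar_ne_zero (χ : PontryaginDual 𝒪[K]ˣ) (ϖ : Uniformizer K) (s : ℂ) {x : K}
    (hx : x ≠ 0) : quasiChar χ ϖ s x ≠ 0 := by
  rw [quasiChar_of_ne _ _ _ hx]
  refine mul_ne_zero (Circle.coe_ne_zero _) ?_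
  rw [Complex.cpow_def_of_ne_zero (by exact_mod_cast (absV_pos hx).ne')]
  exact Complex.exp_ne_zero _

lemma pontryaginDual_sq_apply {A : Type*} [Monoid A] [TopologicalSpace A]
    (χ : PontryaginDual A) (u : A) : (χ ^ 2) u = χ u ^ 2 := by
  rw [pow_two, pow_two]
  rfl

lemma quasiChar_sq {χ : PontryaginDual 𝒪[K]ˣ} (hχ : χ ^ 2 = 1) (ϖ : Uniformizer K) (s : ℂ)
    {x : K} (hx : x ≠ 0) : quasiChar χ ϖ s x ^ 2 = ((absV x : ℝ) : ℂ) ^ (2 * s) := by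
  have h1 : ∀ u, χ u ^ 2 = 1 := fun u => by
    rw [← pontryaginDual_sq_apply, hχ, PontryaginDual.one_apply]
  rw [quasiChar_of_ne _ _ _ hx, mul_pow, ← Circle.coe_pow, h1, Circle.coe_one, one_mul,
    ← Complex.cpow_nat_mul]
  norm_num

lemma quasiChar_unit (χ : PontryaginDual 𝒪[K]ˣ) (ϖ : Uniformizer K) (s : ℂ) (u : 𝒪[K]ˣ) :
    quasiChar χ ϖ s ((u : 𝒪[K]) : K) = χ u := by
  have hv : valuation K ((u : 𝒪[K]) : K) = 1 := by
    have h1 : valuation K ((u : 𝒪[K]) : K) ≤ 1 := (u : 𝒪[K]).2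
    have h2 : valuation K (((u⁻¹ : 𝒪[K]ˣ) : 𝒪[K]) : K) ≤ 1 := ((u⁻¹ : 𝒪[K]ˣ) : 𝒪[K]).2
    have h3 : valuation K ((u : 𝒪[K]) : K) * valuation K (((u⁻¹ : 𝒪[K]ˣ) : 𝒪[K]) : K) = 1 := by
      rw [← map_mul, ← Subring.coe_mul, Units.mul_inv]
      simp
    refine le_antisymm h1 ?_
    rw [← h3]
    exact mul_le_of_le_one_right' h2
  have h0 : ((u : 𝒪[K]) : K) ≠ 0 := by
    intro h
    rw [h] at hv
    simp at hv
  have ho : ord ((u : 𝒪[K]) : K) = 0 := (ord_eq_zero_iff h0).2 hv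
  rw [quasiChar_of_ne _ _ _ h0, absV_of_ne h0, ho]
  have hu : unitOf ((u : 𝒪[K]) : K) = u := by
    ext
    exact unitOf_val hv
  simp [hu]

lemma eventually_valuation_sub_lt (c : K) {γ : ValueGroupWithZero K} (hγ : γ ≠ 0) :
    ∀ᶠ x in 𝓝 c, valuation K (x - c) < γ := by
  have h : ∀ᶠ x in 𝓝 (0 : K), valuation K x < γ :=
    (IsValuativeTopology.mem_nhds_zero_iff _).2 ⟨Units.mk0 γ hγ, fun x hx => hx⟩
  have ht : Tendsto (fun x : K => x - c) (𝓝 c) (𝓝 0) := by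
    have : Continuous (fun x : K => x - c) := by fun_prop
    simpa using this.tendsto c
  exact ht.eventually h

lemma valuation_eq_of_sub_lt {x c : K} (h : valuation K (x - c) < valuation K c) :
    valuation K x = valuation K c := Valuation.map_eq_of_sub_lt _ h

lemma tendsto_unitOf : Tendsto (unitOf : K → 𝒪[K]ˣ) (𝓝 1) (𝓝 1) := by
  have hv : ∀ᶠ x in 𝓝 (1 : K), valuation K x = 1 := by
    filter_upwards [eventually_valuation_sub_lt (1 : K) one_ne_zero] with x hx
    exact (valuation_eq_of_sub_lt (hx.trans_eq (map_one _).symm)).trans (map_one _)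
  rw [Units.isInducing_embedProduct.tendsto_nhds_iff]
  refine Filter.Tendsto.prodMk_nhds ?_ ?_
  · rw [tendsto_subtype_rng]
    refine Tendsto.congr' ?_ (tendsto_id (x := 𝓝 (1 : K)))
    filter_upwards [hv] with x hx
    exact (unitOf_val hx).symm
  · refine (MulOpposite.continuous_op.tendsto _).comp (y := 𝓝 (1 : 𝒪[K])) ?_
    rw [tendsto_subtype_rng]
    have h := tendsto_inv₀ (one_ne_zero (α := K))
    rw [inv_one] at h
    refine Tendsto.congr' ?_ h
    filter_upwards [hv] with x hx
    exact (unitOf_inv_val hx).symm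

lemma eventually_quasiChar_eq {χ : PontryaginDual 𝒪[K]ˣ} (hχ : χ ^ 2 = 1) (ϖ : Uniformizer K)
    (s : ℂ) {c : K} (hc : c ≠ 0) :
    ∀ᶠ x in 𝓝 c, quasiChar χ ϖ s x = quasiChar χ ϖ s c := by
  have h1 : ∀ᶠ w in 𝓝 (1 : K), quasiChar χ ϖ s w = 1 := by
    have hN : ∀ᶠ u in 𝓝 (1 : 𝒪[K]ˣ), χ u ≠ -1 := by
      have hcont : Tendsto χ (𝓝 1) (𝓝 1) := by
        simpa using (map_continuous χ).tendsto 1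
      refine hcont.eventually_ne ?_
      intro h
      have := congrArg (fun z : Circle => (z : ℂ)) h
      norm_num at this
    filter_upwards [tendsto_unitOf.eventually hN,
      eventually_valuation_sub_lt (1 : K) one_ne_zero] with w hw hv
    have hw1 : valuation K w = 1 :=
      (valuation_eq_of_sub_lt (hv.trans_eq (map_one _).symm)).trans (map_one _)
    have hq := quasiChar_unit χ ϖ s (unitOf w)
    rw [unitOf_val hw1] at hq
    rw [hq]
    have h2 : (χ (unitOf w) : ℂ) ^ 2 = 1 := by
      have h3 : χ (unitOf w) ^ 2 = 1 := by
        rw [← pontryaginDual_sq_apply, hχ, PontryaginDual.one_apply]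
      rw [← Circle.coe_pow, h3, Circle.coe_one]
    rcases sq_eq_one_iff.1 h2 with h | h
    · exact h
    · exact absurd (Circle.ext (by simpa using h)) hw
  have ht : Tendsto (fun x : K => x * c⁻¹) (𝓝 c) (𝓝 1) := by
    have : Continuous (fun x : K => x * c⁻¹) := by fun_prop
    simpa [hc] using this.tendsto c
  filter_upwards [ht.eventually h1] with x hx
  have : x = (x * c⁻¹) * c := by field_simp
  rw [this, quasiChar_mul, hx, one_mul]

lemma eventually_max_absV_eq (p : K × K) (hp : p ≠ 0) :
    ∀ᶠ x in 𝓝 p, max (absV x.1) (absV x.2) = max (absV p.1) (absV p.2) := by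
  have key : ∀ a b : K, a ≠ 0 → valuation K b ≤ valuation K a →
      ∀ᶠ x in 𝓝 (a, b), absV x.1 = absV a ∧ absV x.2 ≤ absV a := by
    intro a b ha hab
    have hγ : valuation K a ≠ 0 := by simpa using ha
    have h1 := (continuous_fst.tendsto (a, b)).eventually (eventually_valuation_sub_lt a hγ)
    have h2 := (continuous_snd.tendsto (a, b)).eventually (eventually_valuation_sub_lt b hγ)
    filter_upwards [h1, h2] with x hx1 hx2
    refine ⟨absV_eq_absV (valuation_eq_of_sub_lt hx1), absV_le_absV ?_⟩
    have : x.2 = (x.2 - b) + b := by ring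
    rw [this]
    exact (Valuation.map_add _ _ _).trans (max_le hx2.le hab)
  obtain ⟨a, b⟩ := p
  rcases le_total (valuation K b) (valuation K a) with hab | hab
  · have ha : a ≠ 0 := by
      rintro rfl
      simp at hab
      exact hp (by simp [hab])
    filter_upwards [key a b ha hab] with x hx
    rw [hx.1, max_eq_left hx.2, max_eq_left (absV_le_absV hab)]
  · have hb : b ≠ 0 := by
      rintro rfl
      simp at hab
      exact hp (by simp [hab])
    have := (continuous_swap.tendsto (a, b)).eventually (key b a hb hab)
    filter_upwards [this] with x hx
    simp only [Prod.fst_swap, Prod.snd_swap] at hx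
    rw [hx.1, max_eq_right hx.2, max_eq_right (absV_le_absV hab)]

/-! ### Principal series of `PGL(2, K)` -/

/-- The lower triangular unipotent matrix with lower left entry `x`. -/
def lowerUnip (x : K) : GL (Fin 2) K :=
  Matrix.GeneralLinearGroup.mkOfDetNeZero !![1, 0; x, 1] (by simp)

/-- The space of the normalized principal series: functions `f` on `PGL(2, K)` which are locally
constant (equivalently, whose pull-back to `GL(2, K)` is locally constant, `PGL(2, K)` carrying the
quotient topology) and satisfy `f(g b) = χ_{s + 1/2}(b)⁻¹ f(g)` for all upper triangular `b`, where
`χ_s` takes the value `χ_s(b₀₀ / b₁₁)` at `b`. -/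
def principalSeries (χ : PontryaginDual 𝒪[K]ˣ) (ϖ : Uniformizer K) (s : ℂ) :
    Submodule ℂ (PGL(2, K) → ℂ) where
  carrier := {f | IsLocallyConstant (fun g : GL (Fin 2) K => f (.mk g)) ∧
    ∀ (g : PGL(2, K)) (b : GL (Fin 2) K), b 1 0 = 0 →
      f (g * .mk b) = (quasiChar χ ϖ (s + 1 / 2) (b 0 0 / b 1 1))⁻¹ * f g}
  zero_mem' := ⟨IsLocallyConstant.const 0, by simp⟩
  add_mem' := fun hf hg => ⟨hf.1.add hg.1, fun g b hb => by
    simp only [Pi.add_apply, hf.2 g b hb, hg.2 g b hb, mul_add]⟩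
  smul_mem' := fun c f hf => ⟨hf.1.comp (fun z => c • z), fun g b hb => by
    simp only [Pi.smul_apply, hf.2 g b hb, smul_eq_mul]
    ring⟩

/-- The principal series representation: `PGL(2, K)` acts by left translation. -/
def principalSeriesRep (χ : PontryaginDual 𝒪[K]ˣ) (ϖ : Uniformizer K) (s : ℂ) :
    Representation ℂ PGL(2, K) (principalSeries χ ϖ s) where
  toFun g :=
    { toFun := fun f => ⟨fun x => (f : PGL(2, K) → ℂ) (g⁻¹ * x), by
        induction g using Matrix.ProjGenLinGroup.induction_on with | mk g =>
        refine ⟨?_, fun x b hb => ?_⟩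
        · exact f.2.1.comp_continuous (f := fun x => g⁻¹ * x) (continuous_const_mul g⁻¹)
        · have h := f.2.2 ((Matrix.ProjGenLinGroup.mk g)⁻¹ * x) b hb
          rwa [mul_assoc] at h⟩
      map_add' := fun _ _ => rfl
      map_smul' := fun _ _ => rfl }
  map_one' := by
    ext f x
    simp
  map_mul' g h := by
    ext f x
    simp [mul_assoc]

/-- The function on `GL(2, K)` underlying the normalized `K`-type vector. -/
def typeVectorFun (χ : PontryaginDual 𝒪[K]ˣ) (ϖ : Uniformizer K) (s : ℂ) (g : GL (Fin 2) K) : ℂ :=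
  quasiChar χ ϖ (s + 1 / 2) (Matrix.det (g : Matrix (Fin 2) (Fin 2) K)) *
    ((max (absV (g 0 0)) (absV (g 1 0)) : ℝ) : ℂ) ^ (-(2 * s + 1))

lemma GL_det_ne_zero (g : GL (Fin 2) K) : Matrix.det (g : Matrix (Fin 2) (Fin 2) K) ≠ 0 :=
  g.det.ne_zero

lemma GL_column_ne_zero (g : GL (Fin 2) K) : ((g 0 0, g 1 0) : K × K) ≠ 0 := by
  intro h
  have h1 : g 0 0 = 0 := congrArg Prod.fst h
  have h2 : g 1 0 = 0 := congrArg Prod.snd h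
  apply GL_det_ne_zero g
  rw [Matrix.det_fin_two, h1, h2]
  ring

lemma typeVectorFun_mul {χ : PontryaginDual 𝒪[K]ˣ} (hχ : χ ^ 2 = 1) (ϖ : Uniformizer K) (s : ℂ)
    (g b : GL (Fin 2) K) (hb : b 1 0 = 0) :
    typeVectorFun χ ϖ s (g * b) =
      (quasiChar χ ϖ (s + 1 / 2) (b 0 0 / b 1 1))⁻¹ * typeVectorFun χ ϖ s g := by
  have hdet : Matrix.det (b : Matrix (Fin 2) (Fin 2) K) = b 0 0 * b 1 1 := by
    rw [Matrix.det_fin_two, hb]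
    ring
  have hne : b 0 0 * b 1 1 ≠ 0 := hdet ▸ GL_det_ne_zero b
  have h0 : b 0 0 ≠ 0 := left_ne_zero_of_mul hne
  have h1 : b 1 1 ≠ 0 := right_ne_zero_of_mul hne
  have e0 : (g * b) 0 0 = g 0 0 * b 0 0 := by
    simp [Matrix.mul_apply, Fin.sum_univ_two, hb]
  have e1 : (g * b) 1 0 = g 1 0 * b 0 0 := by
    simp [Matrix.mul_apply, Fin.sum_univ_two, hb]
  have hsq := quasiChar_sq hχ ϖ (s + 1 / 2) h0
  have hpos : ((absV (b 0 0) : ℝ) : ℂ) ≠ 0 := by exact_mod_cast (absV_pos h0).ne'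
  have hexp : ((absV (b 0 0) : ℝ) : ℂ) ^ (-(2 * s + 1)) =
      (quasiChar χ ϖ (s + 1 / 2) (b 0 0) ^ 2)⁻¹ := by
    rw [hsq, ← Complex.cpow_neg]
    congr 1
    ring
  have hq0 := quasiChar_ne_zero χ ϖ (s + 1 / 2) h0
  have hq1 := quasiChar_ne_zero χ ϖ (s + 1 / 2) h1
  have hdiv : quasiChar χ ϖ (s + 1 / 2) (b 0 0) =
      quasiChar χ ϖ (s + 1 / 2) (b 0 0 / b 1 1) * quasiChar χ ϖ (s + 1 / 2) (b 1 1) := by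
    rw [← quasiChar_mul, div_mul_cancel₀ _ h1]
  have hqd := quasiChar_ne_zero χ ϖ (s + 1 / 2) (div_ne_zero h0 h1)
  rw [typeVectorFun, typeVectorFun, e0, e1, absV_mul, absV_mul,
    ← max_mul_of_nonneg _ _ (absV_nonneg _), Complex.ofReal_mul,
    Complex.mul_cpow_ofReal_nonneg (le_max_of_le_left (absV_nonneg _)) (absV_nonneg _), hexp,
    Units.val_mul, Matrix.det_mul, hdet, quasiChar_mul, quasiChar_mul, hdiv]
  generalize quasiChar χ ϖ (s + 1 / 2) (b 0 0 / b 1 1) = X at hqd ⊢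
  generalize quasiChar χ ϖ (s + 1 / 2) (b 1 1) = Y at hq1 ⊢
  generalize quasiChar χ ϖ (s + 1 / 2) (Matrix.det (g : Matrix (Fin 2) (Fin 2) K)) = Z
  field_simp

lemma typeVectorFun_congr {χ : PontryaginDual 𝒪[K]ˣ} (hχ : χ ^ 2 = 1) (ϖ : Uniformizer K) (s : ℂ)
    {g h : GL (Fin 2) K} (e : (Matrix.ProjGenLinGroup.mk g : PGL(2, K)) = .mk h) :
    typeVectorFun χ ϖ s g = typeVectorFun χ ϖ s h := by
  obtain ⟨u, hu⟩ := Matrix.ProjGenLinGroup.mk_eq_mk_iff.1 e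
  have h1 : quasiChar χ ϖ (s + 1 / 2) 1 = 1 := by
    simpa using quasiChar_unit χ ϖ (s + 1 / 2) 1
  have h2 : (Matrix.GeneralLinearGroup.scalar (Fin 2) u : GL (Fin 2) K) 0 0 /
      (Matrix.GeneralLinearGroup.scalar (Fin 2) u : GL (Fin 2) K) 1 1 = 1 := by
    simp
  rw [← hu, typeVectorFun_mul hχ ϖ s _ _ (by simp), h2, h1, inv_one, one_mul]

lemma isLocallyConstant_typeVectorFun {χ : PontryaginDual 𝒪[K]ˣ} (hχ : χ ^ 2 = 1)
    (ϖ : Uniformizer K) (s : ℂ) : IsLocallyConstant (typeVectorFun χ ϖ s) := by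
  rw [IsLocallyConstant.iff_eventually_eq]
  intro g
  have hval : Continuous (fun x : GL (Fin 2) K => (x : Matrix (Fin 2) (Fin 2) K)) :=
    Units.continuous_val
  have hdet : Continuous (fun x : GL (Fin 2) K => Matrix.det (x : Matrix (Fin 2) (Fin 2) K)) :=
    hval.matrix_det
  have hcol : Continuous (fun x : GL (Fin 2) K => ((x 0 0, x 1 0) : K × K)) :=
    (hval.matrix_elem 0 0).prodMk (hval.matrix_elem 1 0)
  filter_upwards [(hdet.tendsto g).eventually
      (eventually_quasiChar_eq hχ ϖ (s + 1 / 2) (GL_det_ne_zero g)),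
    (hcol.tendsto g).eventually (eventually_max_absV_eq _ (GL_column_ne_zero g))] with x hx1 hx2
  rw [typeVectorFun, typeVectorFun, hx1, hx2]

/-- For `χ² = 1`, the vector `φ` of the principal series on which `PGL(2, 𝒪)` acts by the character
`χ ∘ det`, normalized by `φ(1) = 1`. It is given by `φ(k b) = χ_{s + 1/2}(b)⁻¹ χ(det k)⁻¹`, see
`typeVector_mul` below. -/
def typeVector (χ : PontryaginDual 𝒪[K]ˣ) (hχ : χ ^ 2 = 1) (ϖ : Uniformizer K) (s : ℂ) :
    principalSeries χ ϖ s :=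
  ⟨fun g => typeVectorFun χ ϖ s (Function.surjInv Matrix.ProjGenLinGroup.mk_surjective g), by
    have key : ∀ g : GL (Fin 2) K, typeVectorFun χ ϖ s
        (Function.surjInv Matrix.ProjGenLinGroup.mk_surjective (.mk g)) =
          typeVectorFun χ ϖ s g := fun g =>
      typeVectorFun_congr hχ ϖ s (Function.surjInv_eq Matrix.ProjGenLinGroup.mk_surjective _)
    refine ⟨?_, fun g b hb => ?_⟩
    · simpa only [key] using isLocallyConstant_typeVectorFun hχ ϖ s
    · induction g using Matrix.ProjGenLinGroup.induction_on with | mk g =>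
      have h := typeVectorFun_mul hχ ϖ s g b hb
      rw [← key, ← key g, map_mul] at h
      exact h⟩

lemma typeVector_mk {χ : PontryaginDual 𝒪[K]ˣ} (hχ : χ ^ 2 = 1) (ϖ : Uniformizer K) (s : ℂ)
    (g : GL (Fin 2) K) :
    (typeVector χ hχ ϖ s : PGL(2, K) → ℂ) (.mk g) = typeVectorFun χ ϖ s g :=
  typeVectorFun_congr hχ ϖ s (Function.surjInv_eq Matrix.ProjGenLinGroup.mk_surjective _)

/-- The formula `φ(k b) = χ_{s + 1/2}(b)⁻¹ χ(det k)⁻¹` for `k ∈ GL(2, 𝒪)` and `b` upper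
triangular. -/
theorem typeVector_mul {χ : PontryaginDual 𝒪[K]ˣ} (hχ : χ ^ 2 = 1) (ϖ : Uniformizer K) (s : ℂ)
    (k : GL (Fin 2) 𝒪[K]) (b : GL (Fin 2) K) (hb : b 1 0 = 0) :
    (typeVector χ hχ ϖ s : PGL(2, K) → ℂ)
        (.mk (Matrix.GeneralLinearGroup.map 𝒪[K].subtype k) * .mk b) =
      (quasiChar χ ϖ (s + 1 / 2) (b 0 0 / b 1 1))⁻¹ * (χ k.det : ℂ)⁻¹ := by
  rw [← map_mul, typeVector_mk, typeVectorFun_mul hχ ϖ s _ _ hb]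
  congr 1
  have hdet : Matrix.det ((Matrix.GeneralLinearGroup.map 𝒪[K].subtype k : GL (Fin 2) K) :
      Matrix (Fin 2) (Fin 2) K) = ((k.det : 𝒪[K]) : K) := by
    simp [Matrix.det_fin_two]
  have hmax : max (absV ((k 0 0 : 𝒪[K]) : K)) (absV ((k 1 0 : 𝒪[K]) : K)) = 1 := by
    have h1 : absV (1 : K) = 1 := by simp [absV]
    have hle : ∀ x : 𝒪[K], absV (x : K) ≤ 1 := fun x => by
      rw [← h1]
      refine absV_le_absV ?_
      rw [map_one]
      exact x.2
    refine le_antisymm (max_le (hle _) (hle _)) ?_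
    by_contra hlt
    have hlt := max_lt_iff.1 (not_le.1 hlt)
    have hv : ∀ x : 𝒪[K], absV (x : K) < 1 → valuation K (x : K) < 1 := fun x hx => by
      by_contra h
      refine absurd hx (not_lt.2 ?_)
      rw [← h1]
      refine absV_le_absV ?_
      rw [map_one]
      exact not_lt.1 h
    have hd : valuation K ((k.det : 𝒪[K]) : K) < 1 := by
      rw [← hdet, Matrix.det_fin_two]
      refine (Valuation.map_sub _ _ _).trans_lt (max_lt ?_ ?_)
      · rw [map_mul]
        exact mul_lt_one_of_nonneg_of_lt_one_left zero_le (hv _ hlt.1) (k 1 1).2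
      · rw [map_mul]
        exact mul_lt_one_of_nonneg_of_lt_one_right (k 0 1).2 zero_le (hv _ hlt.2)
    have hu : valuation K ((k.det : 𝒪[K]) : K) * valuation K ((k.det⁻¹ : 𝒪[K]ˣ) : 𝒪[K]) = 1 := by
      rw [← map_mul, ← Subring.coe_mul, Units.mul_inv]
      simp
    exact absurd hu (mul_lt_one_of_nonneg_of_lt_one_left zero_le hd ((k.det⁻¹ : 𝒪[K]ˣ) : 𝒪[K]).2).ne
  have hq := quasiChar_unit χ ϖ (s + 1 / 2) k.det
  have hm : ((max (absV ((Matrix.GeneralLinearGroup.map 𝒪[K].subtype k : GL (Fin 2) K) 0 0))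
      (absV ((Matrix.GeneralLinearGroup.map 𝒪[K].subtype k : GL (Fin 2) K) 1 0)) : ℝ) : ℂ) = 1 := by
    exact_mod_cast hmax
  rw [typeVectorFun, hm, hdet, hq, Complex.one_cpow, mul_one]
  have h2 : (χ k.det : ℂ) * χ k.det = 1 := by
    rw [← Circle.coe_mul, ← pow_two, ← pontryaginDual_sq_apply, hχ, PontryaginDual.one_apply,
      Circle.coe_one]
  exact eq_inv_of_mul_eq_one_left h2

end LocalField

/-! ### Symmetry breaking for a quadratic extension `E / F` -/

section Extension

variable {F E : Type*}
  [Field F] [ValuativeRel F] [TopologicalSpace F] [IsNonarchimedeanLocalField F]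
  [Field E] [ValuativeRel E] [TopologicalSpace E] [IsNonarchimedeanLocalField E]
  [Algebra F E] [ValuativeExtension F E]

variable (F E) in
/-- The inclusion of the rings of integers. -/
def integersMap : 𝒪[F] →+* 𝒪[E] :=
  ((algebraMap F E).comp 𝒪[F].subtype).codRestrict 𝒪[E] fun x => by
    have h : (x : F) ≤ᵥ 1 := ((valuation F).vle_one_iff).2 x.2
    have h2 := (ValuativeExtension.vle_iff_vle (B := E) (x : F) 1).2 h
    rw [map_one] at h2
    exact ((valuation E).vle_one_iff).1 h2

variable (F) in
/-- The restriction of a character of `𝒪_Eˣ` to `𝒪_Fˣ`. -/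
def resChar (χ : PontryaginDual 𝒪[E]ˣ) : 𝒪[F]ˣ →* Circle :=
  (χ : 𝒪[E]ˣ →* Circle).comp (Units.map (integersMap F E).toMonoidHom)

lemma sq_eq_one_of_resChar_eq {χ : PontryaginDual 𝒪[E]ˣ} (hχ : χ ^ 2 = 1)
    {η : PontryaginDual 𝒪[F]ˣ} (h : (η : 𝒪[F]ˣ →* Circle) = resChar F χ) : η ^ 2 = 1 := by
  refine PontryaginDual.ext fun u => ?_
  have hu : η u = resChar F χ u := DFunLike.congr_fun h u
  rw [pontryaginDual_sq_apply, hu, PontryaginDual.one_apply]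
  change χ _ ^ 2 = 1
  rw [← pontryaginDual_sq_apply, hχ, PontryaginDual.one_apply]

/-- The coordinates `(x₁, x₂)` of `x = x₁ + x₂ α`. -/
def coords (F : Type*) {E : Type*} [Field F] [Field E] [Algebra F E] (α x : E) : F × F :=
  Classical.epsilon fun p => algebraMap F E p.1 + algebraMap F E p.2 * α = x

/-- The kernel `K_{s,t}(x) = χ_{s-1/2}(x²) (χ_{s-1/2} η_{t+1/2})(x₂ / (x₁² - x₂² α²))` for
`x = x₁ + x₂ α ∈ E ∖ F` (and `0` for `x ∈ F`), where `α² = a ∈ F`. -/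
def kernelFun (χ : PontryaginDual 𝒪[E]ˣ) (η : PontryaginDual 𝒪[F]ˣ) (ϖE : Uniformizer E)
    (ϖF : Uniformizer F) (α : E) (a : F) (s t : ℂ) (x : E) : ℂ :=
  let y : F := (coords F α x).2 / ((coords F α x).1 ^ 2 - (coords F α x).2 ^ 2 * a)
  quasiChar χ ϖE (s - 1 / 2) (x ^ 2) *
    (quasiChar χ ϖE (s - 1 / 2) (algebraMap F E y) * quasiChar η ϖF (t + 1 / 2) y)

/-- The normalizing factor `L(1/2, χ_s|_F η_t)⁻¹ L(1/2, χ_s|_F η_t⁻¹)⁻¹`. Here the restriction of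
`χ_s` to `Fˣ` is `(χ|_{𝒪_Fˣ})_{2s}`, the uniformizers being chosen such that `χ_0(ϖ_F) = 1`. -/
def normFactor (χ : PontryaginDual 𝒪[E]ˣ) (η : PontryaginDual 𝒪[F]ˣ) (s t : ℂ) : ℂ :=
  (localL (resChar F χ * (η : 𝒪[F]ˣ →* Circle)) (1 / 2) (2 * s + t))⁻¹ *
    (localL (resChar F χ * (η : 𝒪[F]ˣ →* Circle)⁻¹) (1 / 2) (2 * s - t))⁻¹

variable [MeasurableSpace E] [BorelSpace E]

/-- `Kt` is the holomorphic extension to `ℂ²` of the family of distributions given, where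
`Re(2s ± t + 1/2) > 0`, by the renormalized locally integrable kernel. -/
def IsRenormalizedKernel (χ : PontryaginDual 𝒪[E]ˣ) (η : PontryaginDual 𝒪[F]ˣ)
    (ϖE : Uniformizer E) (ϖF : Uniformizer F) (α : E) (a : F)
    (Kt : ℂ → ℂ → Distribution E) : Prop :=
  (∀ u : TestFunction E, Differentiable ℂ (fun p : ℂ × ℂ => Kt p.1 p.2 u)) ∧
  ∀ s t : ℂ, 0 < (2 * s + t + 1 / 2).re → 0 < (2 * s - t + 1 / 2).re → ∀ u : TestFunction E,
    Kt s t u = normFactor χ η s t *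
      ∫ x, kernelFun χ η ϖE ϖF α a s t x * (u : E → ℂ) x ∂(haar E)

/-- The renormalized kernel, i.e. the family of distributions singled out by
`IsRenormalizedKernel`. -/
def renormalizedKernel (χ : PontryaginDual 𝒪[E]ˣ) (η : PontryaginDual 𝒪[F]ˣ)
    (ϖE : Uniformizer E) (ϖF : Uniformizer F) (α : E) (a : F) : ℂ → ℂ → Distribution E :=
  Classical.epsilon (IsRenormalizedKernel χ η ϖE ϖF α a)

/-- Symmetry breaking operators, i.e. `PGL(2, F)`-intertwining operators from the restriction of
the principal series of `PGL(2, E)` to the principal series of `PGL(2, F)`. -/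
abbrev SymmetryBreakingOperator (χ : PontryaginDual 𝒪[E]ˣ) (η : PontryaginDual 𝒪[F]ˣ)
    (ϖE : Uniformizer E) (ϖF : Uniformizer F) (s t : ℂ) :=
  Representation.IntertwiningMap
    ((principalSeriesRep χ ϖE s).comp (Matrix.ProjGenLinGroup.map (algebraMap F E)))
    (principalSeriesRep η ϖF t)

/-- `A` has distribution kernel `D`: `A f(n_y) = ∫ D(x) f(n_{x+y}) dx` for all `y ∈ F` and all `f`
for which `x ↦ f(n_{x+y})` is a test function, `n_x` being the lower triangular unipotent matrix. -/
def HasKernel {χ : PontryaginDual 𝒪[E]ˣ} {η : PontryaginDual 𝒪[F]ˣ} {ϖE : Uniformizer E}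
    {ϖF : Uniformizer F} {s t : ℂ} (A : SymmetryBreakingOperator χ η ϖE ϖF s t)
    (D : Distribution E) : Prop :=
  ∀ (f : principalSeries χ ϖE s) (y : F) (u : TestFunction E),
    (∀ x : E, (u : E → ℂ) x = (f : PGL(2, E) → ℂ) (.mk (lowerUnip (x + algebraMap F E y)))) →
    (A f : PGL(2, F) → ℂ) (.mk (lowerUnip y)) = D u

/-- The symmetry breaking operator whose distribution kernel is the renormalized kernel. -/
def renormalizedOperator (χ : PontryaginDual 𝒪[E]ˣ) (η : PontryaginDual 𝒪[F]ˣ)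
    (ϖE : Uniformizer E) (ϖF : Uniformizer F) (α : E) (a : F) (s t : ℂ) :
    SymmetryBreakingOperator χ η ϖE ϖF s t :=
  haveI : Nonempty (SymmetryBreakingOperator χ η ϖE ϖF s t) := ⟨0⟩
  Classical.epsilon fun A => HasKernel A (renormalizedKernel χ η ϖE ϖF α a s t)

end Extension

end
end PGLBranching

open PGLBranching

namespace PGLBranching

set_option linter.unusedSectionVars false

noncomputable section

/-! ### The absolute value of a local field -/

section LocalField

variable {K : Type*} [Field K] [ValuativeRel K] [TopologicalSpace K]
  [IsNonarchimedeanLocalField K]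

/-! The proof replaces `x` by `z = 1/x`, that is, it works in the chart `dualMat z` of the
projective line instead of `lowerUnip x`. Since `x₂ / (x₁² - x₂² a)` is minus the `α`-coordinate of
`1/x`, and since `χ² = 1`, the kernel in the new chart is `λ(-Im z)`, where `λ` is the
quasi-character `mixedChar` of `Fˣ` and `Im` is the second coordinate (`kernelFun_inv`,
`integral_kernelFun_mul`). Upper triangular matrices over `F` act on this chart by affine maps `z ↦
r z + b` with `r, b ∈ F`, and `λ(-Im z)` is invariant under the translations and homogeneous under
the dilations. Integration against it is therefore a functional on `π_{χ,s}` with exactly the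
equivariance needed for `g ↦ ∫ λ(-Im z) f(g · dualMat z) dz` to lie in `τ_{η,t}`.

The integral has two sources of divergence. Near `F` it needs `Re(2s+t+1/2) > 0`, near infinity
`Re(2s-t+1/2) > 0`. Both are removed by taking differences: `dilationDiff` cancels the term
`|z|^{-(2s+1)}` at infinity, and `twistDiff` makes the integrand vanish near `F`. What remains is
locally constant with compact support, uniformly in the parameters, so its integral is a finite sum
of entire functions. This gives `invFunctional` for all `s, t`. In the domain of convergence it
equals the integral times two elementary factors (`invFunctional_eq`). For `η = χ|_F` the choice `c
= ϖ_F`, `e = ϖ_F⁻¹` turns them into `c₋` and `c₊`; for `η ≠ χ|_F` a unit on which `λ` is nontrivial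
turns both into the same nonzero constant. Hence `invFunctional` yields at once the holomorphic
kernel and the intertwining operator. The kernel is unique by the identity theorem, and the operator
because `π_{χ,s}` is spanned by vectors supported in the unit ball of the `lowerUnip` chart and a
single `PGL(2, F)`-translate of such vectors (`HasKernel.unique`).

The vector `φ` becomes `max(|z|, 1)^{-(2s+1)}` in the dual chart, and by the Iwasawa decomposition
its image is determined by one number. If `η ≠ χ|_F`, evaluation at `diag(u, 1)` in two ways forces
this number to vanish. If `η = χ|_F`, the dilation difference of `φ` is a combination of indicators
of lattices, and on such an indicator the functional only sees the shell `|x₂| = |d|`, where `λ` is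
constant. There is one lattice in the unramified case and two in the ramified case; the second one
produces the factor `1 + q_F^{t-1/2}`. -/

lemma absV_lt_absV {x y : K} (h : valuation K x < valuation K y) : absV x < absV y := by
  have hy : y ≠ 0 := by
    rintro rfl
    simp at h
  by_cases hx : x = 0
  · simpa [hx, absV_zero] using absV_pos hy
  rw [absV_of_ne hx, absV_of_ne hy]
  refine zpow_lt_zpow_right₀ (by exact_mod_cast one_lt_resCard) ?_
  simp only [ord, neg_neg]
  refine (WithZero.log_lt_log (by simpa using hx) (by simpa using hy)).2 ?_
  exact (map_lt_map_iff (IsNonarchimedeanLocalField.valueGroupWithZeroIsoInt K)).2 h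

lemma absV_le_iff {x y : K} : absV x ≤ absV y ↔ valuation K x ≤ valuation K y :=
  ⟨fun h => not_lt.1 fun h' => absurd h (not_le.2 (absV_lt_absV h')), absV_le_absV⟩

lemma absV_lt_iff {x y : K} : absV x < absV y ↔ valuation K x < valuation K y := by
  rw [← not_le, absV_le_iff, not_le]

lemma absV_eq_iff {x y : K} : absV x = absV y ↔ valuation K x = valuation K y := by
  rw [le_antisymm_iff, absV_le_iff, absV_le_iff, ← le_antisymm_iff]

@[simp] lemma absV_one : absV (1 : K) = 1 := by simp [absV]

lemma absV_eq_zero {x : K} : absV x = 0 ↔ x = 0 :=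
  ⟨fun h => by_contra fun hx => (absV_pos hx).ne' h, fun h => by simp [h, absV_zero]⟩

lemma absV_le_one_iff {x : K} : absV x ≤ 1 ↔ x ∈ 𝒪[K] := by
  rw [← absV_one (K := K), absV_le_iff, map_one]
  exact (Valuation.mem_integer_iff _ _).symm

lemma absV_lt_one_iff {x : K} : absV x < 1 ↔ valuation K x < 1 := by
  rw [← absV_one (K := K), absV_lt_iff, map_one]

lemma absV_eq_one_iff {x : K} : absV x = 1 ↔ valuation K x = 1 := by
  rw [← absV_one (K := K), absV_eq_iff, map_one]

lemma absV_inv (x : K) : absV x⁻¹ = (absV x)⁻¹ := by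
  by_cases hx : x = 0
  · simp [hx, absV_zero]
  · refine eq_inv_of_mul_eq_one_left ?_
    rw [← absV_mul, inv_mul_cancel₀ hx, absV_one]

lemma absV_div (x y : K) : absV (x / y) = absV x / absV y := by
  rw [div_eq_mul_inv, absV_mul, absV_inv, div_eq_mul_inv]

variable (K) in
/-- The absolute value as a monoid homomorphism. -/
def absHom : K →*₀ ℝ where
  toFun := absV
  map_zero' := absV_zero
  map_one' := absV_one
  map_mul' := absV_mul

lemma absV_pow (x : K) (n : ℕ) : absV (x ^ n) = absV x ^ n := map_pow (absHom K) x n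

lemma absV_zpow (x : K) (n : ℤ) : absV (x ^ n) = absV x ^ n := map_zpow₀ (absHom K) x n

lemma absV_neg (x : K) : absV (-x) = absV x := absV_eq_absV (Valuation.map_neg _ _)

lemma absV_add_le (x y : K) : absV (x + y) ≤ max (absV x) (absV y) := by
  rcases le_max_iff.1 ((valuation K).map_add x y) with h | h
  · exact le_max_of_le_left (absV_le_absV h)
  · exact le_max_of_le_right (absV_le_absV h)

lemma absV_sub_le (x y : K) : absV (x - y) ≤ max (absV x) (absV y) := by
  rw [sub_eq_add_neg, ← absV_neg y]
  exact absV_add_le _ _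

lemma absV_add_eq_left {x y : K} (h : absV y < absV x) : absV (x + y) = absV x :=
  absV_eq_absV (Valuation.map_add_eq_of_lt_left _ (absV_lt_iff.1 h))

lemma absV_add_eq_right {x y : K} (h : absV x < absV y) : absV (x + y) = absV y :=
  absV_eq_absV (Valuation.map_add_eq_of_lt_right _ (absV_lt_iff.1 h))

lemma residue_eq_iff (x y : 𝒪[K]) : IsLocalRing.residue 𝒪[K] x = IsLocalRing.residue 𝒪[K] y ↔
    absV ((x : K) - y) < 1 := by
  rw [← sub_eq_zero, ← map_sub, IsLocalRing.residue_eq_zero_iff, IsLocalRing.mem_maximalIdeal,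
    mem_nonunits_iff, (Valuation.integer.integers (valuation K)).isUnit_iff_valuation_eq_one,
    absV_lt_one_iff]
  have h : valuation K ((x - y : 𝒪[K]) : K) ≤ 1 := (x - y : 𝒪[K]).2
  constructor
  · exact fun h' => lt_of_le_of_ne h h'
  · exact fun h' => ne_of_lt h'

lemma resCard_pos : (0 : ℝ) < resCard K := by
  have := one_lt_resCard (K := K)
  positivity

lemma one_lt_resCard_real : (1 : ℝ) < resCard K := by exact_mod_cast one_lt_resCard

lemma Uniformizer.absV_eq (ϖ : Uniformizer K) : absV (ϖ : K) = (resCard K : ℝ)⁻¹ := by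
  rw [absV_of_ne ϖ.ne_zero, ϖ.2, zpow_neg_one]

lemma Uniformizer.absV_zpow_eq (ϖ : Uniformizer K) (n : ℤ) :
    absV ((ϖ : K) ^ n) = (resCard K : ℝ) ^ (-n) := by
  rw [absV_zpow, ϖ.absV_eq, inv_zpow, zpow_neg]

lemma absV_lt_one_iff_le (x : K) : absV x < 1 ↔ absV x ≤ (resCard K : ℝ)⁻¹ := by
  by_cases hx : x = 0
  · simp [hx, absV_zero]
  rw [absV_of_ne hx, ← zpow_zero (resCard K : ℝ), ← zpow_neg_one,
    zpow_lt_zpow_iff_right₀ one_lt_resCard_real, zpow_le_zpow_iff_right₀ one_lt_resCard_real]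
  omega

variable (K) in
lemma exists_absV_le (r : ℝ) (hr : 0 < r) : ∃ x : K, x ≠ 0 ∧ absV x < r := by
  obtain ⟨x, hx0, hx1⟩ := Valuation.IsNontrivial.exists_lt_one (v := valuation K)
  have hx0' : x ≠ 0 := by simpa using hx0
  obtain ⟨n, hn⟩ := exists_pow_lt_of_lt_one hr (absV_lt_one_iff.2 hx1)
  exact ⟨x ^ n, pow_ne_zero _ hx0', by rwa [absV_pow]⟩

variable (K) in
lemma exists_lt_absV (r : ℝ) : ∃ x : K, x ≠ 0 ∧ r < absV x := by
  obtain ⟨x, hx0, hx⟩ := exists_absV_le K (|r| + 1)⁻¹ (by positivity)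
  refine ⟨x⁻¹, inv_ne_zero hx0, ?_⟩
  rw [absV_inv]
  have h := (lt_inv_comm₀ (absV_pos hx0) (by positivity)).1 hx
  linarith [le_abs_self r]

lemma mem_nhds_iff_absV {c : K} {s : Set K} :
    s ∈ 𝓝 c ↔ ∃ r > 0, ∀ x, absV (x - c) < r → x ∈ s := by
  rw [IsValuativeTopology.mem_nhds_iff]
  constructor
  · rintro ⟨γ, hγ⟩
    obtain ⟨y, hy⟩ := ValuativeRel.valuation_surjective (γ : ValueGroupWithZero K)
    have hy0 : y ≠ 0 := by
      rintro rfl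
      simp at hy
      exact γ.ne_zero hy.symm
    refine ⟨absV y, absV_pos hy0, fun x hx => hγ ?_⟩
    refine ⟨x - c, ?_, by simp⟩
    simpa [← hy] using absV_lt_iff.1 hx
  · rintro ⟨r, hr, h⟩
    obtain ⟨y, hy0, hy⟩ := exists_absV_le K r hr
    refine ⟨Units.mk0 (valuation K y) (by simpa using hy0), ?_⟩
    rintro _ ⟨z, hz, rfl⟩
    refine h _ ?_
    simp only [add_sub_cancel_left]
    exact (absV_lt_iff.2 hz).trans hy

lemma eventually_absV_sub_lt (c : K) {r : ℝ} (hr : 0 < r) : ∀ᶠ x in 𝓝 c, absV (x - c) < r :=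
  mem_nhds_iff_absV.2 ⟨r, hr, fun _ h => h⟩

lemma eventually_absV_eq {c : K} (hc : c ≠ 0) : ∀ᶠ x in 𝓝 c, absV x = absV c := by
  filter_upwards [eventually_absV_sub_lt c (absV_pos hc)] with x hx
  simpa using absV_add_eq_right hx

lemma continuous_absV : Continuous (absV : K → ℝ) := by
  refine continuous_iff_continuousAt.2 fun c => ?_
  by_cases hc : c = 0
  · subst hc
    rw [ContinuousAt, absV_zero, Metric.tendsto_nhds]
    intro ε hε
    filter_upwards [eventually_absV_sub_lt (0 : K) hε] with x hx
    simpa [abs_of_nonneg (absV_nonneg x)] using hx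
  · exact (continuousAt_const (y := absV c)).congr
      ((eventually_absV_eq hc).mono fun x hx => hx.symm)

lemma nhds_zero_eq_comap_absV : 𝓝 (0 : K) = comap absV (𝓝 0) := by
  refine le_antisymm ?_ fun s hs => ?_
  · rw [← tendsto_iff_comap]
    simpa [absV_zero] using continuous_absV.tendsto (0 : K)
  · obtain ⟨r, hr, h⟩ := mem_nhds_iff_absV.1 hs
    refine ⟨Metric.ball 0 r, Metric.ball_mem_nhds _ hr, fun x hx => h x ?_⟩
    simpa [abs_of_nonneg (absV_nonneg x)] using hx

variable (K) in
lemma isCompact_absV_le (r : ℝ) : IsCompact {x : K | absV x ≤ r} := by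
  obtain ⟨y, -, hy⟩ := exists_lt_absV K r
  refine (IsNonarchimedeanLocalField.isCompact_closedBall K (valuation K y)).of_isClosed_subset
    (isClosed_le continuous_absV continuous_const) fun x hx => ?_
  exact absV_le_iff.1 (le_trans hx hy.le)

lemma isClopen_absV_lt (r : ℝ) : IsClopen {x : K | absV x < r} := by
  refine ⟨?_, isOpen_lt continuous_absV continuous_const⟩
  by_cases hr : r ≤ 0
  · have : {x : K | absV x < r} = ∅ := by
      ext x
      simpa using hr.trans (absV_nonneg x)
    rw [this]
    exact isClosed_empty
  rw [← isOpen_compl_iff, isOpen_iff_mem_nhds]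
  intro x hx
  have hx' : r ≤ absV x := by simpa using hx
  have hx0 : x ≠ 0 := by
    rintro rfl
    rw [absV_zero] at hx'
    exact hr hx'
  filter_upwards [eventually_absV_eq hx0] with y hy
  simpa [hy] using hx'

lemma isClopen_absV_le {r : ℝ} (hr : 0 < r) : IsClopen {x : K | absV x ≤ r} := by
  refine ⟨isClosed_le continuous_absV continuous_const, isOpen_iff_mem_nhds.2 fun x hx => ?_⟩
  filter_upwards [eventually_absV_sub_lt x hr] with y hy
  have := absV_add_le (y - x) x
  rw [sub_add_cancel] at this
  exact this.trans (max_le hy.le hx)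

variable (K) in
lemma sigmaCompactSpace_of_isNonarchimedeanLocalField : SigmaCompactSpace K :=
  ⟨⟨fun n : ℕ => {x : K | absV x ≤ n}, fun n => isCompact_absV_le K n, by
    ext x
    simpa using exists_nat_ge (absV x)⟩⟩

-- The neighbourhoods of `0` are pulled back from `ℝ` along `absV`, so the uniformity is countably
-- generated; together with σ-compactness this gives second countability, which the product measures
-- and the uniqueness of Haar measure rely on.
variable (K) in
lemma secondCountableTopology_of_isNonarchimedeanLocalField : SecondCountableTopology K := by
  let := IsTopologicalAddGroup.rightUniformSpace K
  have := isUniformAddGroup_of_addCommGroup (G := K)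
  have := sigmaCompactSpace_of_isNonarchimedeanLocalField K
  have : (𝓝 (0 : K)).IsCountablyGenerated := by
    rw [nhds_zero_eq_comap_absV]
    infer_instance
  have := IsUniformAddGroup.uniformity_countably_generated (α := K)
  let := UniformSpace.pseudoMetricSpace K
  exact EMetric.secondCountable_of_sigmaCompact K

instance instT2SpaceLocalField : T2Space K :=
  IsTopologicalAddGroup.t2Space_of_zero_sep fun x hx =>
    ⟨{y | absV y < absV x}, mem_nhds_iff_absV.2 ⟨absV x, absV_pos hx, fun y hy => by
      simpa using hy⟩, fun h => (lt_irrefl (absV x)) h⟩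

lemma accPt_absV (c : K) : ∀ s ∈ 𝓝 c, ∃ x ∈ s, x ≠ c := by
  intro s hs
  obtain ⟨r, hr, h⟩ := mem_nhds_iff_absV.1 hs
  obtain ⟨y, hy0, hy⟩ := exists_absV_le K r hr
  exact ⟨y + c, h _ (by simpa using hy), by simpa using hy0⟩

end LocalField

/-! ### Haar measure on a local field -/

section LocalField

variable {K : Type*} [Field K] [ValuativeRel K] [TopologicalSpace K]
  [IsNonarchimedeanLocalField K] [MeasurableSpace K] [BorelSpace K]

instance : (haar K).IsAddHaarMeasure := by
  unfold haar
  infer_instance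

lemma haar_integers : haar K {x : K | absV x ≤ 1} = 1 := by
  have h : {x : K | absV x ≤ 1} = (integersCompacts K : Set K) := by
    ext x
    exact absV_le_one_iff
  rw [h]
  exact Measure.addHaarMeasure_self

lemma measurableSet_absV_le (r : ℝ) : MeasurableSet {x : K | absV x ≤ r} :=
  (isClosed_le continuous_absV continuous_const).measurableSet

/-- The larger ball is the disjoint union of `q` translates of the smaller one, indexed by the
residue class of `ϖ^(-n) x`. -/
lemma haar_ball_zpow_succ (ϖ : Uniformizer K) (n : ℤ) :
    resCard K * haar K {x : K | absV x ≤ absV ((ϖ : K) ^ (n + 1))} =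
      haar K {x : K | absV x ≤ absV ((ϖ : K) ^ n)} := by
  have hϖn : (ϖ : K) ^ n ≠ 0 := zpow_ne_zero _ ϖ.ne_zero
  let B := {x : K | absV x ≤ absV ((ϖ : K) ^ (n + 1))}
  let l : 𝓀[K] → 𝒪[K] := Function.surjInv IsLocalRing.residue_surjective
  have hl : ∀ k, IsLocalRing.residue 𝒪[K] (l k) = k :=
    Function.surjInv_eq IsLocalRing.residue_surjective
  let C : 𝓀[K] → Set K := fun k => (fun x => -((ϖ : K) ^ n * l k) + x) ⁻¹' B
  have hmem : ∀ x k, x ∈ C k ↔ absV ((ϖ : K) ^ (-n) * x - l k) < 1 := by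
    intro x k
    have h1 : -((ϖ : K) ^ n * l k) + x = (ϖ : K) ^ n * ((ϖ : K) ^ (-n) * x - l k) := by
      rw [zpow_neg]
      field_simp
      ring
    change absV (-((ϖ : K) ^ n * l k) + x) ≤ absV ((ϖ : K) ^ (n + 1)) ↔ _
    rw [h1, zpow_add_one₀ ϖ.ne_zero, absV_mul, absV_mul, mul_le_mul_iff_right₀ (absV_pos hϖn),
      ϖ.absV_eq, absV_lt_one_iff_le]
  have hunion : ⋃ k, C k = {x : K | absV x ≤ absV ((ϖ : K) ^ n)} := by
    ext x
    have h2 : absV x ≤ absV ((ϖ : K) ^ n) ↔ absV ((ϖ : K) ^ (-n) * x) ≤ 1 := by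
      rw [absV_mul, zpow_neg, absV_inv, inv_mul_le_one₀ (absV_pos hϖn)]
    simp only [Set.mem_iUnion, hmem, Set.mem_ofPred_eq, h2]
    constructor
    · rintro ⟨k, hk⟩
      have := absV_add_le ((ϖ : K) ^ (-n) * x - l k) (l k)
      rw [sub_add_cancel] at this
      exact this.trans (max_le hk.le (absV_le_one_iff.2 (l k).2))
    · intro hx
      refine ⟨IsLocalRing.residue 𝒪[K] ⟨_, absV_le_one_iff.1 hx⟩, ?_⟩
      rw [← residue_eq_iff ⟨_, absV_le_one_iff.1 hx⟩, hl]
  have hdisj : Pairwise (Function.onFun Disjoint C) := by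
    intro k k' hkk
    refine Set.disjoint_left.2 fun x hx hx' => hkk ?_
    rw [hmem] at hx hx'
    rw [← hl k, ← hl k', residue_eq_iff]
    have := absV_sub_le ((ϖ : K) ^ (-n) * x - l k') ((ϖ : K) ^ (-n) * x - l k)
    rw [sub_sub_sub_cancel_left] at this
    exact this.trans_lt (max_lt hx' hx)
  have hC : ∀ k, haar K (C k) = haar K B := fun k => measure_preimage_add _ _ _
  rw [← hunion, measure_iUnion hdisj fun k =>
    (measurableSet_absV_le _).preimage (measurable_const_add _)]
  simp_rw [hC]
  rw [ENNReal.tsum_const, ENat.card_eq_coe_natCard]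
  rfl

lemma haar_ball_zpow (ϖ : Uniformizer K) (n : ℤ) :
    haar K {x : K | absV x ≤ absV ((ϖ : K) ^ n)} = ENNReal.ofReal (absV ((ϖ : K) ^ n)) := by
  have hq : (resCard K : ENNReal) ≠ 0 := by exact_mod_cast (zero_lt_one.trans one_lt_resCard).ne'
  have key : ∀ n : ℤ, ENNReal.ofReal (absV ((ϖ : K) ^ n)) =
      resCard K * ENNReal.ofReal (absV ((ϖ : K) ^ (n + 1))) := by
    intro n
    rw [zpow_add_one₀ ϖ.ne_zero, absV_mul, ϖ.absV_eq, ← ENNReal.ofReal_natCast,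
      ← ENNReal.ofReal_mul (by positivity)]
    congr 1
    have := resCard_pos (K := K)
    field_simp
  induction n using Int.induction_on with
  | zero => simpa using haar_integers
  | succ n ih =>
    rw [← haar_ball_zpow_succ, key] at ih
    exact (ENNReal.mul_right_inj hq (ENNReal.natCast_ne_top _)).1 ih
  | pred n ih =>
    rw [← haar_ball_zpow_succ, key]
    simpa using congrArg (fun y => (resCard K : ENNReal) * y) ih

lemma haar_ball (ϖ : Uniformizer K) {c : K} (hc : c ≠ 0) :
    haar K {x : K | absV x ≤ absV c} = ENNReal.ofReal (absV c) := by
  have h : absV c = absV ((ϖ : K) ^ ord c) := by rw [ϖ.absV_zpow_eq, absV_of_ne hc]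
  rw [h, haar_ball_zpow]

lemma map_add_haar_eq {μ : Measure K} [μ.IsAddHaarMeasure] :
    μ = μ {x : K | absV x ≤ 1} • haar K := by
  have := secondCountableTopology_of_isNonarchimedeanLocalField K
  have := sigmaCompactSpace_of_isNonarchimedeanLocalField K
  have h : {x : K | absV x ≤ 1} = (integersCompacts K : Set K) := by
    ext x
    exact absV_le_one_iff
  rw [h]
  exact Measure.addHaarMeasure_unique μ (integersCompacts K)

variable (K) in
/-- Multiplication by a non-zero element as an automorphism of the additive group. -/
def mulLeftEquiv (c : K) (hc : c ≠ 0) : K ≃ₜ+ K where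
  toFun x := c * x
  invFun x := c⁻¹ * x
  left_inv x := by field_simp
  right_inv x := by field_simp
  map_add' := mul_add c
  continuous_toFun := by fun_prop
  continuous_invFun := by fun_prop

/-- The image is again a Haar measure; the constant is read off on the unit ball, whose preimage is
the ball of radius `|c|⁻¹`. -/
lemma map_mul_haar (ϖ : Uniformizer K) {c : K} (hc : c ≠ 0) :
    (haar K).map (fun x => c * x) = ENNReal.ofReal (absV c)⁻¹ • haar K := by
  have : ((haar K).map (fun x => c * x)).IsAddHaarMeasure :=
    ContinuousAddEquiv.isAddHaarMeasure_map (haar K) (mulLeftEquiv K c hc)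
  rw [map_add_haar_eq (μ := (haar K).map (fun x => c * x)),
    Measure.map_apply (by fun_prop) (measurableSet_absV_le _)]
  congr 1
  rw [← absV_inv, ← haar_ball ϖ (inv_ne_zero hc)]
  congr 1
  ext x
  simp only [Set.preimage_ofPred_eq, Set.mem_ofPred_eq]
  rw [absV_mul, absV_inv, ← one_div, le_div_iff₀' (absV_pos hc)]

lemma integral_mul_haar (ϖ : Uniformizer K) {c : K} (hc : c ≠ 0) (f : K → ℂ) :
    ∫ x, f (c * x) ∂haar K = ((absV c : ℝ) : ℂ)⁻¹ * ∫ x, f x ∂haar K := by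
  have h := (mulLeftEquiv K c hc).toHomeomorph.measurableEmbedding.integral_map
    (μ := haar K) (g := f)
  change ∫ x, f x ∂((haar K).map (fun x => c * x)) = ∫ x, f (c * x) ∂haar K at h
  rw [← h, map_mul_haar ϖ hc, integral_smul_measure, ENNReal.toReal_ofReal
    (inv_nonneg.2 (absV_nonneg c)), Complex.real_smul, Complex.ofReal_inv]

end LocalField

/-! ### Inversion and Haar measure -/

section LocalField

variable {K : Type*} [Field K] [ValuativeRel K] [TopologicalSpace K]
  [IsNonarchimedeanLocalField K] [MeasurableSpace K] [BorelSpace K]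

/-- The inverse of the absolute value, as a non-negative real number. -/
def invAbs (x : K) : NNReal := Real.toNNReal (absV x)⁻¹

lemma measurable_invAbs : Measurable (invAbs : K → NNReal) :=
  (continuous_absV.measurable.inv).real_toNNReal

lemma coe_invAbs (x : K) : (invAbs x : ℝ) = (absV x)⁻¹ :=
  Real.coe_toNNReal _ (inv_nonneg.2 (absV_nonneg x))

variable (K) in
/-- The measure `|x|⁻¹ dx`. -/
def multHaar : Measure K := (haar K).withDensity fun x => (invAbs x : ENNReal)

lemma map_mul_multHaar (ϖ : Uniformizer K) {c : K} (hc : c ≠ 0) :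
    (multHaar K).map (fun x => c * x) = multHaar K := by
  ext A hA
  have hm : Measurable fun x : K => c * x := by fun_prop
  have hi : ∀ x : K, (invAbs x : ENNReal) = ENNReal.ofReal (absV c) * invAbs (c * x) := by
    intro x
    rw [invAbs, invAbs, ← ENNReal.ofReal, ← ENNReal.ofReal, ← ENNReal.ofReal_mul (absV_nonneg c),
      absV_mul, mul_inv, mul_inv_cancel_left₀ (absV_pos hc).ne']
  rw [Measure.map_apply hm hA, multHaar, withDensity_apply _ (hm hA), withDensity_apply _ hA,
    ← lintegral_indicator (hm hA), ← lintegral_indicator hA]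
  have h1 : ∀ x, ((fun x => c * x) ⁻¹' A).indicator (fun x => (invAbs x : ENNReal)) x =
      ENNReal.ofReal (absV c) * A.indicator (fun x => (invAbs x : ENNReal)) (c * x) := by
    intro x
    by_cases hx : c * x ∈ A
    · rw [Set.indicator_of_mem (show x ∈ (fun x => c * x) ⁻¹' A from hx),
        Set.indicator_of_mem hx, hi]
    · rw [Set.indicator_of_notMem (show x ∉ (fun x => c * x) ⁻¹' A from hx),
        Set.indicator_of_notMem hx, mul_zero]
  have hm2 : Measurable (A.indicator (fun x => (invAbs x : ENNReal))) :=
    (measurable_invAbs.coe_nnreal_ennreal).indicator hA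
  simp_rw [h1]
  rw [lintegral_const_mul _ (show Measurable fun x => A.indicator
    (fun x => (invAbs x : ENNReal)) (c * x) from hm2.comp hm), ← lintegral_map hm2 hm,
    map_mul_haar ϖ hc, lintegral_smul_measure, smul_eq_mul, ← mul_assoc,
    ← ENNReal.ofReal_mul (absV_nonneg c), mul_inv_cancel₀ (absV_pos hc).ne', ENNReal.ofReal_one,
    one_mul]

lemma haar_singleton (ϖ : Uniformizer K) (c : K) : haar K {c} = 0 := by
  refine le_antisymm (ENNReal.le_of_forall_pos_le_add fun ε hε _ => ?_) zero_le
  obtain ⟨y, hy0, hy⟩ := exists_absV_le K ε (by exact_mod_cast hε)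
  have h : {c} ⊆ (fun x => -c + x) ⁻¹' {x : K | absV x ≤ absV y} := by
    intro x hx
    rw [Set.mem_singleton_iff] at hx
    simp [hx, absV_zero, absV_nonneg]
  refine (measure_mono h).trans ?_
  rw [measure_preimage_add, haar_ball ϖ hy0, zero_add]
  exact ENNReal.ofReal_le_of_le_toReal hy.le

/-- On `Kˣ`, whose complement `{0}` is a null set, the measure `|x|⁻¹ dx` is a Haar measure of a
commutative group, hence invariant under inversion. -/
lemma map_inv_multHaar (ϖ : Uniformizer K) : (multHaar K).map (fun x => x⁻¹) = multHaar K := by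
  have := secondCountableTopology_of_isNonarchimedeanLocalField K
  let _ : MeasurableSpace Kˣ := borel Kˣ
  have : BorelSpace Kˣ := ⟨rfl⟩
  have hemb : IsOpenEmbedding (Units.val : Kˣ → K) := IsOpenUnits.isOpenEmbedding_unitsVal
  have hme : MeasurableEmbedding (Units.val : Kˣ → K) := hemb.measurableEmbedding
  have : SecondCountableTopology Kˣ := hemb.isEmbedding.secondCountableTopology
  have : LocallyCompactSpace Kˣ := hemb.locallyCompactSpace
  have hinvm : Measurable fun x : K => x⁻¹ := by
    refine measurable_of_continuousOn_compl_singleton (0 : K) ?_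
    exact fun x hx => (continuousAt_inv₀ hx).continuousWithinAt
  let m : Measure Kˣ := (multHaar K).comap Units.val
  have hmap : m.map Units.val = multHaar K := by
    rw [hme.map_comap]
    have hr : Set.range (Units.val : Kˣ → K) = {0}ᶜ := by
      ext x
      exact ⟨by rintro ⟨u, rfl⟩; exact u.ne_zero, fun hx => ⟨Units.mk0 x hx, rfl⟩⟩
    rw [hr]
    refine Measure.restrict_eq_self_of_ae_mem ?_
    have h0 : multHaar K {0} = 0 :=
      withDensity_absolutelyContinuous _ _ (haar_singleton ϖ 0)
    exact measure_eq_zero_iff_ae_notMem.1 h0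
  have hinj : ∀ m' : Measure Kˣ, m'.map Units.val = multHaar K → m' = m := by
    intro m' h
    rw [← hme.comap_map m', h]
  have hleft : m.IsMulLeftInvariant := by
    refine ⟨fun u => hinj _ ?_⟩
    have hu : Measurable fun x : Kˣ => u * x := (continuous_const_mul u).measurable
    rw [Measure.map_map hme.measurable hu]
    have h2 : (Units.val ∘ fun x : Kˣ => u * x) = (fun x : K => (u : K) * x) ∘ Units.val := rfl
    rw [h2, ← Measure.map_map (by fun_prop) hme.measurable, hmap, map_mul_multHaar ϖ u.ne_zero]
  have happ : ∀ A : Set Kˣ, MeasurableSet A →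
      m A = ∫⁻ x in Units.val '' A, (invAbs x : ENNReal) ∂haar K := by
    intro A hA
    rw [hme.comap_apply, multHaar, withDensity_apply _ (hme.measurableSet_image.2 hA)]
  -- On a compact subset of `Kˣ` the density `|x|⁻¹` is bounded.
  have hfin : IsFiniteMeasureOnCompacts m := by
    refine ⟨fun C hC => ?_⟩
    have hcont : Continuous fun u : Kˣ => absV ((u⁻¹ : Kˣ) : K) :=
      continuous_absV.comp (Units.continuous_val.comp continuous_inv)
    obtain ⟨M, hM⟩ := (hC.image hcont).bddAbove
    rw [happ C hC.measurableSet]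
    refine (setLIntegral_mono (g := fun _ => ENNReal.ofReal M) measurable_const ?_).trans_lt ?_
    · rintro _ ⟨u, hu, rfl⟩
      have := hM ⟨u, hu, rfl⟩
      rw [invAbs, ← ENNReal.ofReal]
      refine ENNReal.ofReal_le_ofReal ?_
      rwa [← absV_inv, ← Units.val_inv_eq_inv_val]
    · rw [setLIntegral_const]
      exact ENNReal.mul_lt_top ENNReal.ofReal_lt_top
        (hC.image hemb.continuous).measure_lt_top
  have hpos : m.IsOpenPosMeasure := by
    refine ⟨fun U hU hne h0 => ?_⟩
    rw [happ U hU.measurableSet, setLIntegral_eq_zero_iff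
      (hemb.isOpenMap U hU).measurableSet measurable_invAbs.coe_nnreal_ennreal] at h0
    refine (hemb.isOpenMap U hU).measure_ne_zero (haar K) (hne.image _) ?_
    refine measure_eq_zero_iff_ae_notMem.2 ?_
    filter_upwards [h0] with x hx hxU
    have h3 := hx hxU
    obtain ⟨u, -, rfl⟩ := hxU
    have h4 : invAbs (u : K) = 0 := by exact_mod_cast h3
    have h5 := coe_invAbs (u : K)
    rw [h4] at h5
    exact (inv_pos.2 (absV_pos u.ne_zero)).ne h5
  have hHaar : m.IsHaarMeasure := {}
  let _ := TopologicalSpace.pseudoMetrizableSpacePseudoMetric Kˣ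
  have hinv : m.map (fun u => u⁻¹) = m := Measure.map_inv_eq_self m
  rw [← hmap, Measure.map_map hinvm hme.measurable]
  have h2 : ((fun x : K => x⁻¹) ∘ Units.val) = Units.val ∘ (fun u : Kˣ => u⁻¹) := by
    ext u
    simp
  rw [h2, ← Measure.map_map hme.measurable measurable_inv, hinv]

lemma integral_multHaar (G : K → ℂ) :
    ∫ x, G x ∂multHaar K = ∫ x, ((absV x : ℝ) : ℂ)⁻¹ * G x ∂haar K := by
  rw [multHaar, integral_withDensity_eq_integral_smul measurable_invAbs]
  congr 1
  ext x
  rw [NNReal.smul_def, coe_invAbs, Complex.real_smul, Complex.ofReal_inv]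

/-- Writing `dx = |x| · |x|⁻¹ dx` and inverting the multiplicative measure gives the Jacobian
`|x|⁻²`. -/
lemma integral_inv_haar (ϖ : Uniformizer K) (G : K → ℂ) :
    ∫ x, G x ∂haar K = ∫ x, (((absV x : ℝ) : ℂ) ^ 2)⁻¹ * G x⁻¹ ∂haar K := by
  have hinvm : Measurable fun x : K => x⁻¹ := by
    refine measurable_of_continuousOn_compl_singleton (0 : K) ?_
    exact fun x hx => (continuousAt_inv₀ hx).continuousWithinAt
  let e : K ≃ᵐ K := ⟨Equiv.inv K, hinvm, hinvm⟩
  have h0 : ∀ᵐ x ∂haar K, x ≠ 0 := measure_eq_zero_iff_ae_notMem.1 (haar_singleton ϖ 0)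
  have h1 : ∫ x, G x ∂haar K = ∫ x, ((absV x : ℝ) : ℂ) * G x ∂multHaar K := by
    rw [integral_multHaar]
    refine integral_congr_ae ?_
    filter_upwards [h0] with x hx
    have : ((absV x : ℝ) : ℂ) ≠ 0 := by exact_mod_cast (absV_pos hx).ne'
    field_simp
  have h2 : ∫ x, ((absV x : ℝ) : ℂ) * G x ∂multHaar K =
      ∫ x, ((absV x⁻¹ : ℝ) : ℂ) * G x⁻¹ ∂multHaar K := by
    conv_lhs => rw [← map_inv_multHaar ϖ]
    exact e.measurableEmbedding.integral_map (fun x => ((absV x : ℝ) : ℂ) * G x)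
  rw [h1, h2, integral_multHaar]
  congr 1
  ext x
  rw [absV_inv, Complex.ofReal_inv]
  ring

end LocalField

/-! ### The quadratic extension -/

section Extension

variable {F E : Type*}
  [Field F] [ValuativeRel F] [TopologicalSpace F] [IsNonarchimedeanLocalField F]
  [Field E] [ValuativeRel E] [TopologicalSpace E] [IsNonarchimedeanLocalField E]
  [Algebra F E] [ValuativeExtension F E]

lemma absV_algebraMap_le_iff {x y : F} :
    absV (algebraMap F E x) ≤ absV (algebraMap F E y) ↔ absV x ≤ absV y := by
  rw [absV_le_iff, absV_le_iff, ← Valuation.Compatible.vle_iff_le,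
    ← Valuation.Compatible.vle_iff_le, ValuativeExtension.vle_iff_vle]

lemma absV_algebraMap_lt_iff {x y : F} :
    absV (algebraMap F E x) < absV (algebraMap F E y) ↔ absV x < absV y := by
  rw [← not_le, absV_algebraMap_le_iff, not_le]

lemma absV_algebraMap_lt_one_iff {x : F} : absV (algebraMap F E x) < 1 ↔ absV x < 1 := by
  simpa using absV_algebraMap_lt_iff (E := E) (x := x) (y := 1)

lemma absV_algebraMap_le_one_iff {x : F} : absV (algebraMap F E x) ≤ 1 ↔ absV x ≤ 1 := by
  simpa using absV_algebraMap_le_iff (E := E) (x := x) (y := 1)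

variable (F E) in
lemma continuous_algebraMap_localField : Continuous (algebraMap F E) := by
  refine continuous_of_continuousAt_zero (algebraMap F E) ?_
  rw [ContinuousAt, map_zero, nhds_zero_eq_comap_absV (K := E), tendsto_comap_iff,
    Metric.tendsto_nhds]
  intro ε hε
  -- At this point the two absolute values are only known to be ordered compatibly. Powers of an
  -- element of absolute value `< 1` in `F` tend to `0` in `E` as well, which is enough.
  obtain ⟨y, hy0, hy⟩ := exists_absV_le F 1 one_pos
  obtain ⟨n, hn⟩ := exists_pow_lt_of_lt_one hε (absV_algebraMap_lt_one_iff (E := E).2 hy)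
  filter_upwards [eventually_absV_sub_lt (0 : F) (absV_pos (pow_ne_zero n hy0))] with x hx
  rw [sub_zero, ← absV_algebraMap_lt_iff (E := E), map_pow, absV_pow] at hx
  simpa [abs_of_nonneg (absV_nonneg _)] using hx.trans hn

/-- The element `α` generates the quadratic extension `E / F` and has square `a`. -/
structure IsSqrtGenerator (α : E) (a : F) : Prop where
  finrank_eq : Module.finrank F E = 2
  algebraMap_ne : ∀ c : F, algebraMap F E c ≠ α
  sq_eq : α ^ 2 = algebraMap F E a

variable (F) in
/-- The first coordinate of `x = x₁ + x₂ α`. -/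
def rePart (α x : E) : F := (coords F α x).1

variable (F) in
/-- The second coordinate of `x = x₁ + x₂ α`. -/
def imPart (α x : E) : F := (coords F α x).2

/-- The linear map `(x₁, x₂) ↦ x₁ + x₂ α`. -/
def ofCoords (F : Type*) {E : Type*} [Field F] [Field E] [Algebra F E] (α : E) :
    F × F →ₗ[F] E where
  toFun p := algebraMap F E p.1 + algebraMap F E p.2 * α
  map_add' p q := by
    simp only [Prod.fst_add, Prod.snd_add, map_add]
    ring
  map_smul' c p := by
    simp only [Prod.smul_fst, Prod.smul_snd, smul_eq_mul, map_mul, RingHom.id_apply]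
    rw [Algebra.smul_def]
    ring

namespace IsSqrtGenerator

variable {α : E} {a : F} (h : IsSqrtGenerator α a)
include h

lemma injective_ofCoords : Function.Injective (ofCoords F α) := by
  rw [← LinearMap.ker_eq_bot, LinearMap.ker_eq_bot']
  rintro ⟨x, y⟩ hxy
  change algebraMap F E x + algebraMap F E y * α = 0 at hxy
  have hy : y = 0 := by
    by_contra hy
    have hy' : algebraMap F E y ≠ 0 := by simpa using hy
    refine h.algebraMap_ne (-x / y) ?_
    rw [map_div₀, map_neg]
    field_simp
    linear_combination -hxy
  subst hy
  simpa using hxy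

lemma surjective_ofCoords : Function.Surjective (ofCoords F α) := by
  have : FiniteDimensional F E := Module.finite_of_finrank_pos (by rw [h.finrank_eq]; norm_num)
  refine (LinearMap.injective_iff_surjective_of_finrank_eq_finrank ?_).1 h.injective_ofCoords
  rw [h.finrank_eq]
  simp

lemma re_add_im (x : E) :
    algebraMap F E (rePart F α x) + algebraMap F E (imPart F α x) * α = x :=
  Classical.epsilon_spec (p := fun p : F × F => algebraMap F E p.1 + algebraMap F E p.2 * α = x)
    (h.surjective_ofCoords x)

lemma parts_eq {x : E} {x₁ x₂ : F} (hx : algebraMap F E x₁ + algebraMap F E x₂ * α = x) :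
    rePart F α x = x₁ ∧ imPart F α x = x₂ := by
  have := h.injective_ofCoords (a₁ := (rePart F α x, imPart F α x)) (a₂ := (x₁, x₂))
    ((h.re_add_im x).trans hx.symm)
  simpa using this

lemma imPart_mk (x₁ x₂ : F) : imPart F α (algebraMap F E x₁ + algebraMap F E x₂ * α) = x₂ :=
  (h.parts_eq rfl).2

lemma rePart_mk (x₁ x₂ : F) : rePart F α (algebraMap F E x₁ + algebraMap F E x₂ * α) = x₁ :=
  (h.parts_eq rfl).1

lemma imPart_algebraMap (c : F) : imPart F α (algebraMap F E c) = 0 := by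
  simpa using h.imPart_mk c 0

lemma rePart_algebraMap (c : F) : rePart F α (algebraMap F E c) = c := by
  simpa using h.rePart_mk c 0

lemma imPart_add (x y : E) : imPart F α (x + y) = imPart F α x + imPart F α y := by
  refine (h.parts_eq (x₁ := rePart F α x + rePart F α y) ?_).2
  conv_rhs => rw [← h.re_add_im x, ← h.re_add_im y]
  simp only [map_add]
  ring

lemma imPart_mul (c : F) (x : E) :
    imPart F α (algebraMap F E c * x) = c * imPart F α x := by
  refine (h.parts_eq (x₁ := c * rePart F α x) ?_).2
  conv_rhs => rw [← h.re_add_im x]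
  simp only [map_mul]
  ring

lemma rePart_mul (c : F) (x : E) :
    rePart F α (algebraMap F E c * x) = c * rePart F α x := by
  refine (h.parts_eq (x₂ := c * imPart F α x) ?_).1
  conv_rhs => rw [← h.re_add_im x]
  simp only [map_mul]
  ring

lemma norm_ne_zero {x : E} (hx : x ≠ 0) : rePart F α x ^ 2 - imPart F α x ^ 2 * a ≠ 0 := by
  intro h0
  have h1 : x * (algebraMap F E (rePart F α x) - algebraMap F E (imPart F α x) * α) = 0 := by
    have h2 := congrArg (algebraMap F E) h0
    simp only [map_sub, map_mul, map_pow, map_zero, ← h.sq_eq] at h2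
    conv_lhs => rw [← h.re_add_im x]
    rw [h.rePart_mk, h.imPart_mk]
    linear_combination h2
  rcases mul_eq_zero.1 h1 with h1 | h1
  · exact hx h1
  · have h3 := h.injective_ofCoords (a₁ := (rePart F α x, -imPart F α x)) (a₂ := 0) (by
      rw [map_zero]
      change algebraMap F E _ + algebraMap F E _ * α = 0
      rw [map_neg]
      linear_combination h1)
    simp only [Prod.mk_eq_zero, neg_eq_zero] at h3
    apply hx
    rw [← h.re_add_im x, h3.1, h3.2]
    simp

/-- From `x⁻¹ = x̄ / N(x)`. This identifies the argument of the kernel with a coordinate of the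
inverse, which is what makes the inverted chart linear. -/
lemma imPart_inv {x : E} (hx : x ≠ 0) :
    imPart F α x⁻¹ = -(imPart F α x / (rePart F α x ^ 2 - imPart F α x ^ 2 * a)) := by
  have hN := h.norm_ne_zero hx
  have hN' : algebraMap F E (rePart F α x ^ 2 - imPart F α x ^ 2 * a) ≠ 0 :=
    (map_ne_zero _).2 hN
  refine (h.parts_eq (x₁ := rePart F α x / (rePart F α x ^ 2 - imPart F α x ^ 2 * a)) ?_).2
  refine eq_inv_of_mul_eq_one_left ?_
  rw [map_neg, map_div₀, map_div₀]
  have h2 : (algebraMap F E (rePart F α x) - algebraMap F E (imPart F α x) * α) * x =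
      algebraMap F E (rePart F α x ^ 2 - imPart F α x ^ 2 * a) := by
    conv_lhs => rw [← h.re_add_im x]
    rw [h.rePart_mk, h.imPart_mk]
    simp only [map_sub, map_mul, map_pow, ← h.sq_eq]
    ring
  field_simp
  linear_combination h2

/-- The coordinates as an isomorphism of topological groups. -/
def coordEquiv : F × F ≃ₜ+ E :=
  have := sigmaCompactSpace_of_isNonarchimedeanLocalField F
  have hc : Continuous (ofCoords F α) := by
    have := continuous_algebraMap_localField F E
    change Continuous fun p : F × F => algebraMap F E p.1 + algebraMap F E p.2 * α
    fun_prop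
  -- Continuity of the coordinates comes from the open mapping theorem for σ-compact groups.
  have ho : IsOpenMap (ofCoords F α) :=
    AddMonoidHom.isOpenMap_of_sigmaCompact (ofCoords F α).toAddMonoidHom h.surjective_ofCoords hc
  { AddEquiv.ofBijective (ofCoords F α) ⟨h.injective_ofCoords, h.surjective_ofCoords⟩ with
    continuous_toFun := hc
    continuous_invFun := ((Equiv.ofBijective (ofCoords F α)
      ⟨h.injective_ofCoords, h.surjective_ofCoords⟩).toHomeomorphOfContinuousOpen hc ho
        ).continuous_invFun }

lemma coordEquiv_apply (p : F × F) :
    h.coordEquiv p = algebraMap F E p.1 + algebraMap F E p.2 * α := rfl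

lemma coordEquiv_symm (x : E) : h.coordEquiv.symm x = (rePart F α x, imPart F α x) := by
  rw [ContinuousAddEquiv.symm_apply_eq, h.coordEquiv_apply, h.re_add_im]

lemma continuous_imPart : Continuous (imPart F α : E → F) := by
  have := continuous_snd.comp h.coordEquiv.symm.continuous
  refine this.congr fun x => ?_
  change (h.coordEquiv.symm x).2 = _
  rw [h.coordEquiv_symm]

lemma continuous_rePart : Continuous (rePart F α : E → F) := by
  have := continuous_fst.comp h.coordEquiv.symm.continuous
  refine this.congr fun x => ?_
  change (h.coordEquiv.symm x).1 = _
  rw [h.coordEquiv_symm]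

end IsSqrtGenerator

/-- The map `x₁ + x₂ α ↦ c x₁ + d x₂ α`. -/
def twist (α : E) (c d : F) (x : E) : E :=
  algebraMap F E (c * rePart F α x) + algebraMap F E (d * imPart F α x) * α

/-! ### Coordinate dilations and their effect on Haar measure -/

namespace IsSqrtGenerator

variable {α : E} {a : F} (h : IsSqrtGenerator α a)
include h

lemma twist_self (c : F) (x : E) : twist α c c x = algebraMap F E c * x := by
  conv_rhs => rw [← h.re_add_im x]
  simp only [twist, map_mul]
  ring

lemma imPart_twist (c d : F) (x : E) : imPart F α (twist α c d x) = d * imPart F α x :=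
  h.imPart_mk _ _

lemma rePart_twist (c d : F) (x : E) : rePart F α (twist α c d x) = c * rePart F α x :=
  h.rePart_mk _ _

lemma twist_twist (c d c' d' : F) (x : E) :
    twist α c d (twist α c' d' x) = twist α (c * c') (d * d') x := by
  rw [twist, h.imPart_twist, h.rePart_twist, twist, mul_assoc, mul_assoc]

lemma twist_one (x : E) : twist α (1 : F) 1 x = x := by
  rw [h.twist_self, map_one, one_mul]

lemma twist_one_algebraMap_add (d b : F) (x : E) :
    twist α 1 d (x + algebraMap F E b) = twist α 1 d x + algebraMap F E b := by
  have h1 : rePart F α (x + algebraMap F E b) = rePart F α x + b := by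
    refine (h.parts_eq (x₂ := imPart F α x) ?_).1
    rw [map_add]
    conv_rhs => rw [← h.re_add_im x]
    ring
  rw [twist, twist, h.imPart_add, h.imPart_algebraMap, add_zero, h1]
  simp only [one_mul, map_add]
  ring

lemma twist_mul (c d b : F) (x : E) :
    twist α c d (algebraMap F E b * x) = algebraMap F E b * twist α c d x := by
  rw [twist, h.imPart_mul, h.rePart_mul, twist]
  simp only [map_mul]
  ring

lemma continuous_twist (c d : F) : Continuous (twist α c d : E → E) := by
  have := continuous_algebraMap_localField F E
  have := h.continuous_rePart
  have := h.continuous_imPart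
  unfold twist
  fun_prop

/-- The twist as a homeomorphism. -/
def twistHomeo {c d : F} (hc : c ≠ 0) (hd : d ≠ 0) : E ≃ₜ E where
  toFun := twist α c d
  invFun := twist α c⁻¹ d⁻¹
  left_inv x := by
    rw [h.twist_twist, inv_mul_cancel₀ hc, inv_mul_cancel₀ hd, h.twist_one]
  right_inv x := by
    rw [h.twist_twist, mul_inv_cancel₀ hc, mul_inv_cancel₀ hd, h.twist_one]
  continuous_toFun := h.continuous_twist _ _
  continuous_invFun := h.continuous_twist _ _

section Measure

variable [MeasurableSpace E] [BorelSpace E]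

/-- In coordinates the Haar measure of `E` is a multiple of a product measure on `F × F`, and the
twist is a product of two multiplications. -/
lemma map_twist_haar (ϖF : Uniformizer F) {c d : F} (hc : c ≠ 0) (hd : d ≠ 0) :
    (haar E).map (twist α c d) = ENNReal.ofReal (absV c * absV d)⁻¹ • haar E := by
  have := secondCountableTopology_of_isNonarchimedeanLocalField E
  have := secondCountableTopology_of_isNonarchimedeanLocalField F
  have := sigmaCompactSpace_of_isNonarchimedeanLocalField F
  let _ : MeasurableSpace F := borel F
  have : BorelSpace F := ⟨rfl⟩
  let ν := (haar F).prod (haar F)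
  have : (ν.map h.coordEquiv).IsAddHaarMeasure :=
    ContinuousAddEquiv.isAddHaarMeasure_map ν h.coordEquiv
  have hκ := Measure.isAddLeftInvariant_eq_smul (haar E) (ν.map h.coordEquiv)
  have hT : Measurable h.coordEquiv := h.coordEquiv.continuous.measurable
  have ht : Measurable (twist α c d : E → E) := (h.continuous_twist c d).measurable
  have hmc : Measurable fun x : F => c * x := by fun_prop
  have hmd : Measurable fun x : F => d * x := by fun_prop
  have hcomp : twist α c d ∘ h.coordEquiv =
      h.coordEquiv ∘ Prod.map (fun x => c * x) (fun x => d * x) := by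
    ext p
    simp only [Function.comp_apply, h.coordEquiv_apply, twist, h.imPart_mk, h.rePart_mk,
      Prod.map_fst, Prod.map_snd]
  have hν : (ν.map (Prod.map (fun x => c * x) (fun x => d * x))) =
      ENNReal.ofReal (absV c * absV d)⁻¹ • ν := by
    rw [← Measure.map_prod_map _ _ hmc hmd, map_mul_haar ϖF hc, map_mul_haar ϖF hd,
      Measure.prod_smul_left, Measure.prod_smul_right, smul_smul, mul_inv,
      ENNReal.ofReal_mul (inv_nonneg.2 (absV_nonneg c))]
  rw [hκ, Measure.map_smul, Measure.map_map ht hT, hcomp,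
    ← Measure.map_map hT (hmc.prodMap hmd), hν, Measure.map_smul, smul_comm]

lemma integral_twist_haar (ϖF : Uniformizer F) {c d : F} (hc : c ≠ 0) (hd : d ≠ 0) (f : E → ℂ) :
    ∫ x, f (twist α c d x) ∂haar E = ((absV c * absV d : ℝ) : ℂ)⁻¹ * ∫ x, f x ∂haar E := by
  have h1 := (h.twistHomeo hc hd).measurableEmbedding.integral_map (μ := haar E) (g := f)
  change ∫ x, f x ∂((haar E).map (twist α c d)) = ∫ x, f (twist α c d x) ∂haar E at h1
  rw [← h1, h.map_twist_haar ϖF hc hd, integral_smul_measure, ENNReal.toReal_ofReal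
    (inv_nonneg.2 (mul_nonneg (absV_nonneg _) (absV_nonneg _))), Complex.real_smul,
    Complex.ofReal_inv]

end Measure

/-- Multiplication by `c` scales the Haar measure of `E` by `|c|_E`, but it is also the twist by
`(c, c)`, which scales it by `|c|_F²`. No distinction between ramified and unramified extensions is
needed. -/
lemma absV_algebraMap (ϖE : Uniformizer E) (ϖF : Uniformizer F) (c : F) :
    absV (algebraMap F E c) = absV c ^ 2 := by
  let _ : MeasurableSpace E := borel E
  have : BorelSpace E := ⟨rfl⟩
  by_cases hc : c = 0
  · simp [hc, absV_zero]
  have hc' : algebraMap F E c ≠ 0 := by simpa using hc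
  have h1 := h.map_twist_haar ϖF hc hc
  have h2 : (twist α c c : E → E) = fun x => algebraMap F E c * x := funext (h.twist_self c)
  rw [h2, map_mul_haar ϖE hc'] at h1
  have h3 := congrArg (fun μ : Measure E => μ {x : E | absV x ≤ 1}) h1
  simp only [Measure.smul_apply, haar_integers, smul_eq_mul, mul_one] at h3
  rw [ENNReal.ofReal_eq_ofReal_iff (inv_nonneg.2 (absV_nonneg _))
    (inv_nonneg.2 (mul_nonneg (absV_nonneg _) (absV_nonneg _))), inv_inj] at h3
  rw [h3, pow_two]

end IsSqrtGenerator

end Extension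

/-! ### The absolute value in coordinates -/

section Extension

variable {F E : Type*}
  [Field F] [ValuativeRel F] [TopologicalSpace F] [IsNonarchimedeanLocalField F]
  [Field E] [ValuativeRel E] [TopologicalSpace E] [IsNonarchimedeanLocalField E]
  [Algebra F E] [ValuativeExtension F E]

/-- Hensel's lemma for `X² - a` at the approximate root `c`: the derivative `2c` is a unit because
the residue characteristic is odd. -/
lemma exists_sq_eq_of_absV_lt_one (hodd : Odd (resCard F)) {a c : F} (ha : absV a ≤ 1)
    (hc : absV c = 1) (h : absV (c ^ 2 - a) < 1) : ∃ b : F, b ^ 2 = a := by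
  let _ := IsTopologicalAddGroup.rightUniformSpace F
  have := isUniformAddGroup_of_addCommGroup (G := F)
  let a' : 𝒪[F] := ⟨a, absV_le_one_iff.1 ha⟩
  let c' : 𝒪[F] := ⟨c, absV_le_one_iff.1 hc.le⟩
  let f : Polynomial 𝒪[F] := Polynomial.X ^ 2 - Polynomial.C a'
  have hmem : ∀ x : 𝒪[F], x ∈ IsLocalRing.maximalIdeal 𝒪[F] ↔ absV (x : F) < 1 := by
    intro x
    rw [← IsLocalRing.residue_eq_zero_iff, ← map_zero (IsLocalRing.residue 𝒪[F]), residue_eq_iff]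
    simp
  have h2 : IsUnit (2 : 𝒪[F]) := by
    -- The residue field has `q = 0`; if also `2 = 0` there, the odd number `q` would be `1`.
    by_contra h2
    have h3 : IsLocalRing.residue 𝒪[F] 2 = 0 :=
      (IsLocalRing.residue_eq_zero_iff _).2 ((IsLocalRing.mem_maximalIdeal _).2 h2)
    have : Fintype 𝓀[F] := Fintype.ofFinite _
    have h4 : ((resCard F : ℕ) : 𝓀[F]) = 0 := by
      rw [resCard, Nat.card_eq_fintype_card]
      exact Nat.cast_card_eq_zero _
    obtain ⟨k, hk⟩ := hodd
    rw [hk] at h4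
    simp only [map_ofNat] at h3
    push_cast at h4
    rw [h3] at h4
    simp at h4
  have hcu : IsUnit c' := by
    by_contra hcu
    have := (hmem c').1 ((IsLocalRing.mem_maximalIdeal _).2 hcu)
    exact this.ne hc
  obtain ⟨b, hb, -⟩ := HenselianRing.is_henselian (R := 𝒪[F])
    (I := IsLocalRing.maximalIdeal 𝒪[F]) f (Polynomial.monic_X_pow_sub_C _ two_ne_zero) c'
    ((hmem _).2 (by simpa [f, a', c'] using h))
    (by simpa [f, one_add_one_eq_two] using
      (h2.mul hcu).map (Ideal.Quotient.mk (IsLocalRing.maximalIdeal 𝒪[F])))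
  refine ⟨b, ?_⟩
  have hb' : b ^ 2 - a' = 0 := by simpa [f] using hb
  have := congrArg (fun x : 𝒪[F] => (x : F)) (sub_eq_zero.1 hb')
  simpa [a'] using this

namespace IsSqrtGenerator

variable {α : E} {a : F} (h : IsSqrtGenerator α a)
include h

lemma absV_generator_sq (ϖE : Uniformizer E) (ϖF : Uniformizer F) : absV α = absV a := by
  have h1 : absV α ^ 2 = absV a ^ 2 := by
    rw [← absV_pow, h.sq_eq, h.absV_algebraMap ϖE ϖF]
  exact (pow_left_inj₀ (absV_nonneg _) (absV_nonneg _) two_ne_zero).1 h1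

/-- If `|x₂| = 1`, dividing by `x₂` shows that `α` is congruent to some `c ∈ F` modulo the maximal
ideal. Then `c² ≡ a`, so `a` is a square in `F` by Hensel and `α ∈ F`, a contradiction. -/
lemma absV_parts_lt_one (hodd : Odd (resCard F)) (ha : absV a = 1) (ϖE : Uniformizer E)
    (ϖF : Uniformizer F) {x : E} (h2 : absV (imPart F α x) ≤ 1) (hx : absV x < 1) :
    absV (rePart F α x) < 1 ∧ absV (imPart F α x) < 1 := by
  have hα : absV α = 1 := by rw [h.absV_generator_sq ϖE ϖF, ha]
  have hx1 : algebraMap F E (rePart F α x) = x - algebraMap F E (imPart F α x) * α :=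
    eq_sub_of_add_eq (h.re_add_im x)
  have hlt : absV (imPart F α x) < 1 := by
    refine lt_of_le_of_ne h2 fun h2 => ?_
    have hne : imPart F α x ≠ 0 := by
      rintro h0
      rw [h0, absV_zero] at h2
      exact zero_ne_one h2
    have hne' : algebraMap F E (imPart F α x) ≠ 0 := by simpa using hne
    let c : F := -(rePart F α x / imPart F α x)
    have hc1 : absV (α - algebraMap F E c) < 1 := by
      have h3 : α - algebraMap F E c = x / algebraMap F E (imPart F α x) := by
        simp only [c, map_neg, map_div₀, hx1]
        field_simp
        ring
      rwa [h3, absV_div, h.absV_algebraMap ϖE ϖF, h2, one_pow, div_one]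
    have hcE : absV (algebraMap F E c) = 1 := by
      have h3 := absV_add_eq_left (x := α) (y := -(α - algebraMap F E c))
        (by rwa [absV_neg, hα])
      rwa [neg_sub, add_sub_cancel, hα] at h3
    have hc : absV c = 1 := by
      rw [h.absV_algebraMap ϖE ϖF] at hcE
      exact (pow_eq_one_iff_of_nonneg (absV_nonneg c) two_ne_zero).1 hcE
    have h4 : absV (c ^ 2 - a) < 1 := by
      rw [← absV_algebraMap_lt_one_iff (E := E), map_sub, map_pow, ← h.sq_eq]
      have h5 : algebraMap F E c ^ 2 - α ^ 2 =
          -((α - algebraMap F E c) * (algebraMap F E c + α)) := by ring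
      rw [h5, absV_neg, absV_mul]
      refine mul_lt_one_of_nonneg_of_lt_one_left (absV_nonneg _) hc1 ?_
      exact (absV_add_le _ _).trans (max_le hcE.le hα.le)
    obtain ⟨b, hb⟩ := exists_sq_eq_of_absV_lt_one hodd ha.le hc h4
    have h6 : α ^ 2 = algebraMap F E b ^ 2 := by rw [h.sq_eq, ← hb, map_pow]
    rcases sq_eq_sq_iff_eq_or_eq_neg.1 h6 with h6 | h6
    · exact h.algebraMap_ne b h6.symm
    · exact h.algebraMap_ne (-b) (by rw [map_neg, h6])
  refine ⟨?_, hlt⟩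
  rw [← absV_algebraMap_lt_one_iff (E := E), hx1]
  refine (absV_sub_le _ _).trans_lt (max_lt hx ?_)
  rwa [absV_mul, hα, mul_one, absV_algebraMap_lt_one_iff]

lemma absV_eq_of_unramified (hodd : Odd (resCard F)) (ha : absV a = 1) (ϖE : Uniformizer E)
    (ϖF : Uniformizer F) (x : E) :
    absV x = max (absV (rePart F α x)) (absV (imPart F α x)) ^ 2 := by
  have hα : absV α = 1 := by rw [h.absV_generator_sq ϖE ϖF, ha]
  -- By homogeneity under `F` it suffices to treat vectors whose larger coordinate has absolute
  -- value `1`.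
  have key : ∀ x : E, max (absV (rePart F α x)) (absV (imPart F α x)) = 1 → absV x = 1 := by
    intro x hx
    have h1 : absV x ≤ 1 := by
      rw [← h.re_add_im x]
      refine (absV_add_le _ _).trans (max_le ?_ ?_)
      · rw [absV_algebraMap_le_one_iff, ← hx]
        exact le_max_left _ _
      · rw [absV_mul, hα, mul_one, absV_algebraMap_le_one_iff, ← hx]
        exact le_max_right _ _
    refine le_antisymm h1 (not_lt.1 fun h2 => ?_)
    have h3 := h.absV_parts_lt_one hodd ha ϖE ϖF (hx ▸ le_max_right _ _) h2
    exact (max_lt h3.1 h3.2).ne hx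
  by_cases hx : x = 0
  · have := h.rePart_algebraMap 0
    have h' := h.imPart_algebraMap 0
    rw [map_zero] at this h'
    simp [hx, this, h', absV_zero]
  obtain ⟨c, hc0, hc⟩ : ∃ c : F, c ≠ 0 ∧
      absV c = max (absV (rePart F α x)) (absV (imPart F α x)) := by
    have hmax : 0 < max (absV (rePart F α x)) (absV (imPart F α x)) := by
      by_contra hle
      have h0 := max_le_iff.1 (not_lt.1 hle)
      have h1 := absV_eq_zero.1 (le_antisymm h0.1 (absV_nonneg _))
      have h2 := absV_eq_zero.1 (le_antisymm h0.2 (absV_nonneg _))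
      apply hx
      rw [← h.re_add_im x, h1, h2]
      simp
    rcases max_choice (absV (rePart F α x)) (absV (imPart F α x)) with h1 | h1
    · refine ⟨rePart F α x, ?_, h1.symm⟩
      rintro h2
      rw [h1, h2, absV_zero] at hmax
      exact lt_irrefl _ hmax
    · refine ⟨imPart F α x, ?_, h1.symm⟩
      rintro h2
      rw [h1, h2, absV_zero] at hmax
      exact lt_irrefl _ hmax
  have hc' : algebraMap F E c ≠ 0 := by simpa using hc0
  have h1 := key (algebraMap F E c⁻¹ * x) (by
    rw [h.rePart_mul, h.imPart_mul, absV_mul, absV_mul,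
      ← mul_max_of_nonneg _ _ (absV_nonneg c⁻¹), ← hc, absV_inv,
      inv_mul_cancel₀ (absV_pos hc0).ne'])
  rw [absV_mul, map_inv₀, absV_inv, inv_mul_eq_one₀ (absV_pos hc').ne',
    h.absV_algebraMap ϖE ϖF] at h1
  rw [← h1, hc]

/-- The summands `x₁` and `x₂ α` have absolute values that are even and odd powers of `q`
respectively. They differ unless both vanish, so the ultrametric inequality is an equality. -/
lemma absV_eq_of_ramified (ha : absV a = (resCard F : ℝ)⁻¹)
    (ϖE : Uniformizer E) (ϖF : Uniformizer F) (x : E) :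
    absV x = max (absV (rePart F α x) ^ 2) (absV (imPart F α x) ^ 2 * (resCard F : ℝ)⁻¹) := by
  have hα : absV α = (resCard F : ℝ)⁻¹ := by rw [h.absV_generator_sq ϖE ϖF, ha]
  have h1 := h.absV_algebraMap ϖE ϖF (rePart F α x)
  have h2 : absV (algebraMap F E (imPart F α x) * α) =
      absV (imPart F α x) ^ 2 * (resCard F : ℝ)⁻¹ := by
    rw [absV_mul, hα, h.absV_algebraMap ϖE ϖF]
  rw [← h1, ← h2]
  conv_lhs => rw [← h.re_add_im x]
  rcases lt_trichotomy (absV (algebraMap F E (rePart F α x)))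
    (absV (algebraMap F E (imPart F α x) * α)) with hlt | heq | hlt
  · rw [absV_add_eq_right hlt, max_eq_right hlt.le]
  · by_cases h0 : rePart F α x = 0
    · simp [h0, absV_zero, absV_nonneg]
    exfalso
    have h0' : imPart F α x ≠ 0 := by
      intro h0'
      rw [h0', map_zero, zero_mul, absV_zero, absV_eq_zero] at heq
      exact h0 (by simpa using heq)
    rw [h1, h2, absV_of_ne h0, absV_of_ne h0', ← zpow_natCast, ← zpow_natCast, ← zpow_mul,
      ← zpow_mul, ← zpow_neg_one, ← zpow_add₀ resCard_pos.ne'] at heq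
    have := zpow_right_injective₀ resCard_pos one_lt_resCard_real.ne' heq
    push_cast at this
    omega
  · rw [absV_add_eq_left hlt, max_eq_left hlt.le]

end IsSqrtGenerator

end Extension

/-! ### Smoothness of quasi-characters -/

section LocalField

variable {K : Type*} [Field K] [ValuativeRel K] [TopologicalSpace K]
  [IsNonarchimedeanLocalField K]

/-- The circle has no small subgroups: as long as `z^(2^n)` is close to `1`, the factor `z^(2^n) +
1` has norm at least `3/2`, so squaring increases the distance to `1` geometrically. -/
lemma eq_one_of_forall_norm_pow_sub_one_le (z : ℂ) (hz : ∀ n : ℕ, ‖z ^ n - 1‖ ≤ 1 / 2) :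
    z = 1 := by
  have key : ∀ n : ℕ, (3 / 2 : ℝ) ^ n * ‖z - 1‖ ≤ ‖z ^ (2 ^ n) - 1‖ := by
    intro n
    induction n with
    | zero => simp
    | succ n ih =>
      have h1 : z ^ (2 ^ (n + 1)) - 1 = (z ^ (2 ^ n) - 1) * (z ^ (2 ^ n) + 1) := by
        rw [pow_succ 2 n, pow_mul]
        ring
      have h2 : (3 / 2 : ℝ) ≤ ‖z ^ (2 ^ n) + 1‖ := by
        have h3 : (2 : ℂ) = (z ^ (2 ^ n) + 1) - (z ^ (2 ^ n) - 1) := by ring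
        have h4 := norm_sub_le (z ^ (2 ^ n) + 1) (z ^ (2 ^ n) - 1)
        rw [← h3] at h4
        have h5 : ‖(2 : ℂ)‖ = 2 := by norm_num
        linarith [hz (2 ^ n)]
      rw [h1, norm_mul, pow_succ]
      nlinarith [norm_nonneg (z ^ (2 ^ n) - 1)]
  by_contra hne
  have hpos : 0 < ‖z - 1‖ := norm_pos_iff.2 (sub_ne_zero.2 hne)
  obtain ⟨n, hn⟩ := pow_unbounded_of_one_lt (1 / ‖z - 1‖) (by norm_num : (1 : ℝ) < 3 / 2)
  rw [div_lt_iff₀ hpos] at hn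
  linarith [key n, hz (2 ^ n)]

/-- Near `1` all powers of `w` stay in one small ball, so all powers of the character value stay
near `1`. This covers `η` of arbitrary order, where a sign argument is not available. -/
lemma eventually_char_unitOf_eq_one (χ : PontryaginDual 𝒪[K]ˣ) :
    ∀ᶠ w in 𝓝 (1 : K), χ (unitOf w) = 1 := by
  have hcont : Tendsto (fun w : K => (χ (unitOf w) : ℂ)) (𝓝 1) (𝓝 1) := by
    have h1 : Tendsto χ (𝓝 1) (𝓝 1) := by simpa using (map_continuous χ).tendsto 1
    have h2 : Continuous ((↑) : Circle → ℂ) := continuous_subtype_val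
    exact (h2.tendsto 1).comp (h1.comp tendsto_unitOf)
  have h2 := hcont.eventually (Metric.closedBall_mem_nhds (1 : ℂ) (by norm_num : (0 : ℝ) < 1 / 2))
  obtain ⟨r, hr, h3⟩ := mem_nhds_iff_absV.1 h2
  filter_upwards [eventually_absV_sub_lt (1 : K) (lt_min hr one_pos)] with w hw
  have hpow : ∀ n : ℕ, absV (w ^ n - 1) < min r 1 ∧ valuation K (w ^ n) = 1 := by
    have hval : ∀ x : K, absV (x - 1) < min r 1 → valuation K x = 1 := fun x hx => by
      rw [← absV_eq_one_iff, ← absV_one (K := K), ← absV_add_eq_right (x := x - 1) (y := 1)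
        (by rw [absV_one]; exact hx.trans_le (min_le_right _ _)), sub_add_cancel]
    intro n
    suffices h : absV (w ^ n - 1) < min r 1 from ⟨h, hval _ h⟩
    induction n with
    | zero => simpa [absV_zero] using hr
    | succ n ih =>
      have h4 : w ^ (n + 1) - 1 = w ^ n * (w - 1) + (w ^ n - 1) := by ring
      rw [h4]
      refine (absV_add_le _ _).trans_lt (max_lt ?_ ih)
      rw [absV_mul, absV_eq_one_iff.2 (hval _ ih), one_mul]
      exact hw
  have hunit : ∀ n : ℕ, unitOf (w ^ n) = unitOf w ^ n := by
    intro n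
    induction n with
    | zero =>
      ext
      rw [unitOf_val (hpow 0).2]
      simp
    | succ n ih =>
      have hw1 : valuation K w = 1 := by simpa using (hpow 1).2
      rw [pow_succ, unitOf_mul (hpow n).2 hw1, ih, pow_succ]
  refine Circle.ext ?_
  refine eq_one_of_forall_norm_pow_sub_one_le _ fun n => ?_
  have h5 : dist (χ (unitOf (w ^ n)) : ℂ) 1 ≤ 1 / 2 :=
    h3 (w ^ n) ((hpow n).1.trans_le (min_le_left _ _))
  rw [dist_eq_norm] at h5
  rw [hunit, map_pow, Circle.coe_pow] at h5
  exact h5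

lemma quasiChar_one (χ : PontryaginDual 𝒪[K]ˣ) (ϖ : Uniformizer K) (s : ℂ) :
    quasiChar χ ϖ s 1 = 1 := by
  simpa using quasiChar_unit χ ϖ s 1

lemma quasiChar_inv (χ : PontryaginDual 𝒪[K]ˣ) (ϖ : Uniformizer K) (s : ℂ) (x : K) :
    quasiChar χ ϖ s x⁻¹ = (quasiChar χ ϖ s x)⁻¹ := by
  by_cases hx : x = 0
  · simp [hx, quasiChar]
  refine eq_inv_of_mul_eq_one_left ?_
  rw [← quasiChar_mul, inv_mul_cancel₀ hx, quasiChar_one]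

lemma quasiChar_add_exponent (χ : PontryaginDual 𝒪[K]ˣ) (ϖ : Uniformizer K) (s s' : ℂ) {x : K}
    (hx : x ≠ 0) :
    quasiChar χ ϖ (s + s') x = quasiChar χ ϖ s x * ((absV x : ℝ) : ℂ) ^ s' := by
  rw [quasiChar_of_ne _ _ _ hx, quasiChar_of_ne _ _ _ hx, mul_assoc,
    Complex.cpow_add _ _ (by exact_mod_cast (absV_pos hx).ne')]

lemma norm_quasiChar (χ : PontryaginDual 𝒪[K]ˣ) (ϖ : Uniformizer K) (s : ℂ) {x : K}
    (hx : x ≠ 0) : ‖quasiChar χ ϖ s x‖ = absV x ^ s.re := by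
  rw [quasiChar_of_ne _ _ _ hx, norm_mul, Circle.norm_coe, one_mul,
    Complex.norm_cpow_eq_rpow_re_of_pos (absV_pos hx)]

/-- The neighbourhood does not depend on `s`; this uniformity is what makes the later integrals
entire in the parameters. -/
lemma eventually_quasiChar_eq_forall (χ : PontryaginDual 𝒪[K]ˣ) (ϖ : Uniformizer K) {c : K}
    (hc : c ≠ 0) : ∀ᶠ x in 𝓝 c, ∀ s, quasiChar χ ϖ s x = quasiChar χ ϖ s c := by
  have h1 : ∀ᶠ w in 𝓝 (1 : K), ∀ s, quasiChar χ ϖ s w = 1 := by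
    filter_upwards [eventually_char_unitOf_eq_one χ, eventually_absV_eq (one_ne_zero (α := K))]
      with w hw hv s
    rw [absV_one, absV_eq_one_iff] at hv
    have hq := quasiChar_unit χ ϖ s (unitOf w)
    rw [unitOf_val hv, hw, Circle.coe_one] at hq
    exact hq
  have ht : Tendsto (fun x : K => x * c⁻¹) (𝓝 c) (𝓝 1) := by
    have : Continuous (fun x : K => x * c⁻¹) := by fun_prop
    simpa [hc] using this.tendsto c
  filter_upwards [ht.eventually h1] with x hx s
  have : x = (x * c⁻¹) * c := by field_simp
  rw [this, quasiChar_mul, hx, one_mul]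

lemma differentiable_quasiChar (χ : PontryaginDual 𝒪[K]ˣ) (ϖ : Uniformizer K) (x : K) :
    Differentiable ℂ fun s => quasiChar χ ϖ s x := by
  by_cases hx : x = 0
  · simp [hx, quasiChar]
  · simp_rw [quasiChar_of_ne χ ϖ _ hx]
    have : ((absV x : ℝ) : ℂ) ≠ 0 := by exact_mod_cast (absV_pos hx).ne'
    refine Differentiable.const_mul ?_ _
    exact fun s => (differentiableAt_id.const_cpow (Or.inl this))

end LocalField

/-! ### Integrals of locally constant functions with parameters -/

section Parameters

variable {X P : Type*} [TopologicalSpace X] [MeasurableSpace X] [BorelSpace X]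
  {μ : Measure X} [IsFiniteMeasureOnCompacts μ]

lemma integrable_of_isLocallyConstant {g : X → P → ℂ} (hg : IsLocallyConstant g)
    (hc : HasCompactSupport g) (p : P) : Integrable (fun z => g z p) μ := by
  have h1 : IsLocallyConstant fun z => g z p := hg.comp fun v : P → ℂ => v p
  refine h1.continuous.integrable_of_hasCompactSupport ?_
  exact hc.comp_left (g := fun v : P → ℂ => v p) rfl

/-- Local constancy is required of `g` with values in functions of the parameter, so `g` takes only
finitely many values and the integral is a finite sum of volumes times differentiable functions. -/
lemma differentiable_integral_of_isLocallyConstant [NormedAddCommGroup P] [NormedSpace ℂ P]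
    {g : X → P → ℂ} (hg : IsLocallyConstant g) (hc : HasCompactSupport g)
    (hd : ∀ z, Differentiable ℂ (g z)) : Differentiable ℂ fun p => ∫ z, g z p ∂μ := by
  classical
  have hfin : (g '' tsupport g).Finite := by
    -- For the discrete topology on the target, a compact image is finite.
    let _ : TopologicalSpace (P → ℂ) := ⊥
    have : DiscreteTopology (P → ℂ) := ⟨rfl⟩
    exact (hc.isCompact.image hg.continuous).finite_of_discrete
  let S := hfin.toFinset.erase 0
  have hmeas : ∀ v ∈ S, MeasurableSet (g ⁻¹' {v}) ∧ μ (g ⁻¹' {v}) < ⊤ := by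
    intro v hv
    refine ⟨(hg.isOpen_fiber v).measurableSet, ?_⟩
    refine (measure_mono ?_).trans_lt hc.isCompact.measure_lt_top
    intro z hz
    refine subset_tsupport g ?_
    rw [Function.mem_support, show g z = v from hz]
    exact (Finset.mem_erase.1 hv).1
  have hsum : ∀ z p, g z p = ∑ v ∈ S, (g ⁻¹' {v}).indicator (fun _ => v p) z := by
    intro z p
    by_cases h0 : g z = 0
    · rw [h0, Finset.sum_eq_zero]
      · rfl
      · intro v hv
        refine Set.indicator_of_notMem ?_ _
        intro hz
        exact (Finset.mem_erase.1 hv).1 ((show g z = v from hz).symm.trans h0)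
    · rw [Finset.sum_eq_single (g z)]
      · rw [Set.indicator_of_mem (show z ∈ g ⁻¹' {g z} from rfl)]
      · intro v _ hv
        refine Set.indicator_of_notMem ?_ _
        exact fun hz => hv (show g z = v from hz).symm
      · intro hz
        refine absurd (Finset.mem_erase.2 ⟨h0, ?_⟩) hz
        exact hfin.mem_toFinset.2 ⟨z, subset_tsupport g h0, rfl⟩
  have hint : ∀ p, ∫ z, g z p ∂μ = ∑ v ∈ S, (μ.real (g ⁻¹' {v}) : ℂ) * v p := by
    intro p
    simp_rw [hsum _ p]
    rw [integral_finsetSum]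
    · refine Finset.sum_congr rfl fun v hv => ?_
      rw [integral_indicator_const _ (hmeas v hv).1, Complex.real_smul]
    · intro v hv
      exact (integrable_indicator_iff (hmeas v hv).1).2
        (integrableOn_const (hs := (hmeas v hv).2.ne))
  simp_rw [hint]
  refine Differentiable.fun_sum fun v hv => Differentiable.const_mul ?_ _
  obtain ⟨z, -, rfl⟩ := hfin.mem_toFinset.1 (Finset.mem_of_mem_erase hv)
  exact hd z

end Parameters

/-! ### The invariant functional -/

section LocalField

variable {K : Type*} [Field K] [ValuativeRel K] [TopologicalSpace K]
  [IsNonarchimedeanLocalField K] {P : Type*}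

/-- Families, with parameter space `P`, of locally constant functions `h` on `K` which are multiples
of `|z| ^ (-(2 σ + 1))` for `z` large. -/
def IsSection (σ : P → ℂ) (h : K → P → ℂ) : Prop :=
  IsLocallyConstant h ∧ ∃ (R : ℝ) (C : P → ℂ), ∀ z, R ≤ absV z → ∀ p,
    h z p = ((absV z : ℝ) : ℂ) ^ (-(2 * σ p + 1)) * C p

lemma isSection_const_iff {s : ℂ} {h : K → ℂ} :
    IsSection (fun _ : Unit => s) (fun z _ => h z) ↔ IsLocallyConstant h ∧ ∃ (R : ℝ) (C : ℂ),
      ∀ z, R ≤ absV z → h z = ((absV z : ℝ) : ℂ) ^ (-(2 * s + 1)) * C := by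
  constructor
  · rintro ⟨h1, R, C, hR⟩
    exact ⟨h1.comp fun v => v (), R, C (), fun z hz => hR z hz ()⟩
  · rintro ⟨h1, R, C, hR⟩
    exact ⟨h1.comp fun w _ => w, R, fun _ => C, fun z hz _ => hR z hz⟩

lemma isLocallyConstant_indicator {X Y : Type*} [TopologicalSpace X] [Zero Y] {f : X → Y}
    (hf : IsLocallyConstant f) {s : Set X} (hs : IsClopen s) :
    IsLocallyConstant (s.indicator f) := by
  rw [IsLocallyConstant.iff_eventually_eq]
  intro x
  by_cases hx : x ∈ s
  · filter_upwards [hs.isOpen.mem_nhds hx, hf.eventually_eq x] with y hy hy'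
    rw [Set.indicator_of_mem hy, Set.indicator_of_mem hx, hy']
  · filter_upwards [hs.compl.isOpen.mem_nhds hx] with y hy
    rw [Set.indicator_of_notMem hy, Set.indicator_of_notMem hx]

lemma cpow_absV_mul (x y : K) (w : ℂ) : ((absV (x * y) : ℝ) : ℂ) ^ w =
    ((absV x : ℝ) : ℂ) ^ w * ((absV y : ℝ) : ℂ) ^ w := by
  rw [absV_mul, Complex.ofReal_mul,
    Complex.mul_cpow_ofReal_nonneg (absV_nonneg x) (absV_nonneg y)]

lemma cpow_absV_ne_zero {x : K} (hx : x ≠ 0) (w : ℂ) : ((absV x : ℝ) : ℂ) ^ w ≠ 0 := by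
  have h0 : ((absV x : ℝ) : ℂ) ≠ 0 := by exact_mod_cast (absV_pos hx).ne'
  simp [Complex.cpow_eq_zero_iff, h0]

lemma hasCompactSupport_of_absV {Y : Type*} [Zero Y] {h : K → Y} (R : ℝ)
    (hR : ∀ z, R < absV z → h z = 0) : HasCompactSupport h :=
  HasCompactSupport.intro (isCompact_absV_le K R) fun z hz => hR z (not_le.1 hz)

/-- The combination of `h` and a dilate of `h` which vanishes near infinity if `h` is a section. -/
def dilationDiff (c : K) (s : ℂ) (h : K → ℂ) (z : K) : ℂ :=
  h z - ((absV c : ℝ) : ℂ) ^ (2 * s + 1) * h (c * z)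

lemma isLocallyConstant_dilationDiff (c : K) {σ : P → ℂ} {h : K → P → ℂ}
    (hh : IsLocallyConstant h) :
    IsLocallyConstant fun z p => dilationDiff c (σ p) (fun z => h z p) z := by
  have hm : Continuous fun z : K => c * z := by fun_prop
  have h2 := hh.comp_continuous hm
  rw [IsLocallyConstant.iff_eventually_eq]
  intro z
  filter_upwards [hh.eventually_eq z,
    h2.eventually_eq z] with y hy hy2
  funext p
  simp only [Function.comp_apply] at hy2
  simp only [dilationDiff, hy, hy2]

lemma IsSection.hasCompactSupport_dilationDiff {c : K} (hc : c ≠ 0) {σ : P → ℂ} {h : K → P → ℂ}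
    (hh : IsSection σ h) :
    HasCompactSupport fun z p => dilationDiff c (σ p) (fun z => h z p) z := by
  obtain ⟨-, R, C, hR⟩ := hh
  -- This radius puts both `z` and `c z` in the region where the asymptotic formula holds; there the
  -- factor `|c|^(2s+1)` cancels the homogeneity.
  refine hasCompactSupport_of_absV (max R (R / absV c)) fun z hz => ?_
  funext p
  have h1 : R ≤ absV z := (le_max_left _ _).trans hz.le
  have h2 : R ≤ absV (c * z) := by
    rw [absV_mul, mul_comm, ← div_le_iff₀ (absV_pos hc)]
    exact (le_max_right _ _).trans hz.le
  have h3 := cpow_absV_ne_zero hc (2 * σ p + 1)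
  simp only [dilationDiff, hR _ h1, hR _ h2, cpow_absV_mul, Complex.cpow_neg, Pi.zero_apply]
  field_simp
  ring

end LocalField

/-! ### The quasi-character of `Fˣ` and the regularized integral -/

section Extension

variable {F E : Type*}
  [Field F] [ValuativeRel F] [TopologicalSpace F] [IsNonarchimedeanLocalField F]
  [Field E] [ValuativeRel E] [TopologicalSpace E] [IsNonarchimedeanLocalField E]
  [Algebra F E] [ValuativeExtension F E]

/-- The quasi-character `χ_{s-1/2} η_{t+1/2}` of `Fˣ`. -/
def mixedChar (χ : PontryaginDual 𝒪[E]ˣ) (η : PontryaginDual 𝒪[F]ˣ) (ϖE : Uniformizer E)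
    (ϖF : Uniformizer F) (s t : ℂ) (y : F) : ℂ :=
  quasiChar χ ϖE (s - 1 / 2) (algebraMap F E y) * quasiChar η ϖF (t + 1 / 2) y

section mixedChar

variable (χ : PontryaginDual 𝒪[E]ˣ) (η : PontryaginDual 𝒪[F]ˣ) (ϖE : Uniformizer E)
  (ϖF : Uniformizer F)

lemma mixedChar_mul (s t : ℂ) (x y : F) : mixedChar χ η ϖE ϖF s t (x * y) =
    mixedChar χ η ϖE ϖF s t x * mixedChar χ η ϖE ϖF s t y := by
  simp only [mixedChar, map_mul, quasiChar_mul]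
  ring

lemma mixedChar_zero (s t : ℂ) : mixedChar χ η ϖE ϖF s t 0 = 0 := by
  simp [mixedChar, quasiChar]

lemma mixedChar_ne_zero (s t : ℂ) {y : F} (hy : y ≠ 0) : mixedChar χ η ϖE ϖF s t y ≠ 0 :=
  mul_ne_zero (quasiChar_ne_zero _ _ _ (by simpa using hy)) (quasiChar_ne_zero _ _ _ hy)

lemma mixedChar_one (s t : ℂ) : mixedChar χ η ϖE ϖF s t 1 = 1 := by
  simp [mixedChar, quasiChar_one]

lemma mixedChar_inv (s t : ℂ) (y : F) :
    mixedChar χ η ϖE ϖF s t y⁻¹ = (mixedChar χ η ϖE ϖF s t y)⁻¹ := by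
  rw [mixedChar, map_inv₀, quasiChar_inv, quasiChar_inv, mixedChar, mul_inv]

lemma eventually_mixedChar_eq {y : F} (hy : y ≠ 0) : ∀ᶠ x in 𝓝 y, ∀ s t,
    mixedChar χ η ϖE ϖF s t x = mixedChar χ η ϖE ϖF s t y := by
  have hy' : algebraMap F E y ≠ 0 := by simpa using hy
  filter_upwards [eventually_quasiChar_eq_forall η ϖF hy,
    ((continuous_algebraMap_localField F E).tendsto y).eventually
      (eventually_quasiChar_eq_forall χ ϖE hy')] with x h1 h2 s t
  rw [mixedChar, mixedChar, h1, h2]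

lemma differentiable_mixedChar (y : F) :
    Differentiable ℂ fun p : ℂ × ℂ => mixedChar χ η ϖE ϖF p.1 p.2 y := by
  unfold mixedChar
  refine Differentiable.mul ?_ ?_
  · exact (differentiable_quasiChar χ ϖE (algebraMap F E y)).comp
      (differentiable_fst.sub_const _)
  · exact (differentiable_quasiChar η ϖF y).comp (differentiable_snd.add_const _)

end mixedChar

/-- The difference of a function and a twist of it; it vanishes near `F` if the function is locally
constant. -/
def twistDiff (α : E) (e : F) (H : E → ℂ) (z : E) : ℂ := H z - H (twist α 1 e z)

/-- The integrand of the invariant functional. -/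
def regIntegrand (χ : PontryaginDual 𝒪[E]ˣ) (η : PontryaginDual 𝒪[F]ˣ) (ϖE : Uniformizer E)
    (ϖF : Uniformizer F) (α : E) (e : F) (s t : ℂ) (H : E → ℂ) (z : E) : ℂ :=
  mixedChar χ η ϖE ϖF s t (-imPart F α z) * twistDiff α e H z

variable {P : Type*} {χ : PontryaginDual 𝒪[E]ˣ} {η : PontryaginDual 𝒪[F]ˣ}
  {ϖE : Uniformizer E} {ϖF : Uniformizer F} {α : E} {a : F} (hα : IsSqrtGenerator α a)
include hα

/-- The twist fixes `F` pointwise, so around a point of `F` the difference vanishes and the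
singularity of the quasi-character is harmless. Away from `F` the quasi-character is itself locally
constant, uniformly in the parameters. -/
lemma IsSqrtGenerator.isLocallyConstant_regIntegrand (e : F) {σ τ : P → ℂ} {H : E → P → ℂ}
    (hH : IsLocallyConstant H) : IsLocallyConstant fun z p =>
      regIntegrand χ η ϖE ϖF α e (σ p) (τ p) (fun z => H z p) z := by
  rw [IsLocallyConstant.iff_eventually_eq]
  intro z
  have hS : Continuous (twist α 1 e : E → E) := hα.continuous_twist 1 e
  have h1 := hH.eventually_eq z
  have h2 := (hH.comp_continuous hS).eventually_eq z
  by_cases hz : imPart F α z = 0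
  · have hSz : twist α 1 e z = z := by
      conv_rhs => rw [← hα.re_add_im z]
      rw [twist, hz, mul_zero, one_mul]
    filter_upwards [h1, h2] with y hy hy2
    funext p
    simp only [Function.comp_apply, hSz] at hy2
    simp only [regIntegrand, twistDiff, hy, hy2, hSz, sub_self, mul_zero]
  · have hc : Continuous fun z : E => -imPart F α z := hα.continuous_imPart.neg
    filter_upwards [h1, h2, (hc.tendsto z).eventually
      (eventually_mixedChar_eq χ η ϖE ϖF (neg_ne_zero.2 hz))] with y hy hy2 hy3
    funext p
    simp only [Function.comp_apply] at hy2
    simp only [regIntegrand, twistDiff, hy, hy2, hy3]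

lemma IsSqrtGenerator.hasCompactSupport_regIntegrand {e : F} (he : e ≠ 0) {σ τ : P → ℂ}
    {H : E → P → ℂ} (hH : HasCompactSupport H) : HasCompactSupport fun z p =>
      regIntegrand χ η ϖE ϖF α e (σ p) (τ p) (fun z => H z p) z := by
  have h2 : HasCompactSupport (H ∘ hα.twistHomeo one_ne_zero he) :=
    hH.comp_homeomorph _
  refine HasCompactSupport.intro (hH.isCompact.union h2.isCompact) fun z hz => ?_
  rw [Set.mem_union, not_or] at hz
  funext p
  have h3 := image_eq_zero_of_notMem_tsupport hz.1
  have h4 : (H ∘ hα.twistHomeo one_ne_zero he) z = 0 := image_eq_zero_of_notMem_tsupport hz.2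
  change H (twist α 1 e z) = 0 at h4
  simp [regIntegrand, twistDiff, h3, h4]

variable [MeasurableSpace E] [BorelSpace E]

omit hα in
variable (χ η ϖE ϖF α) in
/-- The regularized functional on locally constant compactly supported functions. -/
def regIntegral (e : F) (s t : ℂ) (H : E → ℂ) : ℂ :=
  ∫ z, regIntegrand χ η ϖE ϖF α e s t H z ∂haar E

lemma IsSqrtGenerator.integrable_regIntegrand {e : F} (he : e ≠ 0) (s t : ℂ) {H : E → ℂ}
    (hH : IsLocallyConstant H) (hc : HasCompactSupport H) :
    Integrable (regIntegrand χ η ϖE ϖF α e s t H) (haar E) := by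
  have h1 : IsLocallyConstant fun (z : E) (_ : Unit) => H z :=
    hH.comp fun w _ => w
  have h2 : HasCompactSupport fun (z : E) (_ : Unit) => H z :=
    hc.comp_left (g := fun w _ => w) rfl
  exact integrable_of_isLocallyConstant
    (hα.isLocallyConstant_regIntegrand e (σ := fun _ => s) (τ := fun _ => t) h1)
    (hα.hasCompactSupport_regIntegrand he (σ := fun _ => s) (τ := fun _ => t) h2) ()

lemma IsSqrtGenerator.regIntegral_add {e : F} (he : e ≠ 0) (s t : ℂ) {H H' : E → ℂ}
    (hH : IsLocallyConstant H) (hc : HasCompactSupport H)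
    (hH' : IsLocallyConstant H') (hc' : HasCompactSupport H') :
    regIntegral χ η ϖE ϖF α e s t (H + H') =
      regIntegral χ η ϖE ϖF α e s t H + regIntegral χ η ϖE ϖF α e s t H' := by
  rw [regIntegral, regIntegral, regIntegral, ← integral_add
    (hα.integrable_regIntegrand he s t hH hc) (hα.integrable_regIntegrand he s t hH' hc')]
  congr 1
  funext z
  simp only [regIntegrand, twistDiff, Pi.add_apply]
  ring

omit hα in
lemma regIntegral_smul (e : F) (s t w : ℂ) (H : E → ℂ) :
    regIntegral χ η ϖE ϖF α e s t (w • H) = w * regIntegral χ η ϖE ϖF α e s t H := by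
  rw [regIntegral, regIntegral, ← integral_const_mul]
  congr 1
  funext z
  simp only [regIntegrand, twistDiff, Pi.smul_apply, smul_eq_mul]
  ring

lemma IsSqrtGenerator.regIntegral_translate (e : F) (s t : ℂ) (H : E → ℂ) (b : F) :
    regIntegral χ η ϖE ϖF α e s t (fun z => H (z + algebraMap F E b)) =
      regIntegral χ η ϖE ϖF α e s t H := by
  rw [regIntegral, regIntegral, ← integral_add_right_eq_self
    (regIntegrand χ η ϖE ϖF α e s t H) (algebraMap F E b)]
  congr 1
  funext z
  simp only [regIntegrand, twistDiff, hα.imPart_add, hα.imPart_algebraMap, add_zero,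
    hα.twist_one_algebraMap_add]

/-- The twist commutes with multiplication by `c ∈ F`, so the only contributions are the value of
the quasi-character and the Jacobian. -/
lemma IsSqrtGenerator.regIntegral_dilate (e : F) (s t : ℂ) (H : E → ℂ) {c : F} (hc : c ≠ 0) :
    regIntegral χ η ϖE ϖF α e s t (fun z => H (algebraMap F E c * z)) =
      (mixedChar χ η ϖE ϖF s t c)⁻¹ * ((absV (algebraMap F E c) : ℝ) : ℂ)⁻¹ *
        regIntegral χ η ϖE ϖF α e s t H := by
  have hc' : algebraMap F E c ≠ 0 := by simpa using hc
  have h0 := mixedChar_ne_zero χ η ϖE ϖF s t hc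
  rw [regIntegral, regIntegral, mul_assoc, ← integral_mul_haar ϖE hc', ← integral_const_mul]
  congr 1
  funext z
  rw [regIntegrand, regIntegrand, hα.imPart_mul, ← mul_neg, mixedChar_mul, twistDiff, twistDiff,
    hα.twist_mul]
  field_simp

omit hα in
variable (χ η ϖE ϖF α) in
/-- The invariant functional on sections, up to normalization. -/
def invFunctional (c e : F) (s t : ℂ) (h : E → ℂ) : ℂ :=
  regIntegral χ η ϖE ϖF α e s t (dilationDiff (algebraMap F E c) s h)

end Extension

section LocalField

variable {K : Type*} [Field K] [ValuativeRel K] [TopologicalSpace K]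
  [IsNonarchimedeanLocalField K]

/-- Locally constant functions `h` on `K` which are multiples of `|z| ^ (-(2 s + 1))` for `z`
large. -/
abbrev IsSectionAt (s : ℂ) (h : K → ℂ) : Prop := IsSection (fun _ : Unit => s) fun z _ => h z

lemma IsSectionAt.isLocallyConstant {s : ℂ} {h : K → ℂ} (hh : IsSectionAt s h) :
    IsLocallyConstant h := hh.1.comp fun v => v ()

lemma IsSectionAt.isLocallyConstant_dilationDiff (c : K) {s : ℂ} {h : K → ℂ}
    (hh : IsSectionAt s h) : IsLocallyConstant (dilationDiff c s h) :=
  (PGLBranching.isLocallyConstant_dilationDiff c (σ := fun _ => s) hh.1).comp fun v => v ()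

lemma IsSectionAt.hasCompactSupport_dilationDiff {c : K} (hc : c ≠ 0) {s : ℂ} {h : K → ℂ}
    (hh : IsSectionAt s h) : HasCompactSupport (dilationDiff c s h) :=
  (IsSection.hasCompactSupport_dilationDiff hc (σ := fun _ => s) hh).comp_left
    (g := fun v : Unit → ℂ => v ()) rfl

lemma absV_add_eq_of_le {z b : K} {R : ℝ} (hb : absV b < R) (hz : R ≤ absV z) :
    absV (z + b) = absV z := absV_add_eq_left (hb.trans_le hz)

lemma absV_add_lt_of_lt {z b : K} {R : ℝ} (hb : absV b < R) (hz : absV z < R) :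
    absV (z + b) < R := (absV_add_le z b).trans_lt (max_lt hz hb)

lemma dilationDiff_add (c : K) (s : ℂ) (h h' : K → ℂ) :
    dilationDiff c s (h + h') = dilationDiff c s h + dilationDiff c s h' := by
  funext z
  simp only [dilationDiff, Pi.add_apply]
  ring

lemma dilationDiff_smul (c : K) (s w : ℂ) (h : K → ℂ) :
    dilationDiff c s (w • h) = w • dilationDiff c s h := by
  funext z
  simp only [dilationDiff, Pi.smul_apply, smul_eq_mul]
  ring

/-- The dilation difference of a translate, up to functions with compact support. -/
lemma IsSectionAt.exists_dilationDiff_translate {s : ℂ} {h : K → ℂ} (hh : IsSectionAt s h)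
    (b c : K) : ∃ h0 : K → ℂ, IsLocallyConstant h0 ∧ HasCompactSupport h0 ∧ ∀ z,
      dilationDiff c s (fun z => h (z + b)) z = dilationDiff c s h (z + b) +
        ((absV c : ℝ) : ℂ) ^ (2 * s + 1) * (h0 (c * z + c * b) - h0 (c * z + b)) := by
  rw [IsSectionAt, isSection_const_iff] at hh
  obtain ⟨h1, R, C, hR⟩ := hh
  -- Larger than `|b|` and `|c b|`: translation by either preserves the ball of radius `R'` and
  -- leaves the absolute value unchanged outside it. Both translates of `h` therefore agree there,
  -- and `h` may be truncated to `h0`.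
  let R' := max R (max (absV b) (absV (c * b)) + 1)
  have hb : absV b < R' := lt_max_of_lt_right ((le_max_left _ _).trans_lt (lt_add_one _))
  have hcb : absV (c * b) < R' := lt_max_of_lt_right ((le_max_right _ _).trans_lt (lt_add_one _))
  have hRR : R ≤ R' := le_max_left _ _
  let h0 : K → ℂ := {z | absV z < R'}.indicator h
  have hin : ∀ w, absV w < R' → h0 w = h w := fun w hw =>
    Set.indicator_of_mem (s := {z | absV z < R'}) hw h
  have hout : ∀ w, R' ≤ absV w → h0 w = 0 := fun w hw =>
    Set.indicator_of_notMem (s := {z | absV z < R'}) (not_lt.2 hw) h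
  have key : ∀ w, h (w + c * b) - h (w + b) = h0 (w + c * b) - h0 (w + b) := by
    intro w
    by_cases hw : absV w < R'
    · rw [hin _ (absV_add_lt_of_lt hcb hw), hin _ (absV_add_lt_of_lt hb hw)]
    · have h2 := absV_add_eq_of_le hb (not_lt.1 hw)
      have h3 := absV_add_eq_of_le hcb (not_lt.1 hw)
      rw [hout _ (by rw [h3]; exact not_lt.1 hw), hout _ (by rw [h2]; exact not_lt.1 hw),
        hR (w + c * b) (by rw [h3]; exact hRR.trans (not_lt.1 hw)),
        hR (w + b) (by rw [h2]; exact hRR.trans (not_lt.1 hw)), h2, h3]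
      ring
  refine ⟨h0, ?_, ?_, fun z => ?_⟩
  · exact isLocallyConstant_indicator h1 (isClopen_absV_lt R')
  · exact hasCompactSupport_of_absV R' fun z hz => hout z hz.le
  · rw [← key]
    simp only [dilationDiff, mul_add]
    ring

end LocalField

/-! ### Equivariance of the invariant functional -/

section Extension

variable {F E : Type*}
  [Field F] [ValuativeRel F] [TopologicalSpace F] [IsNonarchimedeanLocalField F]
  [Field E] [ValuativeRel E] [TopologicalSpace E] [IsNonarchimedeanLocalField E]
  [Algebra F E] [ValuativeExtension F E] [MeasurableSpace E] [BorelSpace E]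
  {χ : PontryaginDual 𝒪[E]ˣ} {η : PontryaginDual 𝒪[F]ˣ}
  {ϖE : Uniformizer E} {ϖF : Uniformizer F} {α : E} {a : F} (hα : IsSqrtGenerator α a)

lemma invFunctional_smul (c e : F) (s t w : ℂ) (h : E → ℂ) :
    invFunctional χ η ϖE ϖF α c e s t (w • h) = w * invFunctional χ η ϖE ϖF α c e s t h := by
  rw [invFunctional, dilationDiff_smul, regIntegral_smul, invFunctional]

namespace IsSqrtGenerator

include hα

lemma invFunctional_add {c e : F} (hc : c ≠ 0) (he : e ≠ 0) (s t : ℂ) {h h' : E → ℂ}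
    (hh : IsSectionAt s h) (hh' : IsSectionAt s h') :
    invFunctional χ η ϖE ϖF α c e s t (h + h') =
      invFunctional χ η ϖE ϖF α c e s t h + invFunctional χ η ϖE ϖF α c e s t h' := by
  have hc' : algebraMap F E c ≠ 0 := by simpa using hc
  rw [invFunctional, dilationDiff_add]
  exact hα.regIntegral_add he s t (hh.isLocallyConstant_dilationDiff _)
    (hh.hasCompactSupport_dilationDiff hc') (hh'.isLocallyConstant_dilationDiff _)
    (hh'.hasCompactSupport_dilationDiff hc')

lemma invFunctional_dilate (c e : F) (s t : ℂ) (h : E → ℂ) {r : F} (hr : r ≠ 0) :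
    invFunctional χ η ϖE ϖF α c e s t (fun z => h (algebraMap F E r * z)) =
      (mixedChar χ η ϖE ϖF s t r)⁻¹ * ((absV (algebraMap F E r) : ℝ) : ℂ)⁻¹ *
        invFunctional χ η ϖE ϖF α c e s t h := by
  rw [invFunctional, invFunctional, ← hα.regIntegral_dilate e s t _ hr]
  congr 1
  funext z
  simp only [dilationDiff, mul_left_comm (algebraMap F E c)]

/-- Translation and dilation do not commute. The discrepancy is a difference of dilates of the
`F`-translates of `h0` by `c b` and `b`, and the regularized integral is blind to `F`-translations.
-/
lemma invFunctional_translate {c e : F} (hc : c ≠ 0) (he : e ≠ 0) (s t : ℂ) {h : E → ℂ}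
    (hh : IsSectionAt s h) (b : F) :
    invFunctional χ η ϖE ϖF α c e s t (fun z => h (z + algebraMap F E b)) =
      invFunctional χ η ϖE ϖF α c e s t h := by
  have hc' : algebraMap F E c ≠ 0 := by simpa using hc
  obtain ⟨h0, h1, h2, hdiff⟩ := hh.exists_dilationDiff_translate (algebraMap F E b)
    (algebraMap F E c)
  let T : F → E → ℂ := fun b z => h0 (z + algebraMap F E b)
  have hT1 : ∀ b, IsLocallyConstant (T b) := fun b => h1.comp_continuous (by fun_prop)
  have hT2 : ∀ b, HasCompactSupport (T b) := fun b =>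
    h2.comp_homeomorph (Homeomorph.addRight (algebraMap F E b))
  let S : F → E → ℂ := fun b z => T b (algebraMap F E c * z)
  have hS1 : ∀ b, IsLocallyConstant (S b) := fun b =>
    (hT1 b).comp_continuous (f := fun z => algebraMap F E c * z) (by fun_prop)
  have hS2 : ∀ b, HasCompactSupport (S b) := fun b =>
    (hT2 b).comp_homeomorph (Homeomorph.mulLeft₀ (algebraMap F E c) hc')
  have hS : ∀ b, regIntegral χ η ϖE ϖF α e s t (S b) = (mixedChar χ η ϖE ϖF s t c)⁻¹ *
      ((absV (algebraMap F E c) : ℝ) : ℂ)⁻¹ * regIntegral χ η ϖE ϖF α e s t h0 := fun b => by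
    rw [hα.regIntegral_dilate e s t (T b) hc, hα.regIntegral_translate]
  let D : E → ℂ := fun z => dilationDiff (algebraMap F E c) s h (z + algebraMap F E b)
  have hD1 : IsLocallyConstant D :=
    (hh.isLocallyConstant_dilationDiff _).comp_continuous (by fun_prop)
  have hD2 : HasCompactSupport D :=
    (hh.hasCompactSupport_dilationDiff hc').comp_homeomorph
      (Homeomorph.addRight (algebraMap F E b))
  let w : ℂ := ((absV (algebraMap F E c) : ℝ) : ℂ) ^ (2 * s + 1)
  have hsm1 : ∀ (w : ℂ) (g : E → ℂ), IsLocallyConstant g → IsLocallyConstant (w • g) :=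
    fun w g hg => hg.comp fun z => w • z
  have hsm2 : ∀ (w : ℂ) (g : E → ℂ), HasCompactSupport g → HasCompactSupport (w • g) :=
    fun w g hg => hg.smul_left (f := fun _ => w)
  have hsplit : dilationDiff (algebraMap F E c) s (fun z => h (z + algebraMap F E b)) =
      D + (w • S (c * b) + (-w) • S b) := by
    funext z
    rw [hdiff]
    simp only [D, S, T, w, Pi.add_apply, Pi.smul_apply, smul_eq_mul, map_mul]
    ring
  rw [invFunctional, hsplit, hα.regIntegral_add he s t hD1 hD2
      ((hsm1 _ _ (hS1 _)).add (hsm1 _ _ (hS1 _))) ((hsm2 _ _ (hS2 _)).add (hsm2 _ _ (hS2 _))),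
    hα.regIntegral_add he s t (hsm1 _ _ (hS1 _)) (hsm2 _ _ (hS2 _)) (hsm1 _ _ (hS1 _))
      (hsm2 _ _ (hS2 _)), regIntegral_smul, regIntegral_smul, hS, hS,
    hα.regIntegral_translate, invFunctional]
  ring

end IsSqrtGenerator

end Extension

/-! ### Convergence -/

section Scaling

variable {X : Type*} [MeasurableSpace X] {μ : Measure X}

/-- If `T` rescales both the measure and the integrand, the integrals over the successive preimages
of a fundamental shell form a geometric sequence; convergence then only needs ratio `k M < 1`. -/
lemma setLIntegral_preimage_iterate {T : X → X} (hT : Measurable T) {M k : ENNReal}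
    (hM : μ.map T = M • μ) {f : X → ENNReal} (hf : Measurable f) (hk : ∀ z, f z = k * f (T z))
    {A : Set X} (hA : MeasurableSet A) (n : ℕ) :
    ∫⁻ z in T^[n] ⁻¹' A, f z ∂μ = (k * M) ^ n * ∫⁻ z in A, f z ∂μ := by
  induction n with
  | zero => simp
  | succ n ih =>
    have hB : MeasurableSet (T^[n] ⁻¹' A) := (hT.iterate n) hA
    have h1 : T^[n + 1] ⁻¹' A = T ⁻¹' (T^[n] ⁻¹' A) := by
      rw [← Set.preimage_comp, ← Function.iterate_succ]
    rw [h1]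
    have h2 : ∫⁻ z in T ⁻¹' (T^[n] ⁻¹' A), f z ∂μ =
        ∫⁻ z in T ⁻¹' (T^[n] ⁻¹' A), k * f (T z) ∂μ := by
      congr 1
      funext z
      exact hk z
    rw [h2, lintegral_const_mul _ (show Measurable fun z => f (T z) from hf.comp hT),
      ← setLIntegral_map hB hf hT, hM, Measure.restrict_smul, lintegral_smul_measure, ih,
      pow_succ, smul_eq_mul]
    ring

lemma setLIntegral_iUnion_preimage_lt_top {T : X → X} (hT : Measurable T) {M k : ENNReal}
    (hM : μ.map T = M • μ) {f : X → ENNReal} (hf : Measurable f) (hk : ∀ z, f z = k * f (T z))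
    {A : Set X} (hA : MeasurableSet A) (hkM : k * M < 1) (hfin : ∫⁻ z in A, f z ∂μ < ⊤) :
    ∫⁻ z in ⋃ n, T^[n] ⁻¹' A, f z ∂μ < ⊤ := by
  refine (lintegral_iUnion_le _ _).trans_lt ?_
  simp_rw [setLIntegral_preimage_iterate hT hM hf hk hA]
  rw [ENNReal.tsum_mul_right, ENNReal.tsum_geometric]
  refine ENNReal.mul_lt_top ?_ hfin
  rw [ENNReal.inv_lt_top]
  exact tsub_pos_of_lt hkM

end Scaling

/-! ### The domain of absolute convergence -/

section Extension

variable {F E : Type*}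
  [Field F] [ValuativeRel F] [TopologicalSpace F] [IsNonarchimedeanLocalField F]
  [Field E] [ValuativeRel E] [TopologicalSpace E] [IsNonarchimedeanLocalField E]
  [Algebra F E] [ValuativeExtension F E]
  {χ : PontryaginDual 𝒪[E]ˣ} {η : PontryaginDual 𝒪[F]ˣ}
  {ϖE : Uniformizer E} {ϖF : Uniformizer F} {α : E} {a : F} (hα : IsSqrtGenerator α a)

namespace IsSqrtGenerator

include hα

lemma norm_mixedChar (s t : ℂ) {y : F} (hy : y ≠ 0) :
    ‖mixedChar χ η ϖE ϖF s t y‖ = absV y ^ (2 * s.re + t.re - 1 / 2) := by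
  have hy' : algebraMap F E y ≠ 0 := by simpa using hy
  rw [mixedChar, norm_mul, norm_quasiChar _ _ _ hy, norm_quasiChar _ _ _ hy',
    hα.absV_algebraMap ϖE ϖF, ← Real.rpow_natCast, ← Real.rpow_mul (absV_nonneg y),
    ← Real.rpow_add (absV_pos hy)]
  congr 1
  simp
  ring

lemma exists_box (R : ℝ) : ∃ d : F, d ≠ 0 ∧ ∀ z : E, absV z ≤ R →
    absV (rePart F α z) ≤ absV d ∧ absV (imPart F α z) ≤ absV d := by
  have h1 := (isCompact_absV_le E R).image (continuous_absV.comp hα.continuous_rePart)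
  have h2 := (isCompact_absV_le E R).image (continuous_absV.comp hα.continuous_imPart)
  obtain ⟨M1, hM1⟩ := h1.bddAbove
  obtain ⟨M2, hM2⟩ := h2.bddAbove
  obtain ⟨d, hd0, hd⟩ := exists_lt_absV F (max M1 M2)
  refine ⟨d, hd0, fun z hz => ⟨?_, ?_⟩⟩
  · exact (hM1 ⟨z, hz, rfl⟩).trans ((le_max_left _ _).trans hd.le)
  · exact (hM2 ⟨z, hz, rfl⟩).trans ((le_max_right _ _).trans hd.le)

lemma isCompact_box (d : F) : IsCompact {z : E | absV (rePart F α z) ≤ absV d ∧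
    absV (imPart F α z) ≤ absV d} := by
  have h1 := ((isCompact_absV_le F (absV d)).prod (isCompact_absV_le F (absV d))).image
    hα.coordEquiv.continuous
  convert h1 using 1
  ext z
  constructor
  · intro hz
    exact ⟨(rePart F α z, imPart F α z), hz, hα.re_add_im z⟩
  · rintro ⟨p, hp, rfl⟩
    change absV (rePart F α (hα.coordEquiv p)) ≤ _ ∧ absV (imPart F α (hα.coordEquiv p)) ≤ _
    rw [hα.coordEquiv_apply, hα.rePart_mk, hα.imPart_mk]
    exact hp

variable [MeasurableSpace E] [BorelSpace E]

lemma measurable_mixedChar_imPart (s t : ℂ) :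
    Measurable fun z : E => mixedChar χ η ϖE ϖF s t (-imPart F α z) := by
  let _ : MeasurableSpace F := borel F
  have : BorelSpace F := ⟨rfl⟩
  have h1 : Measurable (mixedChar χ η ϖE ϖF s t) := by
    refine measurable_of_continuousOn_compl_singleton (0 : F) fun y hy => ?_
    refine ContinuousAt.continuousWithinAt ?_
    refine (continuousAt_const (y := mixedChar χ η ϖE ϖF s t y)).congr ?_
    exact (eventually_mixedChar_eq χ η ϖE ϖF hy).mono fun x hx => (hx s t).symm
  exact h1.comp hα.continuous_imPart.neg.measurable

/-- Up to the set `Im z = 0`, where the integrand is `0`, the box is covered by the shells `|Im z| =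
|ϖ^n d|`, which the twist by `ϖ⁻¹` permutes. The ratio of consecutive shells is `|λ(ϖ)| |ϖ| =
q^{-Re(2s+t+1/2)}`. -/
lemma setLIntegral_box_lt_top {s t : ℂ} (h : 0 < (2 * s + t + 1 / 2).re) {d : F} (hd : d ≠ 0) :
    ∫⁻ z in {z : E | absV (rePart F α z) ≤ absV d ∧ absV (imPart F α z) ≤ absV d},
      ‖mixedChar χ η ϖE ϖF s t (-imPart F α z)‖ₑ ∂haar E < ⊤ := by
  have hϖ0 := ϖF.ne_zero
  let T : E → E := twist α 1 (ϖF : F)⁻¹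
  let A : Set E := {z | absV (rePart F α z) ≤ absV d ∧ absV (imPart F α z) = absV d}
  let Z : Set E := {z | imPart F α z = 0}
  have hT : Measurable T := (hα.continuous_twist _ _).measurable
  have hM := hα.map_twist_haar ϖF (one_ne_zero (α := F)) (inv_ne_zero hϖ0)
  have hf : Measurable fun z : E => ‖mixedChar χ η ϖE ϖF s t (-imPart F α z)‖ₑ :=
    (hα.measurable_mixedChar_imPart s t).enorm
  have hk : ∀ z : E, ‖mixedChar χ η ϖE ϖF s t (-imPart F α z)‖ₑ =
      ‖mixedChar χ η ϖE ϖF s t ϖF‖ₑ * ‖mixedChar χ η ϖE ϖF s t (-imPart F α (T z))‖ₑ := by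
    intro z
    rw [← enorm_mul, ← mixedChar_mul, hα.imPart_twist, mul_neg, mul_inv_cancel_left₀ hϖ0]
  have hA : MeasurableSet A := by
    refine MeasurableSet.inter ?_ ?_
    · exact (isClosed_le (continuous_absV.comp hα.continuous_rePart)
        continuous_const).measurableSet
    · exact (isClosed_eq (continuous_absV.comp hα.continuous_imPart)
        continuous_const).measurableSet
  have hZ : MeasurableSet Z :=
    (isClosed_eq hα.continuous_imPart continuous_const).measurableSet
  have hsub : {z : E | absV (rePart F α z) ≤ absV d ∧ absV (imPart F α z) ≤ absV d} ⊆
      (⋃ n, T^[n] ⁻¹' A) ∪ Z := by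
    rintro z ⟨hz1, hz2⟩
    by_cases hz0 : imPart F α z = 0
    · exact Or.inr hz0
    left
    have hiter : ∀ n : ℕ, rePart F α (T^[n] z) = rePart F α z ∧
        imPart F α (T^[n] z) = (ϖF : F)⁻¹ ^ n * imPart F α z := by
      intro n
      induction n with
      | zero => simp
      | succ n ih =>
        rw [Function.iterate_succ_apply', hα.rePart_twist, hα.imPart_twist, ih.1, ih.2]
        exact ⟨one_mul _, by ring⟩
    have hord : ord d ≤ ord (imPart F α z) := by
      rw [absV_of_ne hz0, absV_of_ne hd, zpow_le_zpow_iff_right₀ one_lt_resCard_real] at hz2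
      omega
    refine Set.mem_iUnion.2 ⟨(ord (imPart F α z) - ord d).toNat, ?_, ?_⟩
    · rw [(hiter _).1]
      exact hz1
    · rw [(hiter _).2, absV_mul, absV_pow, absV_inv, ϖF.absV_eq, inv_inv, absV_of_ne hz0,
        absV_of_ne hd, ← zpow_natCast, ← zpow_add₀ resCard_pos.ne',
        Int.toNat_of_nonneg (by omega)]
      congr 1
      ring
  refine (lintegral_mono_set hsub).trans_lt ((lintegral_union_le _ _ _).trans_lt ?_)
  refine ENNReal.add_lt_top.2 ⟨?_, ?_⟩
  · refine setLIntegral_iUnion_preimage_lt_top hT hM hf hk hA ?_ ?_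
    · rw [← ofReal_norm, hα.norm_mixedChar s t hϖ0, absV_one, one_mul, absV_inv, inv_inv,
        ← ENNReal.ofReal_mul (Real.rpow_nonneg (absV_nonneg _) _), ENNReal.ofReal_lt_one,
        ← Real.rpow_add_one (absV_pos hϖ0).ne']
      refine Real.rpow_lt_one (absV_nonneg _) ?_ ?_
      · rw [ϖF.absV_eq]
        exact inv_lt_one_of_one_lt₀ one_lt_resCard_real
      · simp at h
        linarith
    · have hconst : ∀ z ∈ A, ‖mixedChar χ η ϖE ϖF s t (-imPart F α z)‖ₑ =
          ENNReal.ofReal (absV d ^ (2 * s.re + t.re - 1 / 2)) := by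
        intro z hz
        have hz0 : imPart F α z ≠ 0 := by
          intro h0
          have := hz.2
          rw [h0, absV_zero] at this
          exact (absV_pos hd).ne this
        rw [← ofReal_norm, hα.norm_mixedChar s t (neg_ne_zero.2 hz0), absV_neg, hz.2]
      rw [setLIntegral_congr_fun hA hconst, setLIntegral_const]
      refine ENNReal.mul_lt_top ENNReal.ofReal_lt_top ?_
      exact (measure_mono (show A ⊆ {z | _ ∧ _} from fun z hz => ⟨hz.1, hz.2.le⟩)).trans_lt
        (hα.isCompact_box d).measure_lt_top
  · have h0 : ∀ z ∈ Z, ‖mixedChar χ η ϖE ϖF s t (-imPart F α z)‖ₑ = 0 := by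
      intro z hz
      rw [show imPart F α z = 0 from hz, neg_zero, mixedChar_zero, enorm_zero]
    rw [setLIntegral_congr_fun hZ h0]
    simp

lemma setLIntegral_ball_lt_top {s t : ℂ} (h : 0 < (2 * s + t + 1 / 2).re) (R : ℝ) :
    ∫⁻ z in {z : E | absV z ≤ R},
      ‖mixedChar χ η ϖE ϖF s t (-imPart F α z)‖ₑ ∂haar E < ⊤ := by
  obtain ⟨d, hd0, hd⟩ := hα.exists_box R
  exact (lintegral_mono_set hd).trans_lt (hα.setLIntegral_box_lt_top h hd0)

/-- The exterior is covered by dilates of one annulus under powers of `ϖ_F`. The ratio is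
`q^{-Re(2s-t+1/2)}`, while the annulus itself needs the condition near `F`. -/
lemma setLIntegral_compl_ball_lt_top {s t : ℂ} (h : 0 < (2 * s + t + 1 / 2).re)
    (h' : 0 < (2 * s - t + 1 / 2).re) :
    ∫⁻ z in {z : E | absV (algebraMap F E ϖF) < absV z},
      ‖mixedChar χ η ϖE ϖF s t (-imPart F α z)‖ₑ *
        ENNReal.ofReal (absV z ^ (-(2 * s.re + 1))) ∂haar E < ⊤ := by
  have hϖ0 : algebraMap F E ϖF ≠ 0 := by simpa using ϖF.ne_zero
  have hϖ1 : absV (ϖF : F) < 1 := by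
    rw [ϖF.absV_eq]
    exact inv_lt_one_of_one_lt₀ one_lt_resCard_real
  have hϖE : absV (algebraMap F E ϖF) < 1 := absV_algebraMap_lt_one_iff.2 hϖ1
  let T : E → E := fun z => algebraMap F E ϖF * z
  let A : Set E := {z | absV (algebraMap F E ϖF) < absV z ∧ absV z ≤ 1}
  have hT : Measurable T := by fun_prop
  have hM := map_mul_haar (K := E) ϖE hϖ0
  have hpow : Measurable fun z : E => ENNReal.ofReal (absV z ^ (-(2 * s.re + 1))) :=
    (continuous_absV.measurable.pow_const _).ennreal_ofReal
  have hf0 := (hα.measurable_mixedChar_imPart (χ := χ) (η := η) (ϖE := ϖE) (ϖF := ϖF) s t).enorm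
  have hf := hf0.mul hpow
  -- The inverse of the factor which the integrand picks up under `z ↦ ϖ_F z`; the exponent `2`
  -- comes from `|ϖ_F|_E = |ϖ_F|_F²`.
  let k : ENNReal := ENNReal.ofReal (absV (ϖF : F) ^ (-(2 * s.re + t.re - 1 / 2) +
    2 * (2 * s.re + 1)))
  have hk : ∀ z : E, ‖mixedChar χ η ϖE ϖF s t (-imPart F α z)‖ₑ *
      ENNReal.ofReal (absV z ^ (-(2 * s.re + 1))) = k *
      (‖mixedChar χ η ϖE ϖF s t (-imPart F α (T z))‖ₑ *
        ENNReal.ofReal (absV (T z) ^ (-(2 * s.re + 1)))) := by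
    intro z
    rw [hα.imPart_mul, ← mul_neg, mixedChar_mul, enorm_mul, absV_mul,
      Real.mul_rpow (absV_nonneg _) (absV_nonneg _), ← ofReal_norm (mixedChar _ _ _ _ _ _
        (ϖF : F)), hα.norm_mixedChar s t ϖF.ne_zero, hα.absV_algebraMap ϖE ϖF,
      ENNReal.ofReal_mul (Real.rpow_nonneg (sq_nonneg _) _), ← Real.rpow_natCast,
      ← Real.rpow_mul (absV_nonneg _)]
    have h1 : k * (ENNReal.ofReal (absV (ϖF : F) ^ (2 * s.re + t.re - 1 / 2)) *
        ENNReal.ofReal (absV (ϖF : F) ^ (((2 : ℕ) : ℝ) * -(2 * s.re + 1)))) = 1 := by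
      rw [← ENNReal.ofReal_mul (Real.rpow_nonneg (absV_nonneg _) _),
        ← Real.rpow_add (absV_pos ϖF.ne_zero),
        ← ENNReal.ofReal_mul (Real.rpow_nonneg (absV_nonneg _) _),
        ← Real.rpow_add (absV_pos ϖF.ne_zero)]
      have : -(2 * s.re + t.re - 1 / 2) + 2 * (2 * s.re + 1) +
          (2 * s.re + t.re - 1 / 2 + ((2 : ℕ) : ℝ) * -(2 * s.re + 1)) = 0 := by
        push_cast
        ring
      rw [this, Real.rpow_zero, ENNReal.ofReal_one]
    calc _ = 1 * (‖mixedChar χ η ϖE ϖF s t (-imPart F α z)‖ₑ *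
          ENNReal.ofReal (absV z ^ (-(2 * s.re + 1)))) := (one_mul _).symm
      _ = _ := by
          rw [← h1]
          ring
  have hA : MeasurableSet A := (isOpen_lt continuous_const continuous_absV).measurableSet.inter
    (isClosed_le continuous_absV continuous_const).measurableSet
  have hsub : {z : E | absV (algebraMap F E ϖF) < absV z} ⊆ ⋃ n, T^[n] ⁻¹' A := by
    intro z hz
    have hiter : ∀ n : ℕ, absV (T^[n] z) = absV (algebraMap F E ϖF) ^ n * absV z := by
      intro n
      induction n with
      | zero => simp
      | succ n ih =>
        rw [Function.iterate_succ_apply', absV_mul, ih]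
        ring
    have hex : ∃ n : ℕ, absV (algebraMap F E ϖF) ^ n * absV z ≤ 1 := by
      have hz0 : 0 < absV z := (absV_nonneg _).trans_lt hz
      obtain ⟨n, hn⟩ := exists_pow_lt_of_lt_one (inv_pos.2 hz0) hϖE
      exact ⟨n, by rw [← le_div_iff₀ hz0, one_div]; exact hn.le⟩
    classical
    -- The least power of `ϖ_F` bringing `z` into the unit ball; minimality gives the lower bound of
    -- the annulus.
    refine Set.mem_iUnion.2 ⟨Nat.find hex, ?_, ?_⟩
    · rw [hiter]
      rcases hn : Nat.find hex with _ | m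
      · simpa using hz
      · have hm : ¬ absV (algebraMap F E ϖF) ^ m * absV z ≤ 1 :=
          Nat.find_min hex (by omega)
        rw [pow_succ, mul_comm (_ ^ m), mul_assoc]
        exact lt_mul_of_one_lt_right (absV_pos hϖ0) (not_le.1 hm)
    · rw [hiter]
      exact Nat.find_spec hex
  refine (lintegral_mono_set hsub).trans_lt ?_
  refine setLIntegral_iUnion_preimage_lt_top hT hM hf hk hA ?_ ?_
  · rw [← ENNReal.ofReal_mul (Real.rpow_nonneg (absV_nonneg _) _), ENNReal.ofReal_lt_one,
      hα.absV_algebraMap ϖE ϖF, ← Real.rpow_natCast, ← Real.rpow_neg (absV_nonneg _),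
      ← Real.rpow_add (absV_pos ϖF.ne_zero)]
    refine Real.rpow_lt_one (absV_nonneg _) hϖ1 ?_
    simp at h'
    push_cast
    linarith
  -- The sign of the exponent is unknown, so the power is bounded by continuity on a compact
  -- interval away from `0`.
  · obtain ⟨B, hB⟩ := (isCompact_Icc (a := absV (algebraMap F E ϖF))
      (b := (1 : ℝ))).exists_bound_of_continuousOn (f := fun x : ℝ => x ^ (-(2 * s.re + 1)))
      (fun x hx => (Real.continuousAt_rpow_const _ _
        (Or.inl ((absV_pos hϖ0).trans_le hx.1).ne')).continuousWithinAt)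
    calc _ ≤ ∫⁻ z in A, ‖mixedChar χ η ϖE ϖF s t (-imPart F α z)‖ₑ * ENNReal.ofReal B ∂haar E := by
          refine setLIntegral_mono (hf0.mul_const _) fun z hz => ?_
          exact mul_le_mul_right (ENNReal.ofReal_le_ofReal
            ((le_abs_self _).trans (hB _ ⟨hz.1.le, hz.2⟩))) _
      _ = (∫⁻ z in A, ‖mixedChar χ η ϖE ϖF s t (-imPart F α z)‖ₑ ∂haar E) * ENNReal.ofReal B :=
          lintegral_mul_const _ hf0
      _ < ⊤ := ENNReal.mul_lt_top ((lintegral_mono_set fun z hz => hz.2).trans_lt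
          (hα.setLIntegral_ball_lt_top h 1)) ENNReal.ofReal_lt_top

lemma integrable_mixedChar_mul {s t : ℂ} (h : 0 < (2 * s + t + 1 / 2).re)
    (h' : 0 < (2 * s - t + 1 / 2).re) {f : E → ℂ} (hf : IsSectionAt s f) :
    Integrable (fun z => mixedChar χ η ϖE ϖF s t (-imPart F α z) * f z) (haar E) := by
  have hϖ1 : absV (algebraMap F E ϖF) < 1 := by
    rw [absV_algebraMap_lt_one_iff, ϖF.absV_eq]
    exact inv_lt_one_of_one_lt₀ one_lt_resCard_real
  have hf1 := hf.isLocallyConstant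
  rw [IsSectionAt, isSection_const_iff] at hf
  obtain ⟨-, R, C, hR⟩ := hf
  have hm := (hα.measurable_mixedChar_imPart (χ := χ) (η := η) (ϖE := ϖE) (ϖF := ϖF) s t)
  refine ⟨(hm.mul hf1.continuous.measurable).aestronglyMeasurable, ?_⟩
  -- At least `1`, so that the exterior lies in the region of `setLIntegral_compl_ball_lt_top`.
  let R' := max R 1
  obtain ⟨B, hB⟩ := (isCompact_absV_le E R').exists_bound_of_continuousOn
    hf1.continuous.continuousOn
  have hcover : (Set.univ : Set E) = {z | absV z ≤ R'} ∪ {z | R' < absV z} := by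
    ext z
    simpa using le_or_gt (absV z) R'
  rw [HasFiniteIntegral, ← setLIntegral_univ, hcover]
  refine (lintegral_union_le _ _ _).trans_lt (ENNReal.add_lt_top.2 ⟨?_, ?_⟩)
  · calc _ ≤ ∫⁻ z in {z : E | absV z ≤ R'},
          ‖mixedChar χ η ϖE ϖF s t (-imPart F α z)‖ₑ * ENNReal.ofReal B ∂haar E := by
          refine setLIntegral_mono (hm.enorm.mul_const _) fun z hz => ?_
          rw [enorm_mul, ← ofReal_norm (f z)]
          gcongr
          exact hB z hz
      _ = (∫⁻ z in {z : E | absV z ≤ R'},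
          ‖mixedChar χ η ϖE ϖF s t (-imPart F α z)‖ₑ ∂haar E) * ENNReal.ofReal B :=
          lintegral_mul_const _ hm.enorm
      _ < ⊤ := ENNReal.mul_lt_top (hα.setLIntegral_ball_lt_top h R') ENNReal.ofReal_lt_top
  · have hpow : Measurable fun z : E => ENNReal.ofReal (absV z ^ (-(2 * s.re + 1))) :=
      (continuous_absV.measurable.pow_const _).ennreal_ofReal
    calc _ ≤ ∫⁻ z in {z : E | R' < absV z}, ‖mixedChar χ η ϖE ϖF s t (-imPart F α z)‖ₑ *
          ENNReal.ofReal (absV z ^ (-(2 * s.re + 1))) * ‖C‖ₑ ∂haar E := by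
          refine setLIntegral_mono ((hm.enorm.mul hpow).mul_const _) fun z hz => ?_
          have hz1 : R' < absV z := hz
          have hz0 : 0 < absV z := zero_lt_one.trans_le ((le_max_right R 1).trans hz1.le)
          rw [hR z ((le_max_left R 1).trans hz1.le), enorm_mul, enorm_mul, ← mul_assoc,
            ← ofReal_norm (_ ^ _), Complex.norm_cpow_eq_rpow_re_of_pos hz0]
          simp
      _ = (∫⁻ z in {z : E | R' < absV z}, ‖mixedChar χ η ϖE ϖF s t (-imPart F α z)‖ₑ *
          ENNReal.ofReal (absV z ^ (-(2 * s.re + 1))) ∂haar E) * ‖C‖ₑ :=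
          lintegral_mul_const _ (hm.enorm.mul hpow)
      _ < ⊤ := by
          refine ENNReal.mul_lt_top ((lintegral_mono_set fun z hz => ?_).trans_lt
            (hα.setLIntegral_compl_ball_lt_top h h')) enorm_lt_top
          exact hϖ1.trans_le ((le_max_right R 1).trans (le_of_lt hz))

lemma integrable_comp_twist (ϖF : Uniformizer F) {c d : F} (hc : c ≠ 0) (hd : d ≠ 0) {f : E → ℂ}
    (hf : Integrable f (haar E)) : Integrable (fun z => f (twist α c d z)) (haar E) := by
  refine ((hα.twistHomeo hc hd).measurableEmbedding.integrable_map_iff (g := f)).1 ?_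
  change Integrable f ((haar E).map (twist α c d))
  rw [hα.map_twist_haar ϖF hc hd]
  exact hf.smul_measure ENNReal.ofReal_ne_top

/-- Each of the two differences multiplies the convergent integral by `1` minus a homogeneity
factor, by a linear change of variables. The Jacobian `|c|_E⁻¹` of the dilation lowers the exponent
`2s+1` to `2s`. -/
lemma invFunctional_eq {c e : F} (hc : c ≠ 0) (he : e ≠ 0) {s t : ℂ}
    (h : 0 < (2 * s + t + 1 / 2).re) (h' : 0 < (2 * s - t + 1 / 2).re) {f : E → ℂ}
    (hf : IsSectionAt s f) :
    invFunctional χ η ϖE ϖF α c e s t f =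
      (1 - (mixedChar χ η ϖE ϖF s t e)⁻¹ * ((absV e : ℝ) : ℂ)⁻¹) *
      ((1 - ((absV (algebraMap F E c) : ℝ) : ℂ) ^ (2 * s) * (mixedChar χ η ϖE ϖF s t c)⁻¹) *
      ∫ z, mixedChar χ η ϖE ϖF s t (-imPart F α z) * f z ∂haar E) := by
  have hc' : algebraMap F E c ≠ 0 := by simpa using hc
  have hcabs : ((absV (algebraMap F E c) : ℝ) : ℂ) ≠ 0 := by exact_mod_cast (absV_pos hc').ne'
  have hLe := mixedChar_ne_zero χ η ϖE ϖF s t he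
  have hLc := mixedChar_ne_zero χ η ϖE ϖF s t hc
  let L : E → ℂ := fun z => mixedChar χ η ϖE ϖF s t (-imPart F α z)
  let H := dilationDiff (algebraMap F E c) s f
  let κ := ((absV (algebraMap F E c) : ℝ) : ℂ) ^ (2 * s + 1)
  have hi := hα.integrable_mixedChar_mul (χ := χ) (η := η) (ϖE := ϖE) (ϖF := ϖF) h h' hf
  have hcz : ∀ z : E, algebraMap F E c * z = twist α c c z := fun z => (hα.twist_self c z).symm
  have hdil : ∀ z, L z * f (algebraMap F E c * z) =
      (mixedChar χ η ϖE ϖF s t c)⁻¹ * (L (algebraMap F E c * z) * f (algebraMap F E c * z)) := by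
    intro z
    simp only [L]
    rw [hα.imPart_mul, ← mul_neg, mixedChar_mul]
    field_simp
  have hic : Integrable (fun z => L (algebraMap F E c * z) * f (algebraMap F E c * z))
      (haar E) := by
    simp_rw [hcz]
    exact hα.integrable_comp_twist ϖF hc hc (f := fun z => L z * f z) hi
  have hsplit : (fun z => L z * H z) = fun z => L z * f z - κ * ((mixedChar χ η ϖE ϖF s t c)⁻¹ *
      (L (algebraMap F E c * z) * f (algebraMap F E c * z))) := by
    funext z
    rw [← hdil]
    simp only [H, dilationDiff, κ]
    ring
  have hiH : Integrable (fun z => L z * H z) (haar E) := by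
    rw [hsplit]
    exact hi.sub ((hic.const_mul _).const_mul _)
  have hIH : ∫ z, L z * H z ∂haar E = (1 - ((absV (algebraMap F E c) : ℝ) : ℂ) ^ (2 * s) *
      (mixedChar χ η ϖE ϖF s t c)⁻¹) * ∫ z, L z * f z ∂haar E := by
    rw [hsplit, integral_sub hi ((hic.const_mul _).const_mul _), integral_const_mul,
      integral_const_mul, integral_mul_haar ϖE hc' (fun z => L z * f z)]
    simp only [κ]
    rw [Complex.cpow_add _ _ hcabs, Complex.cpow_one]
    change (∫ z, L z * f z ∂haar E) - _ = _
    field_simp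
  have htw : ∀ z, L z * H (twist α 1 e z) =
      (mixedChar χ η ϖE ϖF s t e)⁻¹ * (L (twist α 1 e z) * H (twist α 1 e z)) := by
    intro z
    simp only [L]
    rw [hα.imPart_twist, ← mul_neg, mixedChar_mul]
    field_simp
  have hsplit2 : (regIntegrand χ η ϖE ϖF α e s t H) = fun z => L z * H z -
      (mixedChar χ η ϖE ϖF s t e)⁻¹ * (L (twist α 1 e z) * H (twist α 1 e z)) := by
    funext z
    rw [← htw]
    simp only [regIntegrand, twistDiff, L]
    ring
  rw [invFunctional, regIntegral]
  change ∫ z, regIntegrand χ η ϖE ϖF α e s t H z ∂haar E = _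
  rw [hsplit2, integral_sub hiH ((hα.integrable_comp_twist ϖF one_ne_zero he
    (f := fun z => L z * H z) hiH).const_mul _), integral_const_mul,
    hα.integral_twist_haar ϖF one_ne_zero he (fun z => L z * H z), absV_one, one_mul, hIH]
  ring

end IsSqrtGenerator

end Extension

/-! ### The renormalized kernel -/

section LocalField

variable {K : Type*} [Field K] [ValuativeRel K] [TopologicalSpace K]
  [IsNonarchimedeanLocalField K]

lemma valuation_unit (u : 𝒪[K]ˣ) : valuation K ((u : 𝒪[K]) : K) = 1 := by
  have h3 : valuation K ((u : 𝒪[K]) : K) * valuation K (((u⁻¹ : 𝒪[K]ˣ) : 𝒪[K]) : K) = 1 := by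
    rw [← map_mul, ← Subring.coe_mul, Units.mul_inv]
    simp
  refine le_antisymm (u : 𝒪[K]).2 ?_
  rw [← h3]
  exact mul_le_of_le_one_right' ((u⁻¹ : 𝒪[K]ˣ) : 𝒪[K]).2

lemma coe_unit_ne_zero (u : 𝒪[K]ˣ) : ((u : 𝒪[K]) : K) ≠ 0 := by
  intro h
  have := valuation_unit u
  simp [h] at this

lemma absV_unit (u : 𝒪[K]ˣ) : absV ((u : 𝒪[K]) : K) = 1 := by
  rw [absV_of_ne (coe_unit_ne_zero u), (ord_eq_zero_iff (coe_unit_ne_zero u)).2 (valuation_unit u)]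
  simp

lemma natCast_inv_cpow (n : ℕ) (w : ℂ) : (((n : ℝ)⁻¹ : ℝ) : ℂ) ^ w = (n : ℂ) ^ (-w) := by
  rw [Complex.cpow_neg, Complex.ofReal_inv, Complex.ofReal_natCast, Complex.inv_cpow]
  rw [Complex.natCast_arg]
  exact Real.pi_pos.ne

lemma natCast_inv_sq_cpow {n : ℕ} (hn : (n : ℂ) ≠ 0) (w : ℂ) :
    (((n : ℝ)⁻¹ ^ 2 : ℝ) : ℂ) ^ w = (n : ℂ) ^ (-(2 * w)) := by
  have h : 0 ≤ (n : ℝ)⁻¹ := by positivity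
  rw [pow_two, Complex.ofReal_mul, Complex.mul_cpow_ofReal_nonneg h h, natCast_inv_cpow,
    ← Complex.cpow_add _ _ hn]
  congr 1
  ring

variable (K) in
lemma resCard_ne_zero : (resCard K : ℂ) ≠ 0 := by
  have := one_lt_resCard (K := K)
  exact_mod_cast (by omega : resCard K ≠ 0)

lemma quasiChar_uniformizer (χ : PontryaginDual 𝒪[K]ˣ) (ϖ : Uniformizer K) (s : ℂ) :
    quasiChar χ ϖ s ϖ = (resCard K : ℂ) ^ (-s) := by
  have h1 : unitOf (1 : K) = 1 := by
    ext
    rw [unitOf_val (map_one _)]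
    rfl
  rw [quasiChar_of_ne _ _ _ ϖ.ne_zero, ϖ.2, ϖ.absV_eq, zpow_neg, zpow_one,
    inv_mul_cancel₀ ϖ.ne_zero, h1, map_one, Circle.coe_one, one_mul,
    natCast_inv_cpow]

/-- The section on the dual chart associated with a test function `u`. -/
def secOfTest (s : ℂ) (u : K → ℂ) (z : K) : ℂ :=
  open Classical in if z = 0 then 0 else ((absV z : ℝ) : ℂ) ^ (-(2 * s + 1)) * u z⁻¹

lemma secOfTest_of_ne (s : ℂ) (u : K → ℂ) {z : K} (hz : z ≠ 0) :
    secOfTest s u z = ((absV z : ℝ) : ℂ) ^ (-(2 * s + 1)) * u z⁻¹ := by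
  simp [secOfTest, hz]

lemma secOfTest_zero (s : ℂ) (u : K → ℂ) : secOfTest s u 0 = 0 := by
  simp [secOfTest]

lemma eventually_secOfTest_eq_zero {u : K → ℂ} (hu : HasCompactSupport u) :
    ∀ᶠ z in 𝓝 (0 : K), ∀ s, secOfTest s u z = 0 := by
  obtain ⟨M, hM⟩ := (hu.isCompact.image continuous_absV).bddAbove
  have hM1 : 0 < max M 1 := lt_max_of_lt_right one_pos
  have h := (mem_nhds_iff_absV (c := (0 : K)) (s := {z | absV z < (max M 1)⁻¹})).2
    ⟨(max M 1)⁻¹, inv_pos.2 hM1, fun x hx => by simpa using hx⟩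
  filter_upwards [h] with z hz s
  by_cases hz0 : z = 0
  · rw [hz0, secOfTest_zero]
  rw [secOfTest_of_ne _ _ hz0]
  by_cases hu0 : u z⁻¹ = 0
  · rw [hu0, mul_zero]
  · exfalso
    have h1 : absV z⁻¹ ≤ max M 1 := (hM ⟨z⁻¹, subset_tsupport _ hu0, rfl⟩).trans (le_max_left _ _)
    rw [absV_inv, inv_le_comm₀ (absV_pos hz0) hM1] at h1
    exact (not_lt.2 h1) hz

/-- Inversion exchanges the two ends: compact support of `u` gives vanishing near `0`, and constancy
of `u` near `0` gives the asymptotics with coefficient `u 0`. -/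
lemma isSection_secOfTest {u : K → ℂ} (hu : IsLocallyConstant u) (hc : HasCompactSupport u) :
    IsSection (fun p : ℂ × ℂ => p.1) fun z p => secOfTest p.1 u z := by
  constructor
  · rw [IsLocallyConstant.iff_eventually_eq]
    intro z
    by_cases hz : z = 0
    · subst hz
      filter_upwards [eventually_secOfTest_eq_zero hc] with y hy
      funext p
      rw [hy, secOfTest_zero]
    · filter_upwards [eventually_absV_eq hz, eventually_ne_nhds hz,
        (continuousAt_inv₀ hz).eventually (hu.eventually_eq z⁻¹)] with y hy hy0 hy2
      funext p
      rw [secOfTest_of_ne _ _ hz, secOfTest_of_ne _ _ hy0, hy, hy2]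
  · obtain ⟨δ, hδ, h⟩ := (mem_nhds_iff_absV (c := (0 : K)) (s := {x | u x = u 0})).1
      (hu.eventually_eq 0)
    -- With `2 / δ` in place of `1 / δ`, the weak inequality on `|z|` gives the strict one for
    -- `|z⁻¹|`.
    refine ⟨2 / δ, fun _ => u 0, fun z hz p => ?_⟩
    have hz0 : z ≠ 0 := by
      rintro rfl
      rw [absV_zero] at hz
      exact absurd hz (not_le.2 (by positivity))
    have h2 : u z⁻¹ = u 0 := by
      refine h _ ?_
      rw [sub_zero, absV_inv, inv_lt_comm₀ (absV_pos hz0) hδ]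
      refine lt_of_lt_of_le ?_ hz
      rw [inv_eq_one_div]
      gcongr
      norm_num
    beta_reduce
    rw [secOfTest_of_ne _ _ hz0, h2]

lemma isSectionAt_secOfTest (s : ℂ) {u : K → ℂ} (hu : IsLocallyConstant u)
    (hc : HasCompactSupport u) : IsSectionAt s (secOfTest s u) := by
  obtain ⟨h1, R, C, hR⟩ := isSection_secOfTest hu hc
  rw [IsSectionAt, isSection_const_iff]
  exact ⟨h1.comp fun v => v (s, 0), R, C (s, 0), fun z hz => hR z hz (s, 0)⟩

lemma secOfTest_add (s : ℂ) (u v : K → ℂ) :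
    secOfTest s (u + v) = secOfTest s u + secOfTest s v := by
  funext z
  by_cases hz : z = 0
  · simp [hz, secOfTest_zero]
  · simp only [secOfTest_of_ne _ _ hz, Pi.add_apply]
    ring

lemma secOfTest_smul (s w : ℂ) (u : K → ℂ) : secOfTest s (w • u) = w • secOfTest s u := by
  funext z
  by_cases hz : z = 0
  · simp [hz, secOfTest_zero]
  · simp only [secOfTest_of_ne _ _ hz, Pi.smul_apply, smul_eq_mul]
    ring

lemma differentiable_secOfTest (u : K → ℂ) (z : K) :
    Differentiable ℂ fun p : ℂ × ℂ => secOfTest p.1 u z := by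
  by_cases hz : z = 0
  · simp only [hz, secOfTest_zero]
    exact differentiable_const _
  · simp only [secOfTest_of_ne _ _ hz]
    have h0 : ((absV z : ℝ) : ℂ) ≠ 0 := by exact_mod_cast (absV_pos hz).ne'
    refine Differentiable.mul_const ?_ _
    exact ((differentiable_fst.const_mul 2).add_const 1).neg.const_cpow (Or.inl h0)

end LocalField

/-! ### Normalization and the kernel in the inverted chart -/

section Extension

variable {F E : Type*}
  [Field F] [ValuativeRel F] [TopologicalSpace F] [IsNonarchimedeanLocalField F]
  [Field E] [ValuativeRel E] [TopologicalSpace E] [IsNonarchimedeanLocalField E]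
  [Algebra F E] [ValuativeExtension F E]

/-- Parameters for which the invariant functional has the normalization of the renormalized
kernel. -/
structure IsNormalizing (χ : PontryaginDual 𝒪[E]ˣ) (η : PontryaginDual 𝒪[F]ˣ)
    (ϖE : Uniformizer E) (ϖF : Uniformizer F) (c e : F) (N : ℂ) : Prop where
  left_ne_zero : c ≠ 0
  right_ne_zero : e ≠ 0
  mul_eq : ∀ s t, N * ((1 - (mixedChar χ η ϖE ϖF s t e)⁻¹ * ((absV e : ℝ) : ℂ)⁻¹) *
    (1 - ((absV (algebraMap F E c) : ℝ) : ℂ) ^ (2 * s) * (mixedChar χ η ϖE ϖF s t c)⁻¹)) =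
      normFactor χ η s t

variable {χ : PontryaginDual 𝒪[E]ˣ} {η : PontryaginDual 𝒪[F]ˣ}
  {ϖE : Uniformizer E} {ϖF : Uniformizer F} {α : E} {a : F} (hα : IsSqrtGenerator α a)

lemma resChar_sq (hχ : χ ^ 2 = 1) : resChar F χ * resChar F χ = 1 := by
  ext u
  have h : χ (Units.map (integersMap F E).toMonoidHom u) ^ 2 = 1 := by
    rw [← pontryaginDual_sq_apply, hχ, PontryaginDual.one_apply]
  rw [pow_two] at h
  exact congrArg _ h

lemma mixedChar_unit (s t : ℂ) (u : 𝒪[F]ˣ) :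
    mixedChar χ η ϖE ϖF s t ((u : 𝒪[F]) : F) = (resChar F χ u : ℂ) * (η u : ℂ) := by
  have h : algebraMap F E ((u : 𝒪[F]) : F) =
      ((Units.map (integersMap F E).toMonoidHom u : 𝒪[E]ˣ) : 𝒪[E]) := rfl
  rw [mixedChar, quasiChar_unit, h, quasiChar_unit]
  rfl

include hα in
lemma IsSqrtGenerator.mixedChar_uniformizer (hϖ : quasiChar χ ϖE 0 (algebraMap F E ϖF) = 1)
    (s t : ℂ) : mixedChar χ η ϖE ϖF s t ϖF = (resCard F : ℂ) ^ (-(2 * s + t - 1 / 2)) := by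
  have h0 : algebraMap F E ϖF ≠ 0 := by simpa using ϖF.ne_zero
  have hq := resCard_ne_zero F
  have h1 := quasiChar_add_exponent χ ϖE 0 (s - 1 / 2) h0
  rw [zero_add, hϖ, one_mul, hα.absV_algebraMap ϖE ϖF, ϖF.absV_eq] at h1
  rw [mixedChar, quasiChar_uniformizer, h1, natCast_inv_sq_cpow hq, ← Complex.cpow_add _ _ hq]
  congr 1
  ring

-- Since `λ(ϖ_F) = q^{-(2s+t-1/2)}`, the twist factor is `1 - q^{-(2s+t-1/2)} q⁻¹ = c₊` and the
-- dilation factor is `1 - q^{-4s} q^{2s+t-1/2} = c₋`.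
include hα in
lemma IsSqrtGenerator.isNormalizing_uniformizer (hχ : χ ^ 2 = 1)
    (hϖ : quasiChar χ ϖE 0 (algebraMap F E ϖF) = 1)
    (hη : (η : 𝒪[F]ˣ →* Circle) = resChar F χ) :
    IsNormalizing χ η ϖE ϖF ϖF (ϖF : F)⁻¹ 1 := by
  refine ⟨ϖF.ne_zero, inv_ne_zero ϖF.ne_zero, fun s t => ?_⟩
  have hq := resCard_ne_zero F
  have h1 : resChar F χ * (η : 𝒪[F]ˣ →* Circle) = 1 := by rw [hη, resChar_sq hχ]
  have h2 : resChar F χ * (η : 𝒪[F]ˣ →* Circle)⁻¹ = 1 := by rw [hη, mul_inv_cancel]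
  rw [normFactor, localL, localL, if_pos h1, if_pos h2, inv_inv, inv_inv, one_mul, mixedChar_inv,
    inv_inv, hα.mixedChar_uniformizer hϖ, absV_inv, ϖF.absV_eq, inv_inv,
    hα.absV_algebraMap ϖE ϖF, ϖF.absV_eq, natCast_inv_sq_cpow hq, ← Complex.cpow_neg,
    ← Complex.cpow_add _ _ hq, Complex.ofReal_natCast, ← Complex.cpow_neg_one,
    ← Complex.cpow_add _ _ hq]
  congr 3
  · ring
  · ring

/-- The restriction of `χ` is its own inverse, so both local factors are trivial and `λ` is
nontrivial on units. For a unit `u` with `λ(u) ≠ 1`, both regularizing factors equal the nonzero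
constant `1 - λ(u)⁻¹`, independent of `s` and `t`. -/
lemma exists_isNormalizing_of_ne (hχ : χ ^ 2 = 1) (hη : (η : 𝒪[F]ˣ →* Circle) ≠ resChar F χ) :
    ∃ c e N, IsNormalizing χ η ϖE ϖF c e N := by
  have h2 : resChar F χ * (η : 𝒪[F]ˣ →* Circle)⁻¹ ≠ 1 := fun h => hη (mul_inv_eq_one.1 h).symm
  have h1 : resChar F χ * (η : 𝒪[F]ˣ →* Circle) ≠ 1 := fun h => hη <| by
    rw [← mul_left_cancel_iff (a := resChar F χ), h, resChar_sq hχ]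
  obtain ⟨u, hu⟩ : ∃ u, (resChar F χ * (η : 𝒪[F]ˣ →* Circle)) u ≠ 1 := by
    by_contra! h
    exact h1 (MonoidHom.ext h)
  have hu' : (resChar F χ u : ℂ) * (η u : ℂ) ≠ 1 := fun h => hu (Circle.ext h)
  let ℓ : ℂ := 1 - ((resChar F χ u : ℂ) * (η u : ℂ))⁻¹
  have hℓ : ℓ ≠ 0 := sub_ne_zero.2 (inv_ne_one.2 hu').symm
  have hE : absV (algebraMap F E ((u : 𝒪[F]) : F)) = 1 :=
    absV_unit (Units.map (integersMap F E).toMonoidHom u : 𝒪[E]ˣ)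
  refine ⟨((u : 𝒪[F]) : F), ((u : 𝒪[F]) : F), (ℓ * ℓ)⁻¹, coe_unit_ne_zero u, coe_unit_ne_zero u,
    fun s t => ?_⟩
  rw [normFactor, localL, localL, if_neg h1, if_neg h2, mixedChar_unit, hE, absV_unit]
  simp only [Complex.ofReal_one, inv_one, mul_one, Complex.one_cpow, one_mul]
  exact inv_mul_cancel₀ (mul_ne_zero hℓ hℓ)

include hα in
lemma IsSqrtGenerator.exists_isNormalizing (hχ : χ ^ 2 = 1)
    (hϖ : quasiChar χ ϖE 0 (algebraMap F E ϖF) = 1) :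
    ∃ c e N, IsNormalizing χ η ϖE ϖF c e N := by
  by_cases hη : (η : 𝒪[F]ˣ →* Circle) = resChar F χ
  · exact ⟨_, _, _, hα.isNormalizing_uniformizer hχ hϖ hη⟩
  · exact exists_isNormalizing_of_ne hχ hη

-- By `imPart_inv` the rational expression becomes linear in `z`, and `χ² = 1` leaves only an
-- absolute value from the factor at `x²`.
include hα in
lemma IsSqrtGenerator.kernelFun_inv (hχ : χ ^ 2 = 1) (s t : ℂ) {z : E} (hz : z ≠ 0) :
    kernelFun χ η ϖE ϖF α a s t z⁻¹ =
      ((absV z : ℝ) : ℂ) ^ (-(2 * s - 1)) * mixedChar χ η ϖE ϖF s t (-imPart F α z) := by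
  have hz' := inv_ne_zero hz
  have h1 : imPart F α z⁻¹ / (rePart F α z⁻¹ ^ 2 - imPart F α z⁻¹ ^ 2 * a) = -imPart F α z := by
    have := hα.imPart_inv hz'
    rw [inv_inv] at this
    rw [this, neg_neg]
  have h2 : quasiChar χ ϖE (s - 1 / 2) (z⁻¹ ^ 2) = ((absV z : ℝ) : ℂ) ^ (-(2 * s - 1)) := by
    rw [inv_pow, quasiChar_inv, pow_two, quasiChar_mul, ← pow_two, quasiChar_sq hχ _ _ hz,
      Complex.cpow_neg]
    congr 2
    ring
  rw [← h2, ← h1]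
  rfl

variable [MeasurableSpace E] [BorelSpace E]

-- The Jacobian `|z|⁻²` and the factor `|z|^{-(2s-1)}` of the kernel combine to the factor
-- `|z|^{-(2s+1)}` built into `secOfTest`.
include hα in
lemma IsSqrtGenerator.integral_kernelFun_mul (hχ : χ ^ 2 = 1) (s t : ℂ) (u : E → ℂ) :
    ∫ x, kernelFun χ η ϖE ϖF α a s t x * u x ∂haar E =
      ∫ z, mixedChar χ η ϖE ϖF s t (-imPart F α z) * secOfTest s u z ∂haar E := by
  rw [integral_inv_haar ϖE]
  congr 1
  funext z
  by_cases hz : z = 0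
  · simp [hz, absV_zero, secOfTest_zero]
  have h0 : ((absV z : ℝ) : ℂ) ≠ 0 := by exact_mod_cast (absV_pos hz).ne'
  have h1 : ((absV z : ℝ) : ℂ) ^ (-(2 * s + 1)) =
      (((absV z : ℝ) : ℂ) ^ 2)⁻¹ * ((absV z : ℝ) : ℂ) ^ (-(2 * s - 1)) := by
    rw [← Complex.cpow_natCast, ← Complex.cpow_neg, ← Complex.cpow_add _ _ h0]
    congr 1
    push_cast
    ring
  rw [hα.kernelFun_inv hχ s t hz, secOfTest_of_ne s u hz, h1]
  ring

/-- The distribution given by the invariant functional. -/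
def IsSqrtGenerator.distribution {c e : F} {N : ℂ} (hn : IsNormalizing χ η ϖE ϖF c e N)
    (s t : ℂ) : Distribution E where
  toFun u := N * invFunctional χ η ϖE ϖF α c e s t (secOfTest s (u : E → ℂ))
  map_add' u v := by
    rw [Submodule.coe_add, secOfTest_add, hα.invFunctional_add hn.left_ne_zero hn.right_ne_zero s t
      (isSectionAt_secOfTest s u.2.1 u.2.2) (isSectionAt_secOfTest s v.2.1 v.2.2), mul_add]
  map_smul' w u := by
    rw [Submodule.coe_smul, secOfTest_smul, invFunctional_smul, RingHom.id_apply, smul_eq_mul]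
    ring

lemma IsSqrtGenerator.isRenormalizedKernel_distribution (hχ : χ ^ 2 = 1) {c e : F} {N : ℂ}
    (hn : IsNormalizing χ η ϖE ϖF c e N) :
    IsRenormalizedKernel χ η ϖE ϖF α a (hα.distribution hn) := by
  have hc' : algebraMap F E c ≠ 0 := by simpa using hn.left_ne_zero
  refine ⟨fun u => ?_, fun s t h h' u => ?_⟩
  · have hu := isSection_secOfTest u.2.1 u.2.2
    refine Differentiable.const_mul ?_ N
    refine differentiable_integral_of_isLocallyConstant
      (hα.isLocallyConstant_regIntegrand e (σ := Prod.fst) (τ := Prod.snd)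
        (isLocallyConstant_dilationDiff (algebraMap F E c) (σ := Prod.fst) hu.1))
      (hα.hasCompactSupport_regIntegrand hn.right_ne_zero (σ := Prod.fst) (τ := Prod.snd)
        (hu.hasCompactSupport_dilationDiff hc')) fun z => ?_
    have h0 : ((absV (algebraMap F E c) : ℝ) : ℂ) ≠ 0 := by exact_mod_cast (absV_pos hc').ne'
    have hd : ∀ z : E, Differentiable ℂ fun p : ℂ × ℂ =>
        dilationDiff (algebraMap F E c) p.1 (secOfTest p.1 (u : E → ℂ)) z := fun z =>
      (differentiable_secOfTest _ _).sub
        ((((differentiable_fst.const_mul 2).add_const 1).const_cpow (Or.inl h0)).mul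
          (differentiable_secOfTest _ _))
    exact (differentiable_mixedChar χ η ϖE ϖF _).mul ((hd _).sub (hd _))
  · change N * invFunctional χ η ϖE ϖF α c e s t (secOfTest s (u : E → ℂ)) = _
    rw [hα.invFunctional_eq hn.left_ne_zero hn.right_ne_zero h h'
      (isSectionAt_secOfTest s u.2.1 u.2.2), hα.integral_kernelFun_mul hχ, ← hn.mul_eq]
    ring

lemma IsRenormalizedKernel.unique {K₁ K₂ : ℂ → ℂ → Distribution E}
    (h₁ : IsRenormalizedKernel χ η ϖE ϖF α a K₁) (h₂ : IsRenormalizedKernel χ η ϖE ϖF α a K₂) :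
    K₁ = K₂ := by
  funext s t
  refine LinearMap.ext fun u => ?_
  have hline : Differentiable ℂ fun p : ℂ => ((p, t) : ℂ × ℂ) :=
    differentiable_id.prodMk (differentiable_const t)
  have hd₁ : AnalyticOnNhd ℂ ((fun p : ℂ × ℂ => K₁ p.1 p.2 u) ∘ fun p : ℂ => (p, t)) Set.univ :=
    fun p _ => Differentiable.analyticAt ((h₁.1 u).comp hline) p
  have hd₂ : AnalyticOnNhd ℂ ((fun p : ℂ × ℂ => K₂ p.1 p.2 u) ∘ fun p : ℂ => (p, t)) Set.univ :=
    fun p _ => Differentiable.analyticAt ((h₂.1 u).comp hline) p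
  -- For fixed `t` the half-plane `Re s > |Re t|` lies in the domain of convergence, so the identity
  -- theorem applies on the complex line through it.
  have hev : ((fun p : ℂ × ℂ => K₁ p.1 p.2 u) ∘ fun p : ℂ => (p, t)) =ᶠ[𝓝 ((|t.re| + 1 : ℝ) : ℂ)]
      ((fun p : ℂ × ℂ => K₂ p.1 p.2 u) ∘ fun p : ℂ => (p, t)) := by
    have ho : IsOpen {p : ℂ | |t.re| < p.re} := isOpen_lt continuous_const Complex.continuous_re
    filter_upwards [ho.mem_nhds (x := ((|t.re| + 1 : ℝ) : ℂ)) (by simp)] with p hp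
    have hp' : |t.re| < p.re := hp
    have h3 := abs_lt.1 hp'
    have h4 := abs_nonneg t.re
    have h5 : 0 < (2 * p + t + 1 / 2).re := by
      simp
      linarith
    have h6 : 0 < (2 * p - t + 1 / 2).re := by
      simp
      linarith
    simp only [Function.comp_apply]
    rw [h₁.2 p t h5 h6 u, h₂.2 p t h5 h6 u]
  exact congrFun (hd₁.eq_of_eventuallyEq hd₂ hev) s

include hα in
lemma IsSqrtGenerator.existsUnique_isRenormalizedKernel (hχ : χ ^ 2 = 1)
    (hϖ : quasiChar χ ϖE 0 (algebraMap F E ϖF) = 1) :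
    ∃! Kt : ℂ → ℂ → Distribution E, IsRenormalizedKernel χ η ϖE ϖF α a Kt := by
  obtain ⟨c, e, N, hn⟩ := hα.exists_isNormalizing (η := η) hχ hϖ
  exact ⟨_, hα.isRenormalizedKernel_distribution hχ hn, fun K hK =>
    hK.unique (hα.isRenormalizedKernel_distribution hχ hn)⟩

lemma IsSqrtGenerator.renormalizedKernel_eq (hχ : χ ^ 2 = 1) {c e : F} {N : ℂ}
    (hn : IsNormalizing χ η ϖE ϖF c e N) :
    renormalizedKernel χ η ϖE ϖF α a = hα.distribution hn :=
  (Classical.epsilon_spec ⟨_, hα.isRenormalizedKernel_distribution hχ hn⟩ :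
    IsRenormalizedKernel χ η ϖE ϖF α a (renormalizedKernel χ η ϖE ϖF α a)).unique
      (hα.isRenormalizedKernel_distribution hχ hn)

end Extension

/-! ### Principal series in the two charts -/

section LocalField

variable {K : Type*} [Field K] [ValuativeRel K] [TopologicalSpace K]
  [IsNonarchimedeanLocalField K]

/-- The matrices parametrizing the dual big cell. -/
def dualMat (z : K) : GL (Fin 2) K where
  val := !![z, -1; 1, 0]
  inv := !![0, 1; -1, z]
  val_inv := by simp [Matrix.one_fin_two]
  inv_val := by simp [Matrix.one_fin_two]

lemma coe_dualMat (z : K) : (dualMat z : Matrix (Fin 2) (Fin 2) K) = !![z, -1; 1, 0] := rfl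

/-- Upper triangular matrices. -/
def upperMat (a b d : K) (h : a * d ≠ 0) : GL (Fin 2) K :=
  Matrix.GeneralLinearGroup.mkOfDetNeZero !![a, b; 0, d] (by simpa using h)

lemma coe_upperMat (a b d : K) (h : a * d ≠ 0) :
    (upperMat a b d h : Matrix (Fin 2) (Fin 2) K) = !![a, b; 0, d] := rfl

lemma coe_lowerUnip (x : K) : (lowerUnip x : Matrix (Fin 2) (Fin 2) K) = !![1, 0; x, 1] := rfl

lemma continuous_dualMat : Continuous (dualMat : K → GL (Fin 2) K) := by
  rw [Units.continuous_iff]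
  constructor
  · change Continuous fun z : K => !![z, -1; 1, 0]
    fun_prop
  · change Continuous fun z : K => !![0, 1; -1, z]
    fun_prop

lemma lowerUnip_mul (x y : K) : lowerUnip x * lowerUnip y = lowerUnip (y + x) := by
  ext i j
  rw [Units.val_mul, coe_lowerUnip, coe_lowerUnip, coe_lowerUnip]
  fin_cases i <;> fin_cases j <;> simp [Matrix.mul_apply, add_comm]

lemma lowerUnip_zero : lowerUnip (0 : K) = 1 := by
  ext i j
  rw [coe_lowerUnip]
  fin_cases i <;> fin_cases j <;> simp

lemma continuous_lowerUnip : Continuous (lowerUnip : K → GL (Fin 2) K) := by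
  have hinv : ∀ x : K, (lowerUnip x)⁻¹ = lowerUnip (-x) := fun x =>
    inv_eq_of_mul_eq_one_left (by rw [lowerUnip_mul, add_neg_cancel, lowerUnip_zero])
  have h : Continuous fun z : K => !![1, 0; z, 1] := by fun_prop
  rw [Units.continuous_iff]
  constructor
  · exact h
  · simp_rw [hinv]
    exact h.comp continuous_neg

/-- The transition between the two charts is `x = z⁻¹`; the upper triangular factor is responsible
for `|z|^{-(2s+1)}` in `principalSeries_dualMat`. -/
lemma lowerUnip_mul_upperMat {z : K} (hz : z ≠ 0) :
    lowerUnip z⁻¹ * upperMat z (-1) z⁻¹ (mul_ne_zero hz (inv_ne_zero hz)) = dualMat z := by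
  ext i j
  rw [Units.val_mul, coe_lowerUnip, coe_upperMat, coe_dualMat]
  fin_cases i <;> fin_cases j <;> simp [Matrix.mul_apply, hz]

variable {χ : PontryaginDual 𝒪[K]ˣ} {ϖ : Uniformizer K} {s : ℂ}

lemma principalSeries_dualMat (hχ : χ ^ 2 = 1) (f : principalSeries χ ϖ s) (g : PGL(2, K)) {z : K}
    (hz : z ≠ 0) : (f : PGL(2, K) → ℂ) (g * .mk (dualMat z)) =
      ((absV z : ℝ) : ℂ) ^ (-(2 * s + 1)) * (f : PGL(2, K) → ℂ) (g * .mk (lowerUnip z⁻¹)) := by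
  have h := f.2.2 (g * .mk (lowerUnip z⁻¹))
    (upperMat z (-1) z⁻¹ (mul_ne_zero hz (inv_ne_zero hz))) rfl
  rw [mul_assoc, ← map_mul, lowerUnip_mul_upperMat hz] at h
  rw [h]
  congr 1
  change (quasiChar χ ϖ (s + 1 / 2) (z / z⁻¹))⁻¹ = _
  rw [div_inv_eq_mul, quasiChar_mul, ← pow_two, quasiChar_sq hχ _ _ hz, ← Complex.cpow_neg]
  congr 1
  ring

lemma isLocallyConstant_principalSeries_comp (f : principalSeries χ ϖ s) {X : Type*}
    [TopologicalSpace X] {φ : X → GL (Fin 2) K} (hφ : Continuous φ) :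
    IsLocallyConstant fun x => (f : PGL(2, K) → ℂ) (.mk (φ x)) :=
  f.2.1.comp_continuous hφ

lemma isSectionAt_principalSeries (hχ : χ ^ 2 = 1) (f : principalSeries χ ϖ s) (g : PGL(2, K)) :
    IsSectionAt s fun z => (f : PGL(2, K) → ℂ) (g * .mk (dualMat z)) := by
  induction g using Matrix.ProjGenLinGroup.induction_on with | mk g =>
  rw [IsSectionAt, isSection_const_iff]
  constructor
  · simp_rw [← map_mul]
    exact isLocallyConstant_principalSeries_comp f (continuous_dualMat.const_mul g)
  · have h1 := isLocallyConstant_principalSeries_comp f (continuous_lowerUnip.const_mul g)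
    obtain ⟨δ, hδ, h⟩ := mem_nhds_iff_absV.1 (h1.eventually_eq 0)
    refine ⟨2 / δ, (f : PGL(2, K) → ℂ) (.mk (g * lowerUnip 0)), fun z hz => ?_⟩
    have hz0 : z ≠ 0 := by
      rintro rfl
      rw [absV_zero] at hz
      exact absurd hz (not_le.2 (by positivity))
    have h2 := h z⁻¹ (by
      rw [sub_zero, absV_inv, inv_lt_comm₀ (absV_pos hz0) hδ]
      refine lt_of_lt_of_le ?_ hz
      rw [inv_eq_one_div]
      gcongr
      norm_num)
    rw [principalSeries_dualMat hχ f _ hz0, ← map_mul]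
    congr 1

/-- Uniformity in `z` follows from compactness of the projective line, covered by the unit balls of
the two charts. It makes the output of the operator locally constant. -/
lemma eventually_principalSeries_dualMat_eq (hχ : χ ^ 2 = 1) (f : principalSeries χ ϖ s)
    (g₀ : GL (Fin 2) K) : ∀ᶠ g in 𝓝 g₀, ∀ z : K, (f : PGL(2, K) → ℂ) (.mk (g * dualMat z)) =
      (f : PGL(2, K) → ℂ) (.mk (g₀ * dualMat z)) := by
  have key : ∀ φ : K → GL (Fin 2) K, Continuous φ → ∀ᶠ g in 𝓝 g₀, ∀ z ∈ {z : K | absV z ≤ 1},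
      (f : PGL(2, K) → ℂ) (.mk (g * φ z)) = (f : PGL(2, K) → ℂ) (.mk (g₀ * φ z)) := by
    intro φ hφ
    refine (isCompact_absV_le K 1).eventually_forall_of_forall_eventually fun z _ => ?_
    have h1 := isLocallyConstant_principalSeries_comp f
      (φ := fun p : GL (Fin 2) K × K => p.1 * φ p.2) (by fun_prop)
    have h2 := isLocallyConstant_principalSeries_comp f
      (φ := fun p : GL (Fin 2) K × K => g₀ * φ p.2) (by fun_prop)
    filter_upwards [h1.eventually_eq (g₀, z), h2.eventually_eq (g₀, z)] with p hp1 hp2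
    rw [hp1, hp2]
  filter_upwards [key _ continuous_dualMat, key _ continuous_lowerUnip] with g h1 h2 z
  rcases le_or_gt (absV z) 1 with hz | hz
  · exact h1 z hz
  · have hz0 : z ≠ 0 := by
      rintro rfl
      rw [absV_zero] at hz
      exact absurd hz (by norm_num)
    have h3 := h2 z⁻¹ (by
      rw [absV_inv]
      exact inv_le_one_of_one_le₀ hz.le)
    rw [map_mul, map_mul, principalSeries_dualMat hχ f _ hz0, principalSeries_dualMat hχ f _ hz0,
      ← map_mul, ← map_mul, h3]

/-- The lower unipotent matrices with integral entries, modulo upper triangular matrices. -/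
def lowerCell (K : Type*) [Field K] [ValuativeRel K] [TopologicalSpace K]
    [IsNonarchimedeanLocalField K] : Set PGL(2, K) :=
  {x | ∃ g : GL (Fin 2) K, .mk g = x ∧ absV (g 1 0) ≤ absV (g 0 0)}

lemma mk_mem_lowerCell {g : GL (Fin 2) K} :
    .mk g ∈ lowerCell K ↔ absV (g 1 0) ≤ absV (g 0 0) := by
  constructor
  · rintro ⟨h, hh, hle⟩
    obtain ⟨u, rfl⟩ := Matrix.ProjGenLinGroup.mk_eq_mk_iff.1 hh
    have h1 : ∀ i : Fin 2, (h * Matrix.GeneralLinearGroup.scalar (Fin 2) u : GL (Fin 2) K) i 0 =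
        h i 0 * u := by
      intro i
      simp [Matrix.mul_apply, Fin.sum_univ_two]
    rw [h1, h1, absV_mul, absV_mul]
    exact mul_le_mul_of_nonneg_right hle (absV_nonneg _)
  · exact fun h => ⟨g, rfl, h⟩

lemma mul_mem_lowerCell (g : PGL(2, K)) (b : GL (Fin 2) K) (hb : b 1 0 = 0) :
    g * .mk b ∈ lowerCell K ↔ g ∈ lowerCell K := by
  induction g using Matrix.ProjGenLinGroup.induction_on with | mk g =>
  have hb0 : b 0 0 ≠ 0 := fun h => GL_column_ne_zero b (by rw [h, hb]; rfl)
  have h1 : ∀ i : Fin 2, (g * b) i 0 = g i 0 * b 0 0 := by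
    intro i
    simp [Matrix.mul_apply, Fin.sum_univ_two, hb]
  rw [← map_mul, mk_mem_lowerCell, mk_mem_lowerCell, h1, h1, absV_mul, absV_mul,
    mul_le_mul_iff_left₀ (absV_pos hb0)]

lemma eventually_absV_le_absV_iff (p : K × K) (hp : p ≠ 0) :
    ∀ᶠ x in 𝓝 p, (absV x.2 ≤ absV x.1 ↔ absV p.2 ≤ absV p.1) := by
  have hc1 : Continuous fun x : K × K => absV x.1 := continuous_absV.comp continuous_fst
  have hc2 : Continuous fun x : K × K => absV x.2 := continuous_absV.comp continuous_snd
  rcases lt_or_ge (absV p.1) (absV p.2) with h | h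
  · filter_upwards [hc1.continuousAt.eventually_lt hc2.continuousAt h] with x hx
    exact iff_of_false (not_le.2 hx) (not_le.2 h)
  · have hp1 : p.1 ≠ 0 := by
      intro h0
      rw [h0, absV_zero] at h
      exact hp (Prod.ext h0 (absV_eq_zero.1 (le_antisymm h (absV_nonneg _))))
    filter_upwards [(continuous_fst.tendsto p).eventually (eventually_absV_eq hp1),
      (continuous_snd.tendsto p).eventually (eventually_absV_sub_lt p.2 (absV_pos hp1))]
      with x h1 h2
    have h3 : absV x.2 ≤ max (absV (x.2 - p.2)) (absV p.2) := by
      simpa using absV_add_le (x.2 - p.2) p.2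
    refine iff_of_true ?_ h
    rw [h1]
    exact h3.trans (max_le h2.le h)

/-- The restriction of a function in the principal series to `lowerCell`. -/
def restrictLowerCell (f : principalSeries χ ϖ s) : principalSeries χ ϖ s :=
  ⟨(lowerCell K).indicator f, by
    constructor
    · rw [IsLocallyConstant.iff_eventually_eq]
      intro g
      have hcol : Continuous fun x : GL (Fin 2) K => ((x 0 0, x 1 0) : K × K) :=
        (Units.continuous_val.matrix_elem 0 0).prodMk (Units.continuous_val.matrix_elem 1 0)
      filter_upwards [f.2.1.eventually_eq g, (hcol.tendsto g).eventually
        (eventually_absV_le_absV_iff _ (GL_column_ne_zero g))] with x h1 h2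
      have h3 : .mk x ∈ lowerCell K ↔ .mk g ∈ lowerCell K := by
        rw [mk_mem_lowerCell, mk_mem_lowerCell]
        exact h2
      by_cases hg : .mk g ∈ lowerCell K
      · rw [Set.indicator_of_mem hg, Set.indicator_of_mem (h3.2 hg), h1]
      · rw [Set.indicator_of_notMem hg, Set.indicator_of_notMem (mt h3.1 hg)]
    · intro g b hb
      have h1 := mul_mem_lowerCell g b hb
      by_cases hg : g ∈ lowerCell K
      · rw [Set.indicator_of_mem hg, Set.indicator_of_mem (h1.2 hg), f.2.2 g b hb]
      · rw [Set.indicator_of_notMem hg, Set.indicator_of_notMem (mt h1.1 hg), mul_zero]⟩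

lemma restrictLowerCell_of_mem (f : principalSeries χ ϖ s) {g : PGL(2, K)} (hg : g ∈ lowerCell K) :
    (restrictLowerCell f : PGL(2, K) → ℂ) g = (f : PGL(2, K) → ℂ) g :=
  Set.indicator_of_mem hg _

lemma restrictLowerCell_of_notMem (f : principalSeries χ ϖ s) {g : PGL(2, K)}
    (hg : g ∉ lowerCell K) : (restrictLowerCell f : PGL(2, K) → ℂ) g = 0 :=
  Set.indicator_of_notMem hg _

end LocalField

/-! ### The renormalized operator -/

section Extension

variable {F E : Type*}
  [Field F] [ValuativeRel F] [TopologicalSpace F] [IsNonarchimedeanLocalField F]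
  [Field E] [ValuativeRel E] [TopologicalSpace E] [IsNonarchimedeanLocalField E]
  [Algebra F E] [ValuativeExtension F E]
  {χ : PontryaginDual 𝒪[E]ˣ} {η : PontryaginDual 𝒪[F]ˣ}
  {ϖE : Uniformizer E} {ϖF : Uniformizer F} {α : E} {a : F}

/-- Upper triangular matrices fix infinity, so in this chart they act by affine maps. -/
lemma upperMat_mul_dualMat {K : Type*} [Field K] [ValuativeRel K] [TopologicalSpace K]
    [IsNonarchimedeanLocalField K] {g : GL (Fin 2) K} (hg : g 1 0 = 0) (h0 : g 0 0 ≠ 0)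
    (h1 : g 1 1 ≠ 0) (z : K) :
    g * dualMat z = dualMat (g 0 0 / g 1 1 * z + g 0 1 / g 1 1) *
      upperMat (g 1 1) 0 (g 0 0) (mul_ne_zero h1 h0) := by
  ext i j
  rw [Units.val_mul, Units.val_mul, coe_dualMat, coe_dualMat, coe_upperMat]
  fin_cases i <;> fin_cases j <;> simp [Matrix.mul_apply, hg]
  field_simp

variable (F) in
/-- The restriction to the dual big cell of a left translate of `f`. -/
def dualSection (f : PGL(2, E) → ℂ) (g : PGL(2, F)) (z : E) : ℂ :=
  f (Matrix.ProjGenLinGroup.map (algebraMap F E) g * .mk (dualMat z))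

lemma isSectionAt_dualSection (hχ : χ ^ 2 = 1) {s : ℂ} (f : principalSeries χ ϖE s)
    (g : PGL(2, F)) : IsSectionAt s (dualSection F (f : PGL(2, E) → ℂ) g) :=
  isSectionAt_principalSeries hχ f _

lemma dualSection_mul {s : ℂ} (f : principalSeries χ ϖE s) (g : PGL(2, F)) {b : GL (Fin 2) F}
    (hb : b 1 0 = 0) (h0 : b 0 0 ≠ 0) (h1 : b 1 1 ≠ 0) :
    dualSection F (f : PGL(2, E) → ℂ) (g * .mk b) =
      quasiChar χ ϖE (s + 1 / 2) (algebraMap F E (b 0 0 / b 1 1)) •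
        fun z => dualSection F (f : PGL(2, E) → ℂ) g
          (algebraMap F E (b 0 0 / b 1 1) * z + algebraMap F E (b 0 1 / b 1 1)) := by
  funext z
  let b' : GL (Fin 2) E := Matrix.GeneralLinearGroup.map (algebraMap F E) b
  have hb' : ∀ i j, b' i j = algebraMap F E (b i j) := fun i j => rfl
  have h0' : b' 0 0 ≠ 0 := by simpa [hb'] using h0
  have h1' : b' 1 1 ≠ 0 := by simpa [hb'] using h1
  have hmat := upperMat_mul_dualMat (g := b') (by simp [hb', hb]) h0' h1' z
  have h2 := f.2.2 (Matrix.ProjGenLinGroup.map (algebraMap F E) g *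
    .mk (dualMat (b' 0 0 / b' 1 1 * z + b' 0 1 / b' 1 1)))
    (upperMat (b' 1 1) 0 (b' 0 0) (mul_ne_zero h1' h0')) rfl
  rw [mul_assoc, ← map_mul, ← hmat] at h2
  change (f : PGL(2, E) → ℂ) (Matrix.ProjGenLinGroup.map (algebraMap F E) (g * .mk b) *
    .mk (dualMat z)) = _
  rw [map_mul, Matrix.ProjGenLinGroup.map_mk, mul_assoc, ← map_mul, h2]
  change (quasiChar χ ϖE (s + 1 / 2) (b' 1 1 / b' 0 0))⁻¹ * _ = _
  rw [← quasiChar_inv, inv_div, hb', hb', hb', ← map_div₀, ← map_div₀]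
  rfl

lemma eventually_dualSection_eq (hχ : χ ^ 2 = 1) {s : ℂ} (f : principalSeries χ ϖE s)
    (g₀ : GL (Fin 2) F) : ∀ᶠ g in 𝓝 g₀, dualSection F (f : PGL(2, E) → ℂ) (.mk g) =
      dualSection F (f : PGL(2, E) → ℂ) (.mk g₀) := by
  have hc : Continuous (Matrix.GeneralLinearGroup.map (n := Fin 2) (algebraMap F E)) := by
    refine Continuous.units_map _ ?_
    exact Continuous.matrix_map continuous_id (continuous_algebraMap_localField F E)
  filter_upwards [(hc.tendsto g₀).eventually (eventually_principalSeries_dualMat_eq hχ f _)]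
    with g hg
  funext z
  exact hg z

lemma dualSection_rep {s : ℂ} (f : principalSeries χ ϖE s) (g x : PGL(2, F)) :
    dualSection F (((principalSeriesRep χ ϖE s).comp
      (Matrix.ProjGenLinGroup.map (algebraMap F E)) g f : principalSeries χ ϖE s) :
        PGL(2, E) → ℂ) x = dualSection F (f : PGL(2, E) → ℂ) (g⁻¹ * x) := by
  funext z
  change (f : PGL(2, E) → ℂ) ((Matrix.ProjGenLinGroup.map (algebraMap F E) g)⁻¹ *
    (Matrix.ProjGenLinGroup.map (algebraMap F E) x * .mk (dualMat z))) = _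
  rw [← mul_assoc, ← map_inv, ← map_mul]
  rfl

lemma dualSection_lowerUnip (hχ : χ ^ 2 = 1) {s : ℂ} (f : principalSeries χ ϖE s) (y : F)
    (u : TestFunction E)
    (hu : ∀ x : E, (u : E → ℂ) x =
      (f : PGL(2, E) → ℂ) (.mk (lowerUnip (x + algebraMap F E y)))) :
    dualSection F (f : PGL(2, E) → ℂ) (.mk (lowerUnip y)) = secOfTest s (u : E → ℂ) := by
  have hmap : Matrix.ProjGenLinGroup.map (algebraMap F E) (.mk (lowerUnip y)) =
      .mk (lowerUnip (algebraMap F E y)) := by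
    rw [Matrix.ProjGenLinGroup.map_mk]
    congr 1
    ext i j
    rw [coe_lowerUnip]
    change algebraMap F E (lowerUnip y i j) = _
    rw [coe_lowerUnip]
    fin_cases i <;> fin_cases j <;> simp
  have hne : ∀ z : E, z ≠ 0 → dualSection F (f : PGL(2, E) → ℂ) (.mk (lowerUnip y)) z =
      secOfTest s (u : E → ℂ) z := by
    intro z hz
    rw [dualSection, hmap, principalSeries_dualMat hχ f _ hz, secOfTest_of_ne _ _ hz, hu,
      ← map_mul, lowerUnip_mul]
  funext z
  -- The charts do not overlap at `z = 0`; there, equality follows from local constancy of both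
  -- sides, as `0` is not isolated.
  by_cases hz : z = 0
  · subst hz
    have h1 := (isSectionAt_dualSection hχ f
      (.mk (lowerUnip y) : PGL(2, F))).isLocallyConstant.eventually_eq 0
    have h2 := (isSectionAt_secOfTest s u.2.1 u.2.2).isLocallyConstant.eventually_eq 0
    obtain ⟨x, hx, hx0⟩ := accPt_absV (0 : E) _ (h1.and h2)
    rw [← hx.1, ← hx.2, hne x hx0]
  · exact hne z hz

variable [MeasurableSpace E] [BorelSpace E] (hα : IsSqrtGenerator α a)

-- With `r = b₀₀ / b₁₁`, the section contributes `χ_{s+1/2}(r)` and the dilation `λ(r)⁻¹ |r|_E⁻¹`.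
-- As `χ_{s+1/2}(r) = χ_{s-1/2}(r) |r|_E`, only `η_{t+1/2}(r)⁻¹` survives.
include hα in
lemma IsSqrtGenerator.invFunctional_dualSection_mul (hχ : χ ^ 2 = 1) {c e : F} (hc : c ≠ 0)
    (he : e ≠ 0) {s t : ℂ} (f : principalSeries χ ϖE s) (g : PGL(2, F)) (b : GL (Fin 2) F)
    (hb : b 1 0 = 0) :
    invFunctional χ η ϖE ϖF α c e s t (dualSection F (f : PGL(2, E) → ℂ) (g * .mk b)) =
      (quasiChar η ϖF (t + 1 / 2) (b 0 0 / b 1 1))⁻¹ *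
        invFunctional χ η ϖE ϖF α c e s t (dualSection F (f : PGL(2, E) → ℂ) g) := by
  have hdet := GL_det_ne_zero b
  rw [Matrix.det_fin_two, hb, mul_zero, sub_zero] at hdet
  have h0 : b 0 0 ≠ 0 := left_ne_zero_of_mul hdet
  have h1 : b 1 1 ≠ 0 := right_ne_zero_of_mul hdet
  have hr := div_ne_zero h0 h1
  have hr' : algebraMap F E (b 0 0 / b 1 1) ≠ 0 := by
    rw [Ne, map_eq_zero]
    exact hr
  rw [dualSection_mul f g hb h0 h1, invFunctional_smul,
    hα.invFunctional_dilate c e s t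
      (fun z => dualSection F (f : PGL(2, E) → ℂ) g (z + algebraMap F E (b 0 1 / b 1 1))) hr,
    hα.invFunctional_translate hc he s t (isSectionAt_dualSection hχ f g), mixedChar]
  have h2 := quasiChar_add_exponent χ ϖE (s - 1 / 2) 1 hr'
  rw [Complex.cpow_one, show s - 1 / 2 + 1 = s + 1 / 2 by ring] at h2
  have h3 := quasiChar_ne_zero χ ϖE (s - 1 / 2) hr'
  have h4 := quasiChar_ne_zero η ϖF (t + 1 / 2) hr
  have h5 : ((absV (algebraMap F E (b 0 0 / b 1 1)) : ℝ) : ℂ) ≠ 0 := by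
    exact_mod_cast (absV_pos hr').ne'
  rw [h2]
  generalize quasiChar χ ϖE (s - 1 / 2) _ = X at h3 ⊢
  generalize quasiChar η ϖF (t + 1 / 2) _ = Y at h4 ⊢
  field_simp

/-- The symmetry breaking operator given by the invariant functional. -/
def IsSqrtGenerator.operator (hχ : χ ^ 2 = 1) {c e : F} {N : ℂ}
    (hn : IsNormalizing χ η ϖE ϖF c e N) (s t : ℂ) : SymmetryBreakingOperator χ η ϖE ϖF s t where
  toFun f := ⟨fun g => N *
      invFunctional χ η ϖE ϖF α c e s t (dualSection F (f : PGL(2, E) → ℂ) g), by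
    constructor
    · rw [IsLocallyConstant.iff_eventually_eq]
      intro g
      filter_upwards [eventually_dualSection_eq hχ f g] with x hx
      rw [hx]
    · intro g b hb
      beta_reduce
      rw [hα.invFunctional_dualSection_mul hχ hn.left_ne_zero hn.right_ne_zero f g b hb]
      ring⟩
  map_add' f f' := by
    refine Subtype.ext (funext fun g => ?_)
    change N * invFunctional χ η ϖE ϖF α c e s t (dualSection F (f : PGL(2, E) → ℂ) g +
      dualSection F (f' : PGL(2, E) → ℂ) g) = _
    rw [hα.invFunctional_add hn.left_ne_zero hn.right_ne_zero s t (isSectionAt_dualSection hχ f g)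
      (isSectionAt_dualSection hχ f' g), mul_add]
    rfl
  map_smul' w f := by
    refine Subtype.ext (funext fun g => ?_)
    change N * invFunctional χ η ϖE ϖF α c e s t (w • dualSection F (f : PGL(2, E) → ℂ) g) =
      w * (N * _)
    rw [invFunctional_smul]
    ring
  isIntertwining' g := by
    refine LinearMap.ext fun f => Subtype.ext (funext fun x => ?_)
    change N * invFunctional χ η ϖE ϖF α c e s t (dualSection F (((principalSeriesRep χ ϖE s).comp
      (Matrix.ProjGenLinGroup.map (algebraMap F E)) g f : principalSeries χ ϖE s) :
        PGL(2, E) → ℂ) x) = N * invFunctional χ η ϖE ϖF α c e s t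
          (dualSection F (f : PGL(2, E) → ℂ) (g⁻¹ * x))
    rw [dualSection_rep]

lemma IsSqrtGenerator.operator_apply (hχ : χ ^ 2 = 1) {c e : F} {N : ℂ}
    (hn : IsNormalizing χ η ϖE ϖF c e N) (s t : ℂ) (f : principalSeries χ ϖE s)
    (g : PGL(2, F)) : (hα.operator hχ hn s t f : PGL(2, F) → ℂ) g =
      N * invFunctional χ η ϖE ϖF α c e s t (dualSection F (f : PGL(2, E) → ℂ) g) := rfl

lemma IsSqrtGenerator.hasKernel_operator (hχ : χ ^ 2 = 1) {c e : F} {N : ℂ}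
    (hn : IsNormalizing χ η ϖE ϖF c e N) (s t : ℂ) :
    HasKernel (hα.operator hχ hn s t) (hα.distribution hn s t) := by
  intro f y u hu
  rw [hα.operator_apply, dualSection_lowerUnip hχ f y u hu]
  rfl

/-! ### Uniqueness of the operator with a given kernel -/

lemma symmetryBreaking_apply {s t : ℂ} (A : SymmetryBreakingOperator χ η ϖE ϖF s t)
    (f : principalSeries χ ϖE s) (g x : PGL(2, F)) :
    (A f : PGL(2, F) → ℂ) (g⁻¹ * x) = (A ((principalSeriesRep χ ϖE s).comp
      (Matrix.ProjGenLinGroup.map (algebraMap F E)) g f) : PGL(2, F) → ℂ) x := by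
  rw [Representation.IntertwiningMap.isIntertwining]
  rfl

omit [MeasurableSpace E] [BorelSpace E] in
lemma isTestFunction_of_forall_lt {s : ℂ} (f : principalSeries χ ϖE s)
    (hf : ∀ x : E, 1 < absV x → (f : PGL(2, E) → ℂ) (.mk (lowerUnip x)) = 0) :
    (fun x : E => (f : PGL(2, E) → ℂ) (.mk (lowerUnip x))) ∈ TestFunction E :=
  ⟨isLocallyConstant_principalSeries_comp f continuous_lowerUnip, hasCompactSupport_of_absV 1 hf⟩

lemma HasKernel.apply_one_eq {s t : ℂ} {A B : SymmetryBreakingOperator χ η ϖE ϖF s t}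
    {D : Distribution E} (hA : HasKernel A D) (hB : HasKernel B D) (f : principalSeries χ ϖE s)
    (hf : ∀ x : E, 1 < absV x → (f : PGL(2, E) → ℂ) (.mk (lowerUnip x)) = 0) :
    (A f : PGL(2, F) → ℂ) 1 = (B f : PGL(2, F) → ℂ) 1 := by
  have hu : ∀ x : E, ((⟨_, isTestFunction_of_forall_lt f hf⟩ : TestFunction E) : E → ℂ) x =
      (f : PGL(2, E) → ℂ) (.mk (lowerUnip (x + algebraMap F E 0))) := by
    intro x
    rw [map_zero, add_zero]
  have h1 := hA f 0 _ hu
  have h2 := hB f 0 _ hu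
  rw [lowerUnip_zero, map_one] at h1 h2
  rw [h1, h2]

/-- By equivariance only values at `1` matter. The part of `f` on `lowerCell` is a test function in
the `lowerUnip` chart. The rest becomes one after translation by an element of `PGL(2, F)`, chosen
unipotent upper triangular so that the value at `1` of the image is unchanged. -/
lemma HasKernel.unique {s t : ℂ} {A B : SymmetryBreakingOperator χ η ϖE ϖF s t}
    {D : Distribution E} (hA : HasKernel A D) (hB : HasKernel B D) : A = B := by
  have key : ∀ f, (A f : PGL(2, F) → ℂ) 1 = (B f : PGL(2, F) → ℂ) 1 := by
    intro f
    let f₁ := restrictLowerCell f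
    let f₂ := f - f₁
    let w : GL (Fin 2) F := upperMat 1 (-1) 1 (by simp)
    let f₃ := (principalSeriesRep χ ϖE s).comp (Matrix.ProjGenLinGroup.map (algebraMap F E))
      (.mk w)⁻¹ f₂
    have hf : f = f₁ + f₂ := (add_sub_cancel _ _).symm
    have h1 : (A f₁ : PGL(2, F) → ℂ) 1 = (B f₁ : PGL(2, F) → ℂ) 1 := by
      refine hA.apply_one_eq hB f₁ fun x hx => restrictLowerCell_of_notMem f fun h => ?_
      rw [mk_mem_lowerCell, coe_lowerUnip] at h
      simp [absV_one] at h
      exact absurd hx (not_lt.2 h)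
    have h3 : (A f₃ : PGL(2, F) → ℂ) 1 = (B f₃ : PGL(2, F) → ℂ) 1 := by
      refine hA.apply_one_eq hB f₃ fun x hx => ?_
      let W : GL (Fin 2) E := Matrix.GeneralLinearGroup.map (algebraMap F E) w
      have hW : (W : Matrix (Fin 2) (Fin 2) E) = !![1, -1; 0, 1] := by
        ext i j
        change algebraMap F E (w i j) = _
        rw [coe_upperMat]
        fin_cases i <;> fin_cases j <;> simp
      have h4 : (f₃ : PGL(2, E) → ℂ) (.mk (lowerUnip x)) =
          (f₂ : PGL(2, E) → ℂ) (.mk (W * lowerUnip x)) := by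
        change (f₂ : PGL(2, E) → ℂ) ((Matrix.ProjGenLinGroup.map (algebraMap F E) (.mk w)⁻¹)⁻¹ *
          .mk (lowerUnip x)) = _
        rw [map_inv, inv_inv, Matrix.ProjGenLinGroup.map_mk, map_mul]
      have h5 : .mk (W * lowerUnip x) ∈ lowerCell E := by
        rw [mk_mem_lowerCell, Units.val_mul, hW, coe_lowerUnip]
        -- For `|x| > 1` the first column `(1 - x, x)` of `W * lowerUnip x` has entries of equal
        -- absolute value, so the point lies in `lowerCell`, where `f₂` vanishes.
        have h6 : absV (1 + -x) = absV x := by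
          rw [add_comm, ← absV_neg x]
          exact absV_add_eq_left (by rwa [absV_one, absV_neg])
        simp [Matrix.mul_apply, h6]
      rw [h4]
      change (f : PGL(2, E) → ℂ) _ - (f₁ : PGL(2, E) → ℂ) _ = 0
      rw [restrictLowerCell_of_mem f h5, sub_self]
    have h2 : ∀ C : SymmetryBreakingOperator χ η ϖE ϖF s t,
        (C f₃ : PGL(2, F) → ℂ) 1 = (C f₂ : PGL(2, F) → ℂ) 1 := by
      intro C
      rw [← symmetryBreaking_apply C f₂, inv_inv, mul_one]
      have h := (C f₂).2.2 1 w rfl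
      have hw : w 0 0 / w 1 1 = 1 := div_one 1
      rwa [one_mul, hw, quasiChar_one, inv_one, one_mul] at h
    rw [h2, h2] at h3
    rw [hf, map_add, map_add]
    exact congrArg₂ (· + ·) h1 h3
  refine Representation.IntertwiningMap.ext
    (LinearMap.ext fun f => Subtype.ext (funext fun x => ?_))
  have h := key ((principalSeriesRep χ ϖE s).comp
    (Matrix.ProjGenLinGroup.map (algebraMap F E)) x⁻¹ f)
  rw [← symmetryBreaking_apply, ← symmetryBreaking_apply, inv_inv, mul_one] at h
  exact h

include hα in
lemma IsSqrtGenerator.existsUnique_hasKernel (hχ : χ ^ 2 = 1)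
    (hϖ : quasiChar χ ϖE 0 (algebraMap F E ϖF) = 1) (s t : ℂ) :
    ∃! A : SymmetryBreakingOperator χ η ϖE ϖF s t,
      HasKernel A (renormalizedKernel χ η ϖE ϖF α a s t) := by
  obtain ⟨c, e, N, hn⟩ := hα.exists_isNormalizing (η := η) hχ hϖ
  rw [hα.renormalizedKernel_eq hχ hn]
  exact ⟨_, hα.hasKernel_operator hχ hn s t, fun B hB =>
    hB.unique (hα.hasKernel_operator hχ hn s t)⟩

lemma IsSqrtGenerator.renormalizedOperator_eq (hχ : χ ^ 2 = 1) {c e : F} {N : ℂ}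
    (hn : IsNormalizing χ η ϖE ϖF c e N) (s t : ℂ) :
    renormalizedOperator χ η ϖE ϖF α a s t = hα.operator hχ hn s t := by
  have h : ∃ A : SymmetryBreakingOperator χ η ϖE ϖF s t,
      HasKernel A (renormalizedKernel χ η ϖE ϖF α a s t) := by
    rw [hα.renormalizedKernel_eq hχ hn]
    exact ⟨_, hα.hasKernel_operator hχ hn s t⟩
  have h1 : HasKernel (renormalizedOperator χ η ϖE ϖF α a s t)
    (renormalizedKernel χ η ϖE ϖF α a s t) := Classical.epsilon_spec h
  rw [hα.renormalizedKernel_eq hχ hn] at h1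
  exact h1.unique (hα.hasKernel_operator hχ hn s t)

end Extension

/-! ### The invariant functional on the spherical section -/

section LocalField

variable {K : Type*} [Field K] [ValuativeRel K] [TopologicalSpace K]
  [IsNonarchimedeanLocalField K]

lemma one_lt_absV_iff (x : K) : 1 < absV x ↔ (resCard K : ℝ) ≤ absV x := by
  by_cases hx : x = 0
  · rw [hx, absV_zero]
    exact iff_of_false (by norm_num) (not_le.2 resCard_pos)
  have h := absV_lt_one_iff_le x⁻¹
  rwa [absV_inv, inv_lt_one₀ (absV_pos hx), inv_le_inv₀ (absV_pos hx) resCard_pos] at h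

lemma resCard_lt_absV_iff (ϖ : Uniformizer K) (x : K) :
    (resCard K : ℝ) < absV x ↔ (resCard K : ℝ) ^ 2 ≤ absV x := by
  have hq : (0 : ℝ) < resCard K := resCard_pos
  have h := one_lt_absV_iff ((ϖ : K) * x)
  rw [absV_mul, ϖ.absV_eq, inv_mul_eq_div, lt_div_iff₀ hq, le_div_iff₀ hq, one_mul] at h
  rw [h, pow_two]

/-- The restriction to the dual big cell of the spherical vector. -/
def sphericalSection (s : ℂ) (z : K) : ℂ := ((max (absV z) 1 : ℝ) : ℂ) ^ (-(2 * s + 1))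

/-- In this form the two terms visibly cancel for `|z| ≥ max(1, |c|⁻¹)`. -/
lemma dilationDiff_sphericalSection {c : K} (hc : c ≠ 0) (s : ℂ) (z : K) :
    dilationDiff c s (sphericalSection s) z = ((max (absV z) 1 : ℝ) : ℂ) ^ (-(2 * s + 1)) -
      ((max (absV z) (absV c)⁻¹ : ℝ) : ℂ) ^ (-(2 * s + 1)) := by
  have hpos := absV_pos hc
  have h : max (absV (c * z)) 1 = absV c * max (absV z) (absV c)⁻¹ := by
    rw [mul_max_of_nonneg _ _ hpos.le, absV_mul, mul_inv_cancel₀ hpos.ne']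
  rw [dilationDiff, sphericalSection, sphericalSection, h, Complex.ofReal_mul,
    Complex.mul_cpow_ofReal_nonneg hpos.le (le_max_of_le_left (absV_nonneg z)),
    Complex.cpow_neg (absV c : ℂ), mul_inv_cancel_left₀ (cpow_absV_ne_zero hc _)]

end LocalField

section Extension

variable {F E : Type*}
  [Field F] [ValuativeRel F] [TopologicalSpace F] [IsNonarchimedeanLocalField F]
  [Field E] [ValuativeRel E] [TopologicalSpace E] [IsNonarchimedeanLocalField E]
  [Algebra F E] [ValuativeExtension F E]
  {χ : PontryaginDual 𝒪[E]ˣ} {η : PontryaginDual 𝒪[F]ˣ}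
  {ϖE : Uniformizer E} {ϖF : Uniformizer F} {α : E} {a : F} (hα : IsSqrtGenerator α a)

/-- The lattice of all `x₁ + x₂ α` with `|x₁| ≤ 1` and `|x₂| ≤ |d|`. -/
def lattice (α : E) (d : F) : Set E :=
  {z | absV (rePart F α z) ≤ 1 ∧ absV (imPart F α z) ≤ absV d}

/-- The characteristic function of a lattice. -/
def latticeInd (α : E) (d : F) : E → ℂ := (lattice α d).indicator fun _ => 1

lemma latticeInd_of_mem {d : F} {z : E} (hz : z ∈ lattice α d) : latticeInd α d z = 1 :=
  Set.indicator_of_mem hz _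

lemma latticeInd_of_notMem {d : F} {z : E} (hz : z ∉ lattice α d) : latticeInd α d z = 0 :=
  Set.indicator_of_notMem hz _

/-- On units `λ` is the square of the restriction of `χ`, hence trivial. -/
lemma mixedChar_eq_of_absV_eq (hχ : χ ^ 2 = 1) (hη : (η : 𝒪[F]ˣ →* Circle) = resChar F χ) (s t : ℂ)
    {x y : F} (hy : y ≠ 0) (h : absV x = absV y) :
    mixedChar χ η ϖE ϖF s t x = mixedChar χ η ϖE ϖF s t y := by
  have hv : valuation F (x / y) = 1 := by
    have h1 : absV (x / y) = absV (1 : F) := by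
      rw [absV_div, h, div_self (absV_pos hy).ne', absV_one]
    rw [absV_eq_iff.1 h1, map_one]
  have h2 : mixedChar χ η ϖE ϖF s t (x / y) = 1 := by
    rw [← unitOf_val hv, mixedChar_unit]
    have h3 : η (unitOf (x / y)) = resChar F χ (unitOf (x / y)) := DFunLike.congr_fun hη _
    rw [h3, ← Circle.coe_mul]
    have h4 := DFunLike.congr_fun (resChar_sq (F := F) hχ) (unitOf (x / y))
    rw [MonoidHom.mul_apply, MonoidHom.one_apply] at h4
    rw [h4, Circle.coe_one]
  rw [← div_mul_cancel₀ x hy, mixedChar_mul, h2, one_mul]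

namespace IsSqrtGenerator

include hα

lemma isLocallyConstant_latticeInd {d : F} (hd : d ≠ 0) :
    IsLocallyConstant (latticeInd α d : E → ℂ) := by
  refine isLocallyConstant_indicator (IsLocallyConstant.const 1) ?_
  exact ((isClopen_absV_le one_pos).preimage hα.continuous_rePart).inter
    ((isClopen_absV_le (absV_pos hd)).preimage hα.continuous_imPart)

lemma hasCompactSupport_latticeInd (d : F) : HasCompactSupport (latticeInd α d : E → ℂ) := by
  obtain ⟨b, -, hb⟩ := exists_lt_absV F (max 1 (absV d))
  refine HasCompactSupport.intro (hα.isCompact_box b) fun z hz => latticeInd_of_notMem fun h => ?_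
  exact hz ⟨h.1.trans ((le_max_left _ _).trans hb.le), h.2.trans ((le_max_right _ _).trans hb.le)⟩

lemma latticeInd_eq_twist {d : F} (hd : d ≠ 0) (z : E) :
    latticeInd α d z = latticeInd α (1 : F) (twist α 1 d⁻¹ z) := by
  have h : z ∈ lattice α d ↔ twist α 1 d⁻¹ z ∈ lattice α (1 : F) := by
    change _ ∧ _ ↔ _ ∧ _
    rw [hα.rePart_twist, hα.imPart_twist, one_mul, absV_mul, absV_inv, absV_one,
      inv_mul_le_one₀ (absV_pos hd)]
  by_cases hz : z ∈ lattice α d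
  · rw [latticeInd_of_mem hz, latticeInd_of_mem (h.1 hz)]
  · rw [latticeInd_of_notMem hz, latticeInd_of_notMem (mt h.2 hz)]

variable [MeasurableSpace E] [BorelSpace E]

lemma integral_latticeInd (ϖF : Uniformizer F)
    (h : ∀ z : E, absV z ≤ 1 ↔ z ∈ lattice α (1 : F)) {d : F} (hd : d ≠ 0) :
    ∫ z, latticeInd α d z ∂haar E = ((absV d : ℝ) : ℂ) := by
  have h1 : ∫ z, latticeInd α (1 : F) z ∂haar E = 1 := by
    have hs : lattice α (1 : F) = {z : E | absV z ≤ 1} := Set.ext fun z => (h z).symm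
    rw [latticeInd, hs, integral_indicator_const _ (measurableSet_absV_le 1), Measure.real,
      haar_integers]
    simp
  simp_rw [hα.latticeInd_eq_twist hd]
  rw [hα.integral_twist_haar ϖF one_ne_zero (inv_ne_zero hd), h1, absV_one, one_mul, absV_inv,
    Complex.ofReal_inv, inv_inv, mul_one]

/-- Twisting by `ϖ⁻¹` shrinks the lattice to `|x₂| < |d|`. The difference is the indicator of the
shell `|x₂| = |d|`, on which `λ` is constant and whose volume is `|d| (1 - q⁻¹)`. -/
lemma regIntegral_latticeInd (hχ : χ ^ 2 = 1) (hη : (η : 𝒪[F]ˣ →* Circle) = resChar F χ)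
    (h : ∀ z : E, absV z ≤ 1 ↔ z ∈ lattice α (1 : F)) (s t : ℂ) {d : F} (hd : d ≠ 0) :
    regIntegral χ η ϖE ϖF α (ϖF : F)⁻¹ s t (latticeInd α d) =
      mixedChar χ η ϖE ϖF s t d * ((absV d : ℝ) : ℂ) * (1 - (resCard F : ℂ)⁻¹) := by
  have hϖ := inv_ne_zero ϖF.ne_zero
  have hint : Integrable (latticeInd α d : E → ℂ) (haar E) :=
    (hα.isLocallyConstant_latticeInd hd).continuous.integrable_of_hasCompactSupport
      (hα.hasCompactSupport_latticeInd d)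
  have heq : regIntegrand χ η ϖE ϖF α (ϖF : F)⁻¹ s t (latticeInd α d) = fun z =>
      mixedChar χ η ϖE ϖF s t d * (latticeInd α d z - latticeInd α d (twist α 1 (ϖF : F)⁻¹ z)) := by
    funext z
    rw [regIntegrand, twistDiff]
    have hmem : twist α 1 (ϖF : F)⁻¹ z ∈ lattice α d ↔
        absV (rePart F α z) ≤ 1 ∧ absV (imPart F α z) < absV d := by
      change _ ∧ _ ↔ _ ∧ _
      have h1 := absV_lt_one_iff_le (imPart F α z / d)
      rw [absV_div, div_lt_one (absV_pos hd), div_le_iff₀ (absV_pos hd)] at h1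
      rw [hα.rePart_twist, hα.imPart_twist, one_mul, absV_mul, absV_inv, ϖF.absV_eq, inv_inv, h1,
        ← div_eq_inv_mul, le_div_iff₀' resCard_pos]
    by_cases hz : z ∈ lattice α d
    · by_cases hz2 : absV (imPart F α z) < absV d
      · rw [latticeInd_of_mem hz, latticeInd_of_mem (hmem.2 ⟨hz.1, hz2⟩), sub_self, mul_zero,
          mul_zero]
      · have h2 : absV (-imPart F α z) = absV d := by
          rw [absV_neg]
          exact le_antisymm hz.2 (not_lt.1 hz2)
        rw [mixedChar_eq_of_absV_eq hχ hη s t hd h2]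
    · have hz2 : twist α 1 (ϖF : F)⁻¹ z ∉ lattice α d := fun h3 =>
        hz ⟨(hmem.1 h3).1, (hmem.1 h3).2.le⟩
      rw [latticeInd_of_notMem hz, latticeInd_of_notMem hz2, sub_self, mul_zero, mul_zero]
  rw [regIntegral, heq, integral_const_mul, integral_sub hint
    (hα.integrable_comp_twist ϖF one_ne_zero hϖ hint),
    hα.integral_twist_haar ϖF one_ne_zero hϖ, hα.integral_latticeInd ϖF h hd, absV_one, one_mul,
    absV_inv, ϖF.absV_eq, inv_inv, Complex.ofReal_natCast]
  ring

/-- Here `|ϖ_F|_E⁻¹ = q_E` is the first absolute value above `1`, so the dilation difference is a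
multiple of the indicator of the integers, which form a lattice in the coordinates. -/
lemma invFunctional_spherical_unramified (hχ : χ ^ 2 = 1)
    (hη : (η : 𝒪[F]ˣ →* Circle) = resChar F χ) (hq : resCard E = resCard F ^ 2)
    (hodd : Odd (resCard F)) (ha : absV a = 1) (s t : ℂ) :
    invFunctional χ η ϖE ϖF α (ϖF : F) (ϖF : F)⁻¹ s t (sphericalSection s) =
      (1 - (resCard F : ℂ)⁻¹) * (1 - (resCard E : ℂ) ^ (-(2 * s + 1))) := by
  have hO : ∀ z : E, absV z ≤ 1 ↔ z ∈ lattice α (1 : F) := by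
    intro z
    rw [hα.absV_eq_of_unramified hodd ha ϖE ϖF, sq_le_one_iff₀ (le_max_of_le_left (absV_nonneg _)),
      max_le_iff]
    change _ ↔ _ ∧ _
    rw [absV_one]
  have hc : algebraMap F E ϖF ≠ 0 := by simpa using ϖF.ne_zero
  have hcabs : (absV (algebraMap F E ϖF))⁻¹ = resCard E := by
    rw [hα.absV_algebraMap ϖE ϖF, ϖF.absV_eq, inv_pow, inv_inv, hq, Nat.cast_pow]
  have hD : dilationDiff (algebraMap F E ϖF) s (sphericalSection s) =
      (1 - (resCard E : ℂ) ^ (-(2 * s + 1))) • latticeInd α (1 : F) := by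
    funext z
    rw [dilationDiff_sphericalSection hc, hcabs, Pi.smul_apply, smul_eq_mul]
    rcases le_or_gt (absV z) 1 with hz | hz
    · rw [latticeInd_of_mem ((hO z).1 hz), max_eq_right hz,
        max_eq_right (hz.trans one_lt_resCard_real.le)]
      simp
    · rw [latticeInd_of_notMem (fun h => not_lt.2 ((hO z).2 h) hz), max_eq_left hz.le,
        max_eq_left ((one_lt_absV_iff z).1 hz)]
      simp
  rw [invFunctional, hD, regIntegral_smul, hα.regIntegral_latticeInd hχ hη hO s t one_ne_zero,
    mixedChar_one, absV_one]
  simp only [Complex.ofReal_one, one_mul]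
  ring

/-- Now `|ϖ_F|_E⁻¹ = q_E²`, and the intermediate absolute value `q_E` contributes a second ball. In
coordinates it is the lattice with `d = ϖ_F⁻¹`: the radius grows only in the `α` direction. -/
lemma invFunctional_spherical_ramified (hχ : χ ^ 2 = 1)
    (hϖ : quasiChar χ ϖE 0 (algebraMap F E ϖF) = 1)
    (hη : (η : 𝒪[F]ˣ →* Circle) = resChar F χ) (hq : resCard E = resCard F)
    (ha : absV a = (resCard F : ℝ)⁻¹) (s t : ℂ) :
    invFunctional χ η ϖE ϖF α (ϖF : F) (ϖF : F)⁻¹ s t (sphericalSection s) =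
      (1 - (resCard F : ℂ)⁻¹) * ((1 - (resCard E : ℂ) ^ (-(2 * s + 1))) *
        (1 + (resCard F : ℂ) ^ (t - 1 / 2))) := by
  have hq1 : (1 : ℝ) < resCard F := one_lt_resCard_real
  have hq0 : (0 : ℝ) < resCard F := resCard_pos
  -- The next absolute value above `1` is `q`, whose square exceeds `q`.
  have hle : ∀ x : F, absV x ^ 2 ≤ resCard F ↔ absV x ≤ 1 := by
    intro x
    constructor
    · intro h
      by_contra! h1
      have h2 := (one_lt_absV_iff x).1 h1
      nlinarith
    · intro h
      exact (pow_le_one₀ (absV_nonneg x) h).trans hq1.le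
  have habs := hα.absV_eq_of_ramified ha ϖE ϖF
  have hϖ0 := inv_ne_zero ϖF.ne_zero
  have hO : ∀ z : E, absV z ≤ 1 ↔ z ∈ lattice α (1 : F) := by
    intro z
    change _ ↔ _ ∧ _
    rw [habs, max_le_iff, sq_le_one_iff₀ (absV_nonneg _), ← div_eq_mul_inv, div_le_one hq0, hle,
      absV_one]
  have hO' : ∀ z : E, absV z ≤ resCard E ↔ z ∈ lattice α (ϖF : F)⁻¹ := by
    intro z
    change _ ↔ _ ∧ _
    rw [hq, habs, max_le_iff, hle, ← div_eq_mul_inv, div_le_iff₀ hq0, ← pow_two,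
      pow_le_pow_iff_left₀ (absV_nonneg _) hq0.le two_ne_zero, absV_inv, ϖF.absV_eq, inv_inv]
  have hc : algebraMap F E ϖF ≠ 0 := by simpa using ϖF.ne_zero
  have hcabs : (absV (algebraMap F E ϖF))⁻¹ = (resCard E : ℝ) ^ 2 := by
    rw [hα.absV_algebraMap ϖE ϖF, ϖF.absV_eq, inv_pow, inv_inv, hq]
  have hqE : (1 : ℝ) < resCard E := one_lt_resCard_real
  let X : ℂ := (resCard E : ℂ) ^ (-(2 * s + 1))
  have hX2 : ((((resCard E : ℝ) ^ 2 : ℝ) : ℂ)) ^ (-(2 * s + 1)) = X * X := by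
    rw [pow_two, Complex.ofReal_mul, Complex.mul_cpow_ofReal_nonneg (by positivity) (by positivity),
      Complex.ofReal_natCast]
  have hD : dilationDiff (algebraMap F E ϖF) s (sphericalSection s) =
      (1 - X) • latticeInd α (1 : F) + ((1 - X) * X) • latticeInd α (ϖF : F)⁻¹ := by
    funext z
    rw [dilationDiff_sphericalSection hc, hcabs, Pi.add_apply, Pi.smul_apply, Pi.smul_apply,
      smul_eq_mul, smul_eq_mul]
    rcases le_or_gt (absV z) 1 with hz | hz
    · have hz' := hz.trans hqE.le
      rw [latticeInd_of_mem ((hO z).1 hz), latticeInd_of_mem ((hO' z).1 hz'), max_eq_right hz,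
        max_eq_right (hz'.trans (le_self_pow₀ hqE.le two_ne_zero)), hX2, Complex.ofReal_one,
        Complex.one_cpow]
      ring
    · rw [latticeInd_of_notMem (fun h => not_lt.2 ((hO z).2 h) hz), max_eq_left hz.le]
      rcases le_or_gt (absV z) (resCard E) with hz2 | hz2
      · have hz3 := le_antisymm hz2 ((one_lt_absV_iff z).1 hz)
        rw [latticeInd_of_mem ((hO' z).1 hz2), hz3,
          max_eq_right (le_self_pow₀ hqE.le two_ne_zero), hX2, Complex.ofReal_natCast]
        ring
      · rw [latticeInd_of_notMem (fun h => not_lt.2 ((hO' z).2 h) hz2),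
          max_eq_left ((resCard_lt_absV_iff ϖE z).1 hz2)]
        ring
  have hsm : ∀ (w : ℂ) {d : F}, d ≠ 0 → IsLocallyConstant (w • latticeInd α d : E → ℂ) ∧
      HasCompactSupport (w • latticeInd α d : E → ℂ) := fun w d hd =>
    ⟨(hα.isLocallyConstant_latticeInd hd).comp fun z => w • z,
      (hα.hasCompactSupport_latticeInd d).smul_left (f := fun _ => w)⟩
  have hqF := resCard_ne_zero F
  -- The weight of the larger ball times `λ(ϖ_F⁻¹) |ϖ_F⁻¹|`, relative to the smaller one; the
  -- dependence on `s` cancels.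
  have hpow : X * (((resCard F : ℂ) ^ (-(2 * s + t - 1 / 2)))⁻¹ * (resCard F : ℂ)) =
      (resCard F : ℂ) ^ (t - 1 / 2) := by
    simp only [X]
    have h1 := Complex.cpow_add (- -(2 * s + t - 1 / 2)) 1 hqF
    rw [Complex.cpow_one] at h1
    rw [hq, ← Complex.cpow_neg, ← h1, ← Complex.cpow_add _ _ hqF]
    congr 1
    ring
  rw [invFunctional, hD, hα.regIntegral_add hϖ0 s t (hsm _ one_ne_zero).1 (hsm _ one_ne_zero).2
      (hsm _ hϖ0).1 (hsm _ hϖ0).2, regIntegral_smul, regIntegral_smul,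
    hα.regIntegral_latticeInd hχ hη hO s t one_ne_zero, hα.regIntegral_latticeInd hχ hη hO s t hϖ0,
    mixedChar_one, mixedChar_inv, hα.mixedChar_uniformizer hϖ, absV_one, absV_inv, ϖF.absV_eq,
    inv_inv, ← hpow, Complex.ofReal_one, Complex.ofReal_natCast]
  ring

end IsSqrtGenerator

end Extension

/-! ### The action on the `K`-type vector -/

section LocalField

variable {K : Type*} [Field K] [ValuativeRel K] [TopologicalSpace K]
  [IsNonarchimedeanLocalField K]

/-- The vector `(z, x z + y)` is the image of `(z, 1)` under an integral matrix of unit determinant,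
which preserves the maximum norm. -/
lemma max_absV_mul_add {x y z : K} (hx : absV x ≤ 1) (hy : absV y = 1) :
    max (absV z) (absV (x * z + y)) = max (absV z) 1 := by
  have h1 : absV (x * z) ≤ absV z := by
    rw [absV_mul]
    exact mul_le_of_le_one_left (absV_nonneg z) hx
  refine le_antisymm (max_le (le_max_left _ _) ?_) (max_le (le_max_left _ _) ?_)
  · exact (absV_add_le _ _).trans (max_le_max h1 hy.le)
  · have h2 := absV_sub_le (x * z + y) (x * z)
    rw [add_sub_cancel_left, hy] at h2
    exact h2.trans (max_le (le_max_right _ _) (h1.trans (le_max_left _ _)))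

/-- The Iwasawa decomposition. -/
lemma exists_iwasawa (g : GL (Fin 2) K) : ∃ (x : K) (k b : GL (Fin 2) K), absV x ≤ 1 ∧
    (k = lowerUnip x ∨ k = dualMat x) ∧ b 1 0 = 0 ∧ g = k * b := by
  have hcol := GL_column_ne_zero g
  rcases le_or_gt (absV (g 1 0)) (absV (g 0 0)) with h | h
  · have h0 : g 0 0 ≠ 0 := by
      intro h0
      rw [h0, absV_zero] at h
      exact hcol (Prod.ext h0 (absV_eq_zero.1 (le_antisymm h (absV_nonneg _))))
    refine ⟨g 1 0 / g 0 0, _, (lowerUnip (g 1 0 / g 0 0))⁻¹ * g, ?_, Or.inl rfl, ?_,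
      (mul_inv_cancel_left _ _).symm⟩
    · rw [absV_div]
      exact div_le_one_of_le₀ h (absV_nonneg _)
    · have hinv : (lowerUnip (g 1 0 / g 0 0))⁻¹ = lowerUnip (-(g 1 0 / g 0 0)) :=
        inv_eq_of_mul_eq_one_left (by rw [lowerUnip_mul, add_neg_cancel, lowerUnip_zero])
      rw [hinv, Units.val_mul, coe_lowerUnip]
      simp [Matrix.mul_apply, h0]
  · have h1 : g 1 0 ≠ 0 := by
      intro h1
      rw [h1, absV_zero] at h
      exact not_lt.2 (absV_nonneg _) h
    refine ⟨g 0 0 / g 1 0, _, (dualMat (g 0 0 / g 1 0))⁻¹ * g, ?_, Or.inr rfl, ?_,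
      (mul_inv_cancel_left _ _).symm⟩
    · rw [absV_div]
      exact div_le_one_of_le₀ h.le (absV_nonneg _)
    · rw [Units.val_mul]
      change (!![0, 1; -1, g 0 0 / g 1 0] * (g : Matrix (Fin 2) (Fin 2) K)) 1 0 = 0
      simp [Matrix.mul_apply, h1]

lemma typeVectorFun_lowerUnip (χ : PontryaginDual 𝒪[K]ˣ) (ϖ : Uniformizer K) (s : ℂ) {x : K}
    (hx : absV x ≤ 1) : typeVectorFun χ ϖ s (lowerUnip x) = 1 := by
  rw [typeVectorFun, coe_lowerUnip]
  simp [quasiChar_one, absV_one, hx]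

lemma typeVectorFun_dualMat (χ : PontryaginDual 𝒪[K]ˣ) (ϖ : Uniformizer K) (s : ℂ) (x : K) :
    typeVectorFun χ ϖ s (dualMat x) = sphericalSection s x := by
  rw [typeVectorFun, coe_dualMat, sphericalSection]
  simp [quasiChar_one, absV_one]

end LocalField

section Extension

variable {F E : Type*}
  [Field F] [ValuativeRel F] [TopologicalSpace F] [IsNonarchimedeanLocalField F]
  [Field E] [ValuativeRel E] [TopologicalSpace E] [IsNonarchimedeanLocalField E]
  [Algebra F E] [ValuativeExtension F E]
  {χ : PontryaginDual 𝒪[E]ˣ} {η : PontryaginDual 𝒪[F]ˣ}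
  {ϖE : Uniformizer E} {ϖF : Uniformizer F} {α : E} {a : F} (hα : IsSqrtGenerator α a)

lemma dualSection_typeVector (hχ : χ ^ 2 = 1) (s : ℂ) (k : GL (Fin 2) F) (z : E) :
    dualSection F (typeVector χ hχ ϖE s : PGL(2, E) → ℂ) (.mk k) z =
      quasiChar χ ϖE (s + 1 / 2) (algebraMap F E (Matrix.det (k : Matrix (Fin 2) (Fin 2) F))) *
        ((max (absV (algebraMap F E (k 0 0) * z + algebraMap F E (k 0 1)))
          (absV (algebraMap F E (k 1 0) * z + algebraMap F E (k 1 1))) : ℝ) : ℂ) ^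
            (-(2 * s + 1)) := by
  let k' : GL (Fin 2) E := Matrix.GeneralLinearGroup.map (algebraMap F E) k
  have hk' : ∀ i j, k' i j = algebraMap F E (k i j) := fun i j => rfl
  have hdet : Matrix.det ((k' * dualMat z : GL (Fin 2) E) : Matrix (Fin 2) (Fin 2) E) =
      algebraMap F E (Matrix.det (k : Matrix (Fin 2) (Fin 2) F)) := by
    rw [Units.val_mul, Matrix.det_mul, coe_dualMat, Matrix.det_fin_two_of, Matrix.det_fin_two,
      Matrix.det_fin_two, hk', hk', hk', hk']
    simp
  have hcol : ∀ i, (k' * dualMat z) i 0 = algebraMap F E (k i 0) * z + algebraMap F E (k i 1) := by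
    intro i
    rw [Units.val_mul, coe_dualMat]
    simp [Matrix.mul_apply, Fin.sum_univ_two, hk']
  rw [dualSection, Matrix.ProjGenLinGroup.map_mk, ← map_mul, typeVector_mk, typeVectorFun, hdet,
    hcol, hcol]

lemma dualSection_typeVector_of_iwasawa (hχ : χ ^ 2 = 1) (s : ℂ) {x : F} (hx : absV x ≤ 1)
    {k : GL (Fin 2) F} (hk : k = lowerUnip x ∨ k = dualMat x) :
    dualSection F (typeVector χ hχ ϖE s : PGL(2, E) → ℂ) (.mk k) = sphericalSection s := by
  funext z
  have hx' : absV (algebraMap F E x) ≤ 1 := absV_algebraMap_le_one_iff.2 hx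
  rw [dualSection_typeVector, sphericalSection]
  rcases hk with rfl | rfl
  · rw [coe_lowerUnip, ← max_absV_mul_add hx' (absV_one (K := E))]
    simp [quasiChar_one]
  · rw [coe_dualMat, ← max_absV_mul_add hx' (y := (-1 : E)) (by rw [absV_neg, absV_one]), max_comm]
    simp [quasiChar_one]

variable [MeasurableSpace E] [BorelSpace E]

lemma IsSqrtGenerator.operator_typeVector_mul (hχ : χ ^ 2 = 1) {c e : F} {N : ℂ}
    (hn : IsNormalizing χ η ϖE ϖF c e N) (s t : ℂ) {x : F} (hx : absV x ≤ 1)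
    {k b : GL (Fin 2) F} (hk : k = lowerUnip x ∨ k = dualMat x) (hb : b 1 0 = 0) :
    (hα.operator hχ hn s t (typeVector χ hχ ϖE s) : PGL(2, F) → ℂ) (.mk (k * b)) =
      (quasiChar η ϖF (t + 1 / 2) (b 0 0 / b 1 1))⁻¹ *
        (N * invFunctional χ η ϖE ϖF α c e s t (sphericalSection s)) := by
  rw [map_mul, (hα.operator hχ hn s t (typeVector χ hχ ϖE s)).2.2 _ b hb, hα.operator_apply,
    dualSection_typeVector_of_iwasawa hχ s hx hk]

/-- At `diag(u, 1)`, equivariance of the image gives the factor `η(u)⁻¹`, whereas invariance of the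
spherical section gives `χ(u) = χ(u)⁻¹`. If these differ, the number determining the image must be
`0`. -/
lemma IsSqrtGenerator.operator_typeVector_eq_zero (hχ : χ ^ 2 = 1) {c e : F} {N : ℂ}
    (hn : IsNormalizing χ η ϖE ϖF c e N) (s t : ℂ)
    (hη : (η : 𝒪[F]ˣ →* Circle) ≠ resChar F χ) :
    hα.operator hχ hn s t (typeVector χ hχ ϖE s) = 0 := by
  obtain ⟨u, hu⟩ : ∃ u, η u ≠ resChar F χ u := by
    by_contra! h
    exact hη (MonoidHom.ext h)
  have hu0 := coe_unit_ne_zero u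
  let b : GL (Fin 2) F := upperMat ((u : 𝒪[F]) : F) 0 1 (by simp)
  have h1 := hα.operator_typeVector_mul hχ hn s t (x := (0 : F))
    (by rw [absV_zero]; exact zero_le_one) (Or.inl rfl) (b := b) rfl
  have hb : b 0 0 / b 1 1 = ((u : 𝒪[F]) : F) := div_one _
  have hE : algebraMap F E ((u : 𝒪[F]) : F) =
      ((Units.map (integersMap F E).toMonoidHom u : 𝒪[E]ˣ) : 𝒪[E]) := rfl
  have h2 : dualSection F (typeVector χ hχ ϖE s : PGL(2, E) → ℂ) (.mk b) =
      (resChar F χ u : ℂ) • sphericalSection s := by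
    funext z
    have hdet : Matrix.det (b : Matrix (Fin 2) (Fin 2) F) = ((u : 𝒪[F]) : F) := by
      rw [coe_upperMat, Matrix.det_fin_two_of]
      simp
    rw [dualSection_typeVector, hdet, hE, quasiChar_unit, Pi.smul_apply, smul_eq_mul,
      sphericalSection, coe_upperMat]
    simp only [Matrix.of_apply, Matrix.cons_val', Matrix.cons_val_zero, Matrix.cons_val_one,
      Matrix.cons_val_fin_one, map_zero, map_one, add_zero, zero_mul, zero_add, absV_one, absV_mul]
    rw [hE, absV_unit, one_mul]
    rfl
  rw [lowerUnip_zero, one_mul, hb, quasiChar_unit, hα.operator_apply, h2, invFunctional_smul] at h1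
  have h3 : (resChar F χ u : ℂ) * (resChar F χ u : ℂ) = 1 := by
    rw [← Circle.coe_mul, ← MonoidHom.mul_apply, resChar_sq hχ, MonoidHom.one_apply,
      Circle.coe_one]
  have hzero : N * invFunctional χ η ϖE ϖF α c e s t (sphericalSection s) = 0 := by
    by_contra hne
    have h4 : (resChar F χ u : ℂ) = (η u : ℂ)⁻¹ := by
      refine mul_right_cancel₀ hne ?_
      rw [← h1]
      ring
    refine hu (Circle.ext ?_)
    rw [← inv_inj, ← h4]
    exact eq_inv_of_mul_eq_one_left h3
  refine Subtype.ext (funext fun g => ?_)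
  induction g using Matrix.ProjGenLinGroup.induction_on with | mk g =>
  obtain ⟨x, k, b, hx, hk, hb, rfl⟩ := exists_iwasawa g
  rw [hα.operator_typeVector_mul hχ hn s t hx hk hb, hzero, mul_zero]
  rfl

lemma IsSqrtGenerator.operator_typeVector_eq_smul (hχ : χ ^ 2 = 1) {c e : F} {N : ℂ}
    (hn : IsNormalizing χ η ϖE ϖF c e N) (s t : ℂ) (hη : η ^ 2 = 1) :
    hα.operator hχ hn s t (typeVector χ hχ ϖE s) =
      (N * invFunctional χ η ϖE ϖF α c e s t (sphericalSection s)) • typeVector η hη ϖF t := by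
  refine Subtype.ext (funext fun g => ?_)
  induction g using Matrix.ProjGenLinGroup.induction_on with | mk g =>
  obtain ⟨x, k, b, hx, hk, hb, rfl⟩ := exists_iwasawa g
  have hk1 : typeVectorFun η ϖF t k = 1 := by
    rcases hk with rfl | rfl
    · exact typeVectorFun_lowerUnip η ϖF t hx
    · rw [typeVectorFun_dualMat, sphericalSection, max_eq_right hx, Complex.ofReal_one,
        Complex.one_cpow]
  rw [hα.operator_typeVector_mul hχ hn s t hx hk hb, Submodule.coe_smul, Pi.smul_apply, smul_eq_mul,
    typeVector_mk, typeVectorFun_mul hη ϖF t k b hb, hk1]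
  ring

end Extension

end
end PGLBranching

theorem mainTheorem6
    {F E : Type*}
    [Field F] [ValuativeRel F] [TopologicalSpace F] [IsNonarchimedeanLocalField F]
    [Field E] [ValuativeRel E] [TopologicalSpace E] [IsNonarchimedeanLocalField E]
    [MeasurableSpace E] [BorelSpace E]
    [Algebra F E] [ValuativeExtension F E] (hEF : Module.finrank F E = 2)
    -- `E = F(α)` with `α² = a ∈ F`, normalized
    (α : E) (a : F) (hα : ∀ c : F, algebraMap F E c ≠ α) (ha : α ^ 2 = algebraMap F E a)
    (hnorm : (resCard E = resCard F ^ 2 ∧ absV a = 1 ∧ Odd (resCard F)) ∨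
      (resCard E = resCard F ∧ absV a = (resCard F : ℝ)⁻¹))
    (ϖE : Uniformizer E) (ϖF : Uniformizer F)
    (χ : PontryaginDual 𝒪[E]ˣ) (η : PontryaginDual 𝒪[F]ˣ)
    -- the uniformizers are chosen compatibly: `χ_0(ϖ_F) = 1`
    (hϖ : quasiChar χ ϖE 0 (algebraMap F E ϖF) = 1)
    (s t : ℂ) (hχ : χ ^ 2 = 1) :
    -- the kernel and the operator are well defined
    (∃! Kt : ℂ → ℂ → Distribution E, IsRenormalizedKernel χ η ϖE ϖF α a Kt) ∧
    (∃! A : SymmetryBreakingOperator χ η ϖE ϖF s t,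
      HasKernel A (renormalizedKernel χ η ϖE ϖF α a s t)) ∧
    -- the action on the `K`-type vector
    ((η : 𝒪[F]ˣ →* Circle) ≠ resChar F χ →
      renormalizedOperator χ η ϖE ϖF α a s t (typeVector χ hχ ϖE s) = 0) ∧
    (∀ hη : (η : 𝒪[F]ˣ →* Circle) = resChar F χ,
      (resCard E = resCard F ^ 2 →
        renormalizedOperator χ η ϖE ϖF α a s t (typeVector χ hχ ϖE s) =
          ((1 - (resCard F : ℂ)⁻¹) * (1 - (resCard E : ℂ) ^ (-(2 * s + 1)))) •
            typeVector η (sq_eq_one_of_resChar_eq hχ hη) ϖF t) ∧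
      (resCard E = resCard F →
        renormalizedOperator χ η ϖE ϖF α a s t (typeVector χ hχ ϖE s) =
          ((1 - (resCard F : ℂ)⁻¹) * ((1 - (resCard E : ℂ) ^ (-(2 * s + 1))) *
            (1 + (resCard F : ℂ) ^ (t - 1 / 2)))) •
            typeVector η (sq_eq_one_of_resChar_eq hχ hη) ϖF t)) := by
  have h : IsSqrtGenerator α a := ⟨hEF, hα, ha⟩
  refine ⟨h.existsUnique_isRenormalizedKernel hχ hϖ, h.existsUnique_hasKernel hχ hϖ s t,
    fun hη => ?_, fun hη => ⟨fun hq => ?_, fun hq => ?_⟩⟩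
  · obtain ⟨c, e, N, hn⟩ := exists_isNormalizing_of_ne (ϖE := ϖE) (ϖF := ϖF) hχ hη
    rw [h.renormalizedOperator_eq hχ hn]
    exact h.operator_typeVector_eq_zero hχ hn s t hη
  · have hn := h.isNormalizing_uniformizer hχ hϖ hη
    rcases hnorm with ⟨-, ha1, hodd⟩ | ⟨hq', -⟩
    · rw [h.renormalizedOperator_eq hχ hn, h.operator_typeVector_eq_smul hχ hn s t, one_mul,
        h.invFunctional_spherical_unramified hχ hη hq hodd ha1]
    -- The two residue degrees exclude each other: `q_F² = q_F` is impossible for `q_F > 1`.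
    · have h1 := one_lt_resCard (K := F)
      nlinarith
  · have hn := h.isNormalizing_uniformizer hχ hϖ hη
    rcases hnorm with ⟨hq', -, -⟩ | ⟨-, ha1⟩
    · have h1 := one_lt_resCard (K := F)
      nlinarith
    · rw [h.renormalizedOperator_eq hχ hn, h.operator_typeVector_eq_smul hχ hn s t, one_mul,
        h.invFunctional_spherical_ramified hχ hϖ hη hq ha1]
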